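/- **Setting.** Fix real parameters $\kappa_1<\dots<\kappa_n$ that are generic, i.e. for $1<p<n$ the sums of $p$ of them are pairwise distinct. Let $A$ be a full-rank real $k\times n$ matrix all of whose maximal minors $\Delta_J(A)$ are $\ge 0$, and put $\mathcal M=\{J\in\binom{[n]}{k}:\Delta_J(A)\neq 0\}$. Assume that $A$ is irreducible: its reduced row echelon form has no zero column, and each of its rows has a nonzero entry besides the pivot. For $r\in[n]$ let $I_r$ be the lexicographically minimal element of $\mathcal M$ for the order $r<r+1<\dots<n<1<\dots<r-1$. The cell $\mathcal S_\pi^{tnn}$ containing $A$ is indexed by the derangement $\pi\in S_n$ with $\pi(j)=i$ whenever $I_{i+1}=(I_i\setminus\{i\})\cup\{j\}$, $j\ne i$ (indices modulo $n$). Fix the times $t=t_3,t_4,\dots,t_m$, and let $K_J=\prod_{a<b;\ a,b\in J}(\kappa_b-\kappa_a)$ and $$f_A(x,y)=\max_{J\in\mathcal M}\Bigl\{\ln(\Delta_J(A)K_J)+\sum_{j\in J}\Bigl(\kappa_jx+\kappa_j^2y+\sum_{\ell=3}^m\kappa_j^\ell t_\ell\Bigr)\Bigr\}.$$ The *contour plot*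 is the locus in $\mathbb R^2$ where $f_A$ is not linear. Each region of its complement is labelled by the index set $J$ of its dominant term. A segment of the contour plot between regions labelled $B\cup\{i\}$ and $B\cup\{j\}$ (with $|B|=k-1$, $i<j$) is a *line-soliton of type $[i,j]$*; the other segments are *phase shifts*. An *X-crossing* of line-solitons of types $[i,j]$ and $[l,m]$ ($i,j,l,m$ distinct) is a place where the four regions labelled $B\cup\{i,l\}$, $B\cup\{j,l\}$, $B\cup\{j,m\}$, $B\cup\{i,m\}$ meet in this cyclic order, either in a single point or around one phase-shift segment that separates the first region from the third; such phase shifts are ignored, i.e. contracted. Assume that the contour plot is *generic*: every point where at least three regions meet is either a trivalent vertex where three line-solitons meet, or belongs to an X-crossing. The *soliton graph* $C$ consists of the line-solitons as edges (labelled by their types), the trivalent vertices, coloured black (white) if they have a unique edge extending downwards (upwards), the X-crossings (not regarded as vertices), one boundary vertex for each end at infinity of an unbounded line-soliton, and the regions labelled by their dominant exponentials. The graph $Pl(C)$ is obtained from $C$ by forgetting the labels of edges and regions and labelling by $\pi(i)$ the boundary vertex incident to the edge of type $\{i,\pi(i)\}$ (the unbounded line-soliton of this type at $y\gg0$ if $i<\pi(i)$,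 at $y\ll0$ if $\pi(i)<i$). In a graph in a disk with black and white internal vertices, X-crossings, and boundary vertices labelled $1,\dots,n$ in some order and each incident to one edge (a *generalized plabic graph*), the *trip* $T_i$ starts at the boundary vertex $i$, turns right at black vertices, turns left at white vertices and goes straight through X-crossings until it reaches a boundary vertex $j$; the *trip permutation* sends $i$ to $j$. **Theorem.** $Pl(C)$ is a generalized plabic graph with $n$ boundary vertices, labelled bijectively by $1,\dots,n$, and its trip permutation is $\pi$. For every edge of $C$, of type $[i,j]$, the trips that pass through this edge are exactly $T_i$ and $T_j$. Each trip $T_r$ divides the regions into those on its left and those on its right, and for every region of $C$, with dominant exponential $E_J$, the set of all $r$ such that the region is to the left of $T_r$ is exactly $J$. -/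

import Mathlib

open scoped Topology

/-! ### Points of the totally non-negative Grassmannian and their cells -/

/-- The maximal minor `Δ_J(A)` in the columns `J`, listed increasingly
(and `0` when `J` does not have `k` elements). -/
noncomputable def plueckerMinor {k n : ℕ} (A : Matrix (Fin k) (Fin n) ℝ)
    (J : Finset (Fin n)) : ℝ :=
  if h : J.card = k then (A.submatrix id (J.orderEmbOfFin h)).det else 0

open Classical in
/-- The set `𝓜` of all `k`-subsets `J` with `Δ_J(A) ≠ 0`. -/
noncomputable def columnMatroid {k n : ℕ} (A : Matrix (Fin k) (Fin n) ℝ) :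
    Finset (Finset (Fin n)) :=
  Finset.univ.filter fun J => plueckerMinor A J ≠ 0

/-- `A` has full rank and all its maximal minors are non-negative: it represents a point of the
totally non-negative Grassmannian. -/
def IsTotallyNonneg {k n : ℕ} (A : Matrix (Fin k) (Fin n) ℝ) : Prop :=
  A.rank = k ∧ ∀ J, 0 ≤ plueckerMinor A J

/-- `B` is a full rank matrix in reduced row echelon form, with pivot columns `p 0 < p 1 < ⋯`. -/
def IsReducedEchelon {k n : ℕ} (B : Matrix (Fin k) (Fin n) ℝ) (p : Fin k → Fin n) : Prop :=
  StrictMono p ∧ ∀ i, B i (p i) = 1 ∧ (∀ i', i' ≠ i → B i' (p i) = 0) ∧ ∀ j, j < p i → B i j = 0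

/-- The reduced row echelon form of `A` has no zero column, and each of its rows has a nonzero
entry besides the pivot. -/
def IsIrreduciblePoint {k n : ℕ} (A : Matrix (Fin k) (Fin n) ℝ) : Prop :=
  ∃ (U : Matrix (Fin k) (Fin k) ℝ) (p : Fin k → Fin n), IsUnit U.det ∧
    IsReducedEchelon (U * A) p ∧
    (∀ j, ∃ i, (U * A) i j ≠ 0) ∧ ∀ i, ∃ j, j ≠ p i ∧ (U * A) i j ≠ 0

/-- The position of `i` in the order `r < r+1 < ⋯ < n < 1 < ⋯ < r-1`. -/
def cyclicPos {n : ℕ} (r i : Fin n) : ℕ := (i.val + n - r.val) % n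

/-- `I` is the lexicographically minimal element of `M` for the order that starts at `r`: for any
other `J` in `M`, the smallest element that lies in exactly one of `I`, `J` lies in `I`. -/
def IsLexMin {n : ℕ} (M : Finset (Finset (Fin n))) (r : Fin n) (I : Finset (Fin n)) : Prop :=
  I ∈ M ∧ ∀ J ∈ M, J ≠ I → ∃ a ∈ I \ J, ∀ b ∈ J \ I, cyclicPos r a < cyclicPos r b

/-- `π` is the derangement of the cell of `A`: if `N` is the Grassmann necklace of lexicographically
minimal elements and `N (i+1) = (N i \ {i}) ∪ {j}` with `j ≠ i`, then `π j = i`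
(`i + 1` is taken modulo `n`). -/
def IsCellDerangement {k n : ℕ} (A : Matrix (Fin k) (Fin n) ℝ) (π : Equiv.Perm (Fin n)) : Prop :=
  ∃ N : Fin n → Finset (Fin n), (∀ r, IsLexMin (columnMatroid A) r (N r)) ∧
    ∀ i, ∃ j, j ≠ i ∧ N (finRotate n i) = insert j ((N i).erase i) ∧ π j = i

/-! ### Generalized plabic graphs, trips, and the labels they induce -/

/-- Boundary vertices, black and white internal vertices, and X-crossings. -/
inductive NodeKind
  | boundary
  | black
  | white
  | crossing

/-- The combinatorial data of a graph drawn in a disk with two-coloured internal vertices,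
X-crossings and boundary vertices labelled by `Fin n`.  An edge between two consecutive nodes is
represented by its two darts (orientations) `d` and `rev d`, and a node by the darts that leave it.

* `ccw d d'`: the darts `d` and `d'` leave the same node, and `d'` is the next one after `d` in
  counterclockwise order;
* `kind d`: the kind of the node from which `d` leaves;
* `left d`: the region on the left of `d`;
* `label d r`: `d` leaves a boundary vertex which is labelled `r`. -/
structure PlabicDiagram (n : ℕ) where
  Dart : Type
  Region : Type
  rev : Dart → Dart
  ccw : Dart → Dart → Prop
  kind : Dart → NodeKind
  left : Dart → Region
  label : Dart → Fin n → Prop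

namespace PlabicDiagram

variable {n : ℕ}

/-- The region on the right of a dart. -/
def right (G : PlabicDiagram n) (d : G.Dart) : G.Region := G.left (G.rev d)

/-- The data are those of a generalized plabic graph with `n` boundary vertices labelled
`1, …, n` in some order around the boundary. -/
structure IsGeneralizedPlabicGraph (G : PlabicDiagram n) : Prop where
  finite_dart : Finite G.Dart
  rev_rev : ∀ d, G.rev (G.rev d) = d
  rev_ne : ∀ d, G.rev d ≠ d
  exists_next : ∀ d, ∃! d', G.ccw d d'
  exists_prev : ∀ d', ∃! d, G.ccw d d'
  kind_eq : ∀ d d', G.ccw d d' → G.kind d' = G.kind d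
  /-- at an internal node, two consecutive darts bound a common region -/
  corner : ∀ d d', G.kind d ≠ NodeKind.boundary → G.ccw d d' → G.right d' = G.left d
  /-- each boundary vertex is incident to a single edge -/
  boundary_degree : ∀ d, G.kind d = NodeKind.boundary → G.ccw d d
  /-- exactly four half-edges meet at an X-crossing -/
  crossing_degree : ∀ d, G.kind d = NodeKind.crossing → ∃ a b c,
    [d, a, b, c].Nodup ∧ G.ccw d a ∧ G.ccw a b ∧ G.ccw b c ∧ G.ccw c d
  boundary_label : ∀ d, G.kind d = NodeKind.boundary → ∃! r, G.label d r
  exists_boundary : ∀ r, ∃! d, G.kind d = NodeKind.boundary ∧ G.label d r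

/-- The rules of the road: having traversed `d`, a trip continues along `d'`.  It turns right at a
black vertex, turns left at a white vertex, and goes straight through an X-crossing. -/
def Step (G : PlabicDiagram n) (d d' : G.Dart) : Prop :=
  match G.kind (G.rev d) with
  | NodeKind.boundary => False
  | NodeKind.black => G.ccw (G.rev d) d'
  | NodeKind.white => G.ccw d' (G.rev d)
  | NodeKind.crossing => ∃ e, G.ccw (G.rev d) e ∧ G.ccw e d'

/-- The trip which starts at the boundary vertex `r` traverses the dart `d`. -/
def OnTrip (G : PlabicDiagram n) (r : Fin n) (d : G.Dart) : Prop :=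
  ∃ d₀, G.kind d₀ = NodeKind.boundary ∧ G.label d₀ r ∧ Relation.ReflTransGen G.Step d₀ d

/-- The trip which starts at the boundary vertex `i` ends at the boundary vertex `j`. -/
def TripEndsAt (G : PlabicDiagram n) (i j : Fin n) : Prop :=
  ∃ d, G.OnTrip i d ∧ G.kind (G.rev d) = NodeKind.boundary ∧ G.label (G.rev d) j

/-- `σ` is the trip permutation. -/
def IsTripPermutation (G : PlabicDiagram n) (σ : Equiv.Perm (Fin n)) : Prop :=
  ∀ i j, G.TripEndsAt i j ↔ σ i = j

/-- The labels that the trips put on the edge of the dart `d`. -/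
def edgeLabels (G : PlabicDiagram n) (d : G.Dart) : Set (Fin n) :=
  {r | G.OnTrip r d ∨ G.OnTrip r (G.rev d)}

/-- Two regions are separated by an edge which does not belong to the trip that starts at `r`. -/
def AdjOffTrip (G : PlabicDiagram n) (r : Fin n) (R R' : G.Region) : Prop :=
  ∃ d, G.left d = R ∧ G.right d = R' ∧ r ∉ G.edgeLabels d

/-- The region `R` is in the part of the disk to the left of the trip that starts at `r`: it can be
reached, without crossing the trip, from a region that borders the trip on its left. -/
def IsLeftOfTrip (G : PlabicDiagram n) (r : Fin n) (R : G.Region) : Prop :=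
  ∃ d, G.OnTrip r d ∧ Relation.ReflTransGen (G.AdjOffTrip r) (G.left d) R

/-- The region `R` is in the part of the disk to the right of the trip that starts at `r`. -/
def IsRightOfTrip (G : PlabicDiagram n) (r : Fin n) (R : G.Region) : Prop :=
  ∃ d, G.OnTrip r d ∧ Relation.ReflTransGen (G.AdjOffTrip r) (G.right d) R

/-- The labels that the trips put in the region `R`. -/
def regionLabels (G : PlabicDiagram n) (R : G.Region) : Set (Fin n) :=
  {r | G.IsLeftOfTrip r R}

end PlabicDiagram

/-! ### Contour plots and soliton graphs -/

/-- The data of a soliton solution at a fixed time: parameters `κ`, a matrix `A`, and the values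
`time 3 = t`, `time 4`, …, `time m` of the time variables. -/
structure SolitonData (k n : ℕ) where
  κ : Fin n → ℝ
  A : Matrix (Fin k) (Fin n) ℝ
  m : ℕ
  time : ℕ → ℝ

namespace SolitonData

variable {k n : ℕ}

/-- `κ` is increasing, and for `1 < p < n` the sums of `p` of the `κ`s are distinct. -/
def GenericParameters (S : SolitonData k n) : Prop :=
  StrictMono S.κ ∧ ∀ I J : Finset (Fin n), I.card = J.card → 1 < I.card → I.card < n →
    ∑ i ∈ I, S.κ i = ∑ j ∈ J, S.κ j → I = J

/-- `K_J`, the product of the differences `κ_b - κ_a` over `a < b` in `J`. -/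
noncomputable def vandermonde (S : SolitonData k n) (J : Finset (Fin n)) : ℝ :=
  ∏ b ∈ J, ∏ a ∈ J.filter (· < b), (S.κ b - S.κ a)

/-- The exponent of `E_j` at the point `p = (x, y)`. -/
noncomputable def phase (S : SolitonData k n) (j : Fin n) (p : ℝ × ℝ) : ℝ :=
  S.κ j * p.1 + S.κ j ^ 2 * p.2 + ∑ l ∈ Finset.Icc 3 S.m, S.κ j ^ l * S.time l

/-- The logarithm of `Δ_J(A) E_J` at the point `p`. -/
noncomputable def term (S : SolitonData k n) (J : Finset (Fin n)) (p : ℝ × ℝ) : ℝ :=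
  Real.log (plueckerMinor S.A J * S.vandermonde J) + ∑ j ∈ J, S.phase j p

/-- The function `f_A` at the fixed time: the maximum over `J ∈ 𝓜` of the `term J`. -/
noncomputable def f (S : SolitonData k n) (p : ℝ × ℝ) : ℝ :=
  ⨆ J : {J // J ∈ columnMatroid S.A}, S.term J.1 p

/-- The contour plot: the locus where `f_A` is not (affine) linear. -/
def contourPlot (S : SolitonData k n) : Set (ℝ × ℝ) :=
  {p | ¬ ∃ a b c : ℝ, ∀ᶠ q in 𝓝 p, S.f q = a * q.1 + b * q.2 + c}

/-- The open set where `Δ_J E_J` is the dominant exponential. -/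
def domain (S : SolitonData k n) (J : Finset (Fin n)) : Set (ℝ × ℝ) :=
  {p | ∀ᶠ q in 𝓝 p, S.f q = S.term J q}

open Classical in
/-- The index sets of the dominant exponentials of the regions of the contour plot. -/
noncomputable def regions (S : SolitonData k n) : Finset (Finset (Fin n)) :=
  (columnMatroid S.A).filter fun J => (S.domain J).Nonempty

/-- Coefficients of `x` and `y` in `term J`. -/
noncomputable def gradient (S : SolitonData k n) (J : Finset (Fin n)) : ℝ × ℝ :=
  (∑ j ∈ J, S.κ j, ∑ j ∈ J, S.κ j ^ 2)

theorem term_eq (S : SolitonData k n) (J : Finset (Fin n)) (p : ℝ × ℝ) :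
    S.term J p = (S.gradient J).1 * p.1 + (S.gradient J).2 * p.2 + S.term J 0 := by
  simp only [term, phase, gradient, Finset.sum_add_distrib, Finset.sum_mul]
  simp
  ring

/-- The regions of the contour plot are the sets `domain J`. -/
theorem compl_contourPlot (S : SolitonData k n) (h : (columnMatroid S.A).Nonempty) :
    S.contourPlotᶜ = ⋃ J ∈ S.regions, S.domain J := by
  ext p
  simp only [contourPlot, Set.mem_compl_iff, Set.mem_ofPred_eq, not_not, Set.mem_iUnion, regions,
    Finset.mem_filter]
  constructor
  · rintro ⟨a, b, c, hp⟩
    have : Nonempty {J // J ∈ columnMatroid S.A} := ⟨⟨h.choose, h.choose_spec⟩⟩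
    obtain ⟨J, hJ⟩ := Finite.exists_max fun J : {J // J ∈ columnMatroid S.A} => S.term J.1 p
    have hfp : S.f p = S.term J.1 p :=
      le_antisymm (ciSup_le hJ) (le_ciSup (f := fun J : {J // J ∈ columnMatroid S.A} => S.term J.1 p)
        (Set.finite_range _).bddAbove J)
    have hle : ∀ q, S.term J.1 q ≤ S.f q := fun q =>
      le_ciSup (f := fun J : {J // J ∈ columnMatroid S.A} => S.term J.1 q)
        (Set.finite_range _).bddAbove J
    have hp0 := hp.self_of_nhds
    set g := S.gradient J.1 with hg
    have key : ∀ u v : ℝ, 0 ≤ (a - g.1) * u + (b - g.2) * v := by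
      intro u v
      have hc : Filter.Tendsto (fun s : ℝ => (p.1 + s * u, p.2 + s * v)) (𝓝[>] 0) (𝓝 p) := by
        have : Continuous fun s : ℝ => (p.1 + s * u, p.2 + s * v) := by fun_prop
        have h2 := this.tendsto 0
        simp only [zero_mul, add_zero] at h2
        exact h2.mono_left nhdsWithin_le_nhds
      obtain ⟨s, hs, hs0⟩ := ((hc.eventually hp).and self_mem_nhdsWithin).exists
      have hs0' : (0 : ℝ) < s := hs0
      have h1 := hle (p.1 + s * u, p.2 + s * v)
      rw [hs, S.term_eq] at h1
      rw [hfp, S.term_eq] at hp0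
      simp only [← hg] at h1 hp0
      have : 0 ≤ s * ((a - g.1) * u + (b - g.2) * v) := by nlinarith
      exact nonneg_of_mul_nonneg_right this hs0'
    have ha : a = g.1 := by
      have h1 := key 1 0
      have h2 := key (-1) 0
      linarith
    have hb : b = g.2 := by
      have h1 := key 0 1
      have h2 := key 0 (-1)
      linarith
    have hd : p ∈ S.domain J.1 := by
      filter_upwards [hp] with q hq
      rw [hfp, S.term_eq J.1 p, ← hg] at hp0
      rw [hq, S.term_eq J.1 q, ← hg, ha, hb]
      rw [ha, hb] at hp0
      linarith
    exact ⟨J.1, ⟨J.2, p, hd⟩, hd⟩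
  · rintro ⟨J, -, hd⟩
    exact ⟨(S.gradient J).1, (S.gradient J).2, S.term J 0, hd.mono fun q hq => by
      rw [hq, S.term_eq]⟩

open Classical in
/-- The index sets of the regions whose closures contain `p`. -/
noncomputable def regionsAt (S : SolitonData k n) (p : ℝ × ℝ) : Finset (Finset (Fin n)) :=
  S.regions.filter fun J => S.term J p = S.f p

/-- The relatively open segment, ray or line of the contour plot that separates the regions of
`I` and `J`. -/
def wall (S : SolitonData k n) (I J : Finset (Fin n)) : Set (ℝ × ℝ) :=
  {p | S.regionsAt p = {I, J}}

/-- The regions of `I` and `J` are adjacent along a line-soliton, that is, the two dominant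
exponentials differ in exactly one index.  (A segment between regions which differ in more than one
index is a phase shift.) -/
def IsLineSoliton (S : SolitonData k n) (I J : Finset (Fin n)) : Prop :=
  I ∈ S.regions ∧ J ∈ S.regions ∧ (I \ J).card = 1 ∧ (S.wall I J).Nonempty

/-- Three line-solitons, and nothing else, meet at `p`. -/
def IsTrivalentVertex (S : SolitonData k n) (p : ℝ × ℝ) : Prop :=
  (S.regionsAt p).card = 3 ∧ ∀ I ∈ S.regionsAt p, ∀ J ∈ S.regionsAt p, I ≠ J → (I \ J).card = 1

/-- Two line-solitons, of types `[i, j]` and `[l, m]`, cross over each other at the points `p` and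
`q`: the four regions around the crossing are, in cyclic order, those of `B ∪ {i, l}`, `B ∪ {j, l}`,
`B ∪ {j, m}`, `B ∪ {i, m}`.  Either `p = q` and the four regions meet in this point, or `p` and `q`
are the two ends of the phase shift that separates `B ∪ {i, l}` from `B ∪ {j, m}`. -/
def IsXCrossing (S : SolitonData k n) (p q : ℝ × ℝ) : Prop :=
  ∃ (B : Finset (Fin n)) (i j l m : Fin n),
    [i, j, l, m].Nodup ∧ i ∉ B ∧ j ∉ B ∧ l ∉ B ∧ m ∉ B ∧
    ((p = q ∧ S.regionsAt p =
        {insert i (insert l B), insert j (insert l B), insert j (insert m B),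
          insert i (insert m B)}) ∨
      (p ≠ q ∧
        S.regionsAt p = {insert i (insert l B), insert j (insert l B), insert j (insert m B)} ∧
        S.regionsAt q = {insert i (insert l B), insert i (insert m B), insert j (insert m B)}))

/-- The contour plot is generic: all interactions of line-solitons are at trivalent vertices or are
X-crossings (where phase shifts are ignored). -/
def IsGeneric (S : SolitonData k n) : Prop :=
  ∀ p, 3 ≤ (S.regionsAt p).card → S.IsTrivalentVertex p ∨ ∃ q, S.IsXCrossing p q

/-- The regions of the soliton graph. -/
def Region (S : SolitonData k n) : Type := {J : Finset (Fin n) // J ∈ S.regions}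

/-- The edges of the soliton graph with an orientation: the region of `d.1.1` is on the left, and
that of `d.1.2` on the right.  Edges are line-solitons up to the next vertex or X-crossing. -/
def Dart (S : SolitonData k n) : Type :=
  {d : Finset (Fin n) × Finset (Fin n) // S.IsLineSoliton d.1 d.2}

theorem IsLineSoliton.symm {S : SolitonData k n} {I J : Finset (Fin n)}
    (h : S.IsLineSoliton I J) : S.IsLineSoliton J I := by
  obtain ⟨hI, hJ, h1, h2⟩ := h
  have hc : ∀ L ∈ S.regions, L.card = k := by
    intro L hL
    simp only [regions, columnMatroid, Finset.mem_filter, plueckerMinor] at hL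
    by_contra hne
    simp [hne] at hL
  refine ⟨hJ, hI, ?_, ?_⟩
  · rw [← h1]
    exact Finset.card_sdiff_comm ((hc J hJ).trans (hc I hI).symm)
  · simpa only [wall, Finset.pair_comm] using h2

namespace Dart

variable {S : SolitonData k n}

/-- The edge with the opposite orientation. -/
def rev (d : S.Dart) : S.Dart := ⟨(d.1.2, d.1.1), d.2.symm⟩

/-- The direction of travel: a quarter turn to the right of the vector `gradient I - gradient J`,
which points from the region of `J` to the region of `I`. -/
noncomputable def direction (d : S.Dart) : ℝ × ℝ :=
  ((S.gradient d.1.1).2 - (S.gradient d.1.2).2, -((S.gradient d.1.1).1 - (S.gradient d.1.2).1))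

/-- The segment starts at the point `p`. -/
def StartsAt (d : S.Dart) (p : ℝ × ℝ) : Prop :=
  p ∉ S.wall d.1.1 d.1.2 ∧
    ∃ ε > (0 : ℝ), ∀ s, 0 < s → s < ε → p + s • d.direction ∈ S.wall d.1.1 d.1.2

/-- The line-soliton is unbounded, and the dart comes in from infinity along it. -/
def FromInfinity (d : S.Dart) : Prop :=
  ∀ p ∈ S.wall d.1.1 d.1.2, ∀ s : ℝ, 0 ≤ s → p - s • d.direction ∈ S.wall d.1.1 d.1.2

/-- The two darts leave the same trivalent vertex or the same X-crossing. -/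
def SameOrigin (d d' : S.Dart) : Prop :=
  ∃ p q, d.StartsAt p ∧ d'.StartsAt q ∧ (p = q ∨ S.IsXCrossing p q)

open Classical in
/-- The kind of the node which a dart leaves.  A trivalent vertex is black if it has a unique edge
extending downwards from it; otherwise it has a unique edge extending upwards, and is white. -/
noncomputable def kind (d : S.Dart) : NodeKind :=
  if d.FromInfinity then NodeKind.boundary
  else if ∃ p q, d.StartsAt p ∧ S.IsXCrossing p q then NodeKind.crossing
  else if ∃! d' : S.Dart, d.SameOrigin d' ∧ d'.direction.2 < 0 then NodeKind.black
  else NodeKind.white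

/-- The type `{i, j}` of the line-soliton. -/
def solitonType (d : S.Dart) : Finset (Fin n) := symmDiff d.1.1 d.1.2

end Dart

/-- The generalized plabic graph `Pl(C)` of the soliton graph `C`.  The next dart counterclockwise
after `d` around an internal node is the one which has on its right the region to the left of `d`.
The boundary vertex of the edge `{i, π i}` is labelled `π i`; the edge `{i, π i}` is the
unbounded line-soliton of that type at `y ≫ 0` if `i < π i`, and at `y ≪ 0` if `π i < i`. -/
noncomputable def plabic (S : SolitonData k n) (π : Equiv.Perm (Fin n)) : PlabicDiagram n where
  Dart := S.Dart
  Region := S.Region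
  rev := Dart.rev
  ccw d d' := (d.FromInfinity ∧ d' = d) ∨ (d.SameOrigin d' ∧ d'.1.2 = d.1.1)
  kind := Dart.kind
  left d := ⟨d.1.1, d.2.1⟩
  label d r := d.FromInfinity ∧ ∃ i, d.solitonType = {i, r} ∧ π i = r ∧
    ((d.direction.2 < 0 ∧ i < r) ∨ (0 < d.direction.2 ∧ r < i))

end SolitonData

/-! ### Bases and locally maximal bases of the column matroid -/

/-! The two regions beside an oriented edge are `B ∪ {r}` on the left and `B ∪ {i}` on the right, so
every dart carries exactly one index `r`, and its reversal carries `i`. Everything follows from one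
claim (`onTrip_iff`): the trip that starts at `r` consists of exactly the darts that carry `r`.
Three facts prove it.

Local rule. By genericity, a node is dual to a convex polygon whose vertices are the gradients of
the regions around it. The gradients of `B ∪ {x}`, for three values of `x`, are a translate of three
points of the parabola `(κ, κ²)`; those of `B \ {x}` are a point reflection of such a triangle.
Hence the indices increase counterclockwise up to rotation, and the first case is white, the second
black. An X-crossing is dual to a parallelogram. In each case the rules of the road lead a dart
carrying `r` to a dart carrying `r` (`step_carries_iff`).

Behaviour at infinity. Along a ray on which the exponents of `r` and `i` grow equally fast, the
growth rate is quadratic in `κ_e`, and the indices that grow faster than `r` and `i` form the cyclic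
arc from `r` to `i`. The dominant sets far out are greedy bases for this rate, and so are the
necklace bases for the cyclic orders. Comparing spans of columns shows that the incoming unbounded
darts that carry `r` are of type `{i, r}` with `π i = r`, and that exactly one exists for each `r`
(`Dart.FromInfinity.exists_insert`, `exists_fromInfinity`, `Dart.FromInfinity.carries_unique`).

No closed paths. The polygons dual to the nodes have disjoint interiors, since they lie in
subdifferentials of a convex function. A dart carrying `r` is dual to an edge which is crossed by
the vector `(1, 2κ_r)`, the tangent of the parabola at `r`: it leads from the tile at the end of the
dart to the tile at its start. Translation in a fixed direction orders disjoint bounded open convex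
sets of the plane without cycles (`not_transGen_isAbove`), so no path of darts carrying `r` closes
up. Followed backwards, such a path comes from infinity at the vertex labelled `r`; followed
forwards, it leaves along an edge of type `{r, π r}`, hence ends at the label `π r`.

For the region labels, membership of `r` changes only across edges of the trip of `r`. All regions
are connected through line-solitons, because phase shifts are bounded
(`reflTransGen_isLineSoliton`). So a region whose set contains `r` is joined, off the trip, to one
that borders it on the left, and the other regions to one on the right. -/

theorem mem_columnMatroid {k n : ℕ} {A : Matrix (Fin k) (Fin n) ℝ} {J : Finset (Fin n)} :
    J ∈ columnMatroid A ↔ J.card = k ∧ LinearIndepOn ℝ A.col (J : Set (Fin n)) := by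
  classical
  rw [columnMatroid, Finset.mem_filter]
  by_cases h : J.card = k
  · simp only [Finset.mem_univ, true_and, plueckerMinor, h, dite_true]
    rw [← isUnit_iff_ne_zero, ← Matrix.isUnit_iff_isUnit_det,
      ← Matrix.linearIndependent_cols_iff_isUnit]
    have hr : Set.range (J.orderEmbOfFin h) = (J : Set (Fin n)) := Finset.range_orderEmbOfFin J h
    rw [← hr, linearIndepOn_range_iff (J.orderEmbOfFin h).injective]
    rfl
  · simp [h, plueckerMinor]

theorem card_of_mem_columnMatroid {k n : ℕ} {A : Matrix (Fin k) (Fin n) ℝ} {J : Finset (Fin n)}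
    (hJ : J ∈ columnMatroid A) : J.card = k := (mem_columnMatroid.1 hJ).1

theorem col_ne_zero_of_isIrreduciblePoint {k n : ℕ} {A : Matrix (Fin k) (Fin n) ℝ}
    (h : IsIrreduciblePoint A) (j : Fin n) : A.col j ≠ 0 := by
  obtain ⟨U, p, -, -, h1, -⟩ := h
  obtain ⟨i, hi⟩ := h1 j
  intro h0
  apply hi
  rw [Matrix.mul_apply]
  refine Finset.sum_eq_zero fun x _ => ?_
  have : A x j = 0 := congrFun h0 x
  rw [this, mul_zero]

/-- `I` is a basis of the column matroid that no single exchange improves, for the weights `w`. -/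
def IsLocallyMaximal {k n : ℕ} (A : Matrix (Fin k) (Fin n) ℝ) (w : Fin n → ℝ)
    (I : Finset (Fin n)) : Prop :=
  I ∈ columnMatroid A ∧
    ∀ f ∈ I, ∀ e, e ∉ I → insert e (I.erase f) ∈ columnMatroid A → w e ≤ w f

theorem col_notMem_span_sdiff {k n : ℕ} {A : Matrix (Fin k) (Fin n) ℝ} {I : Finset (Fin n)}
    (hI : I ∈ columnMatroid A) {e : Fin n} (he : e ∈ I) :
    A.col e ∉ Submodule.span ℝ (A.col '' ((I : Set (Fin n)) \ {e})) := by
  have hl := (mem_columnMatroid.1 hI).2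
  have : (I : Set (Fin n)) = insert e ((I : Set (Fin n)) \ {e}) := by
    rw [Set.insert_sdiff_singleton, Set.insert_eq_of_mem (by exact_mod_cast he)]
  rw [this, linearIndepOn_insert (by simp)] at hl
  exact hl.2

theorem span_col_eq_top {k n : ℕ} {A : Matrix (Fin k) (Fin n) ℝ} {I : Finset (Fin n)}
    (hI : I ∈ columnMatroid A) : Submodule.span ℝ (A.col '' (I : Set (Fin n))) = ⊤ := by
  obtain ⟨hc, hl⟩ := mem_columnMatroid.1 hI
  rw [Set.image_eq_range]
  apply LinearIndependent.span_eq_top_of_card_eq_finrank' hl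
  simp [hc]

theorem insert_erase_mem_columnMatroid {k n : ℕ} {A : Matrix (Fin k) (Fin n) ℝ}
    {I : Finset (Fin n)} (hI : I ∈ columnMatroid A) {e f : Fin n} (hf : f ∈ I) (he : e ∉ I)
    (h : A.col e ∉ Submodule.span ℝ (A.col '' ((I : Set (Fin n)) \ {f}))) :
    insert e (I.erase f) ∈ columnMatroid A := by
  obtain ⟨hc, hl⟩ := mem_columnMatroid.1 hI
  rw [mem_columnMatroid]
  constructor
  · rw [Finset.card_insert_of_notMem (fun h => he (Finset.mem_of_mem_erase h)),
      Finset.card_erase_add_one hf, hc]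
  · rw [Finset.coe_insert, Finset.coe_erase, linearIndepOn_insert (fun h => he h.1)]
    exact ⟨hl.mono Set.sdiff_subset, h⟩

namespace IsLocallyMaximal

variable {k n : ℕ} {A : Matrix (Fin k) (Fin n) ℝ} {w : Fin n → ℝ} {I : Finset (Fin n)}

/-- Expand the column of `e` in the basis `I`. If `f` has a nonzero coefficient, then `f` can be
exchanged for `e`, and local maximality forces `w e ≤ w f`. -/
theorem col_mem_span (h : IsLocallyMaximal A w I) (e : Fin n) :
    A.col e ∈ Submodule.span ℝ (A.col '' {f | f ∈ I ∧ w e ≤ w f}) := by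
  by_cases he : e ∈ I
  · exact Submodule.subset_span ⟨e, ⟨he, le_rfl⟩, rfl⟩
  have htop : A.col e ∈ Submodule.span ℝ (A.col '' (I : Set (Fin n))) := by
    rw [span_col_eq_top h.1]; trivial
  obtain ⟨l, hl, hle⟩ := (Finsupp.mem_span_image_iff_linearCombination ℝ).1 htop
  refine (Finsupp.mem_span_image_iff_linearCombination ℝ).2 ⟨l, ?_, hle⟩
  rw [Finsupp.mem_supported] at hl ⊢
  intro f hf
  refine ⟨hl hf, ?_⟩
  by_contra hlt
  refine hlt (h.2 f (hl hf) e he (insert_erase_mem_columnMatroid h.1 (hl hf) he fun hs => ?_))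
  obtain ⟨l', hl', hle'⟩ := (Finsupp.mem_span_image_iff_linearCombination ℝ).1 hs
  rw [Finsupp.mem_supported] at hl'
  have : l' = l := by
    refine sub_eq_zero.1 (linearIndepOn_iff.1 (mem_columnMatroid.1 h.1).2 _ (Submodule.sub_mem _
      ((Finsupp.mem_supported _ _).2 (hl'.trans Set.sdiff_subset))
      ((Finsupp.mem_supported _ _).2 hl)) ?_)
    rw [map_sub, hle', hle, sub_self]
  subst this
  exact (hl' hf).2 rfl

/-- A basis element is not spanned by basis elements of larger weight, nor by any columns that
are at least as heavy as such basis elements. -/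
theorem col_notMem_span (h : IsLocallyMaximal A w I) {e : Fin n} (he : e ∈ I) {s : Set (Fin n)}
    (hs : ∀ f ∈ s, w e < w f) : A.col e ∉ Submodule.span ℝ (A.col '' s) := by
  intro hmem
  have hle : Submodule.span ℝ (A.col '' s) ≤ Submodule.span ℝ (A.col '' ((I : Set (Fin n)) \ {e})) := by
    rw [Submodule.span_le]
    rintro _ ⟨f, hf, rfl⟩
    refine Submodule.span_mono (Set.image_mono ?_) (h.col_mem_span f)
    rintro g ⟨hg, hfg⟩
    refine ⟨hg, ?_⟩
    rintro rfl
    exact absurd (hs f hf) (not_lt.2 hfg)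
  exact col_notMem_span_sdiff h.1 he (hle hmem)

/-- The criterion does not mention `I`, so locally maximal bases for the same weights can differ
only in indices that are tied with others. -/
theorem mem_iff (h : IsLocallyMaximal A w I) {e : Fin n} (hw : ∀ f, w f = w e → f = e) :
    e ∈ I ↔ A.col e ∉ Submodule.span ℝ (A.col '' {f | w e < w f}) := by
  refine ⟨fun he => h.col_notMem_span he fun f hf => hf, fun hn => ?_⟩
  by_contra he
  refine hn (Submodule.span_mono (Set.image_mono ?_) (h.col_mem_span e))
  rintro f ⟨hf, hle⟩
  refine lt_of_le_of_ne hle fun heq => he ?_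
  rwa [← hw f heq.symm]

end IsLocallyMaximal

/-! ### The Grassmann necklace and the derangement -/

theorem cyclicPos_eq {n : ℕ} (r i : Fin n) :
    cyclicPos r i = if r ≤ i then i.val - r.val else i.val + n - r.val := by
  have h1 := r.2
  have h2 := i.2
  unfold cyclicPos
  split_ifs with h
  · have h : r.val ≤ i.val := h
    rw [show i.val + n - r.val = (i.val - r.val) + n by omega, Nat.add_mod_right,
      Nat.mod_eq_of_lt (by omega)]
  · have h : ¬ r.val ≤ i.val := h
    exact Nat.mod_eq_of_lt (by omega)

/-- Starting the cyclic order one step later only moves `i` from the first place to the last. -/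
theorem cyclicPos_finRotate {n : ℕ} (i f : Fin n) :
    cyclicPos (finRotate n i) f = if f = i then n - 1 else cyclicPos i f - 1 := by
  cases n with
  | zero => exact i.elim0
  | succ n =>
    have h1 := i.2
    have h2 := f.2
    have hr : (finRotate (n + 1) i).val = if i = Fin.last n then 0 else i.val + 1 := by
      rw [coe_finRotate]
    simp only [cyclicPos_eq, Fin.le_def, Fin.ext_iff, hr, Fin.val_last]
    split_ifs <;> omega

/-- The elements that come strictly between `i` and `j` when one goes up cyclically from `i`. -/
def cyclicArc {n : ℕ} (i j : Fin n) : Set (Fin n) := {f | f ≠ i ∧ cyclicPos i f < cyclicPos i j}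

theorem mem_cyclicArc {n : ℕ} {i j f : Fin n} (hij : i ≠ j) :
    f ∈ cyclicArc i j ↔ (i < j ∧ i < f ∧ f < j) ∨ (j < i ∧ (i < f ∨ f < j)) := by
  have h1 := i.2
  have h2 := f.2
  have h3 := j.2
  have hij' : i.val ≠ j.val := fun h => hij (Fin.ext h)
  simp only [cyclicArc, Set.mem_ofPred_eq, cyclicPos_eq, Fin.le_def, Fin.lt_def, ne_eq, Fin.ext_iff]
  split_ifs <;> omega

/-- With minus the cyclic position as weight, necklace bases fall under the same greedy criterion as
the dominant sets at infinity. -/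
theorem IsLexMin.isLocallyMaximal {k n : ℕ} {A : Matrix (Fin k) (Fin n) ℝ} {r : Fin n}
    {I : Finset (Fin n)} (h : IsLexMin (columnMatroid A) r I) :
    IsLocallyMaximal A (fun e => -(cyclicPos r e : ℝ)) I := by
  refine ⟨h.1, fun f hf e he hJ => ?_⟩
  have hef : e ≠ f := fun h => he (h ▸ hf)
  have hne : insert e (I.erase f) ≠ I := by
    intro h
    exact he (h ▸ Finset.mem_insert_self _ _)
  obtain ⟨a, ha, hb⟩ := h.2 _ hJ hne
  simp only [Finset.mem_sdiff, Finset.mem_insert, Finset.mem_erase, not_or, not_and] at ha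
  have haf : a = f := by
    by_contra hne
    exact ha.2.2 hne ha.1
  have := hb e (by simp [he])
  subst haf
  simp only [neg_le_neg_iff, Nat.cast_le]
  exact this.le

theorem cyclicPos_injective {n : ℕ} (r : Fin n) : Function.Injective (cyclicPos r) := by
  intro a b h
  have h1 := r.2
  have h2 := a.2
  have h3 := b.2
  simp only [cyclicPos_eq, Fin.le_def] at h
  apply Fin.ext
  split_ifs at h <;> omega

theorem IsLexMin.mem_iff {k n : ℕ} {A : Matrix (Fin k) (Fin n) ℝ} {r : Fin n}
    {I : Finset (Fin n)} (h : IsLexMin (columnMatroid A) r I) (e : Fin n) :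
    e ∈ I ↔ A.col e ∉ Submodule.span ℝ (A.col '' {f | cyclicPos r f < cyclicPos r e}) := by
  rw [h.isLocallyMaximal.mem_iff (e := e)]
  · simp
  · intro f hf
    simp only [neg_inj, Nat.cast_inj] at hf
    exact cyclicPos_injective r hf

theorem IsCellDerangement.apply_ne {k n : ℕ} {A : Matrix (Fin k) (Fin n) ℝ}
    {π : Equiv.Perm (Fin n)} (hπ : IsCellDerangement A π) (j : Fin n) : π j ≠ j := by
  obtain ⟨N, -, h⟩ := hπ
  obtain ⟨j', h1, -, h2⟩ := h (π j)
  rw [π.injective h2] at h1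
  exact h1.symm

/-- The derangement is determined by the spans of the columns in cyclic intervals. -/
theorem IsCellDerangement.apply_eq_iff {k n : ℕ} {A : Matrix (Fin k) (Fin n) ℝ}
    {π : Equiv.Perm (Fin n)} (hπ : IsCellDerangement A π) (h0 : ∀ j, A.col j ≠ 0) {i j : Fin n}
    (hij : j ≠ i) :
    π j = i ↔ A.col j ∈ Submodule.span ℝ (A.col '' insert i (cyclicArc i j)) ∧
      A.col j ∉ Submodule.span ℝ (A.col '' cyclicArc i j) := by
  obtain ⟨N, hN, h⟩ := hπ
  have hpos : ∀ j, j ≠ i → cyclicPos i i < cyclicPos i j := by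
    intro j hij
    have h1 := i.2
    have h2 := j.2
    have hij' : i.val ≠ j.val := fun h => hij (Fin.ext h.symm)
    simp only [cyclicPos_eq, Fin.le_def]
    split_ifs <;> omega
  have e1 : ∀ j, j ≠ i → {f | cyclicPos i f < cyclicPos i j} = insert i (cyclicArc i j) := by
    intro j hij
    ext f
    simp only [cyclicArc, Set.mem_ofPred_eq, Set.mem_insert_iff]
    by_cases hf : f = i
    · simp [hf, hpos j hij]
    · simp [hf]
  have e2 : ∀ j, j ≠ i → {f | cyclicPos (finRotate n i) f < cyclicPos (finRotate n i) j} = cyclicArc i j := by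
    intro j hij
    ext f
    have hlt : cyclicPos i j < n := Nat.mod_lt _ i.pos
    have hj := hpos j hij
    simp only [cyclicArc, Set.mem_ofPred_eq, cyclicPos_finRotate, hij, if_false]
    split_ifs with hf
    · simp only [hf, ne_eq, not_true, false_and, iff_false]; omega
    · have := hpos f hf
      simp only [hf, ne_eq, not_false_eq_true, true_and]; omega
  have m1 : ∀ j, j ≠ i → (j ∈ N i ↔ A.col j ∉ Submodule.span ℝ (A.col '' insert i (cyclicArc i j))) :=
    fun j hij => by rw [(hN i).mem_iff, e1 j hij]
  have m2 : ∀ j, j ≠ i → (j ∈ N (finRotate n i) ↔ A.col j ∉ Submodule.span ℝ (A.col '' cyclicArc i j)) :=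
    fun j hij => by rw [(hN _).mem_iff, e2 j hij]
  -- `i` comes first in its own order, so it lies in the basis as soon as its column is nonzero.
  have hi : i ∈ N i := by
    rw [(hN i).mem_iff]
    have : {f | cyclicPos i f < cyclicPos i i} = ∅ := by
      ext f
      simp [cyclicPos_eq]
    rw [this]
    simpa using h0 i
  obtain ⟨j₀, hj₀, hN', hπ₀⟩ := h i
  -- Otherwise the next necklace element would have only `k - 1` members.
  have hj₀' : j₀ ∉ N i := by
    intro hmem
    have hc := card_of_mem_columnMatroid (hN (finRotate n i)).1
    have hc' := card_of_mem_columnMatroid (hN i).1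
    rw [hN', Finset.insert_eq_of_mem (Finset.mem_erase.2 ⟨hj₀, hmem⟩)] at hc
    have := Finset.card_erase_add_one hi
    omega
  constructor
  · intro hj
    have : j = j₀ := π.injective (hj.trans hπ₀.symm)
    subst this
    refine ⟨not_not.1 fun hn => hj₀' ((m1 j hij).2 hn), (m2 j hij).1 ?_⟩
    rw [hN']
    exact Finset.mem_insert_self _ _
  · rintro ⟨ha, hb⟩
    have h1 : j ∉ N i := fun hm => (m1 j hij).1 hm ha
    have h2 := (m2 j hij).2 hb
    rw [hN', Finset.mem_insert, Finset.mem_erase] at h2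
    rcases h2 with rfl | h2
    · exact hπ₀
    · exact absurd h2.2 h1

/-! ### The dominant terms near a point -/

/-- The standard bilinear form of the plane. -/
def planeDot (a b : ℝ × ℝ) : ℝ := a.1 * b.1 + a.2 * b.2

namespace SolitonData

variable {k n : ℕ} {S : SolitonData k n}

/-- The column matroid has a basis, and the terms of `f` have pairwise distinct `x`-slopes. -/
structure HasDistinctSlopes (S : SolitonData k n) : Prop where
  nonempty : (columnMatroid S.A).Nonempty
  inj : ∀ I ∈ columnMatroid S.A, ∀ J ∈ columnMatroid S.A,
    (S.gradient I).1 = (S.gradient J).1 → I = J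

theorem term_eq_add (S : SolitonData k n) (J : Finset (Fin n)) (p q : ℝ × ℝ) :
    S.term J q = S.term J p + planeDot (S.gradient J) (q - p) := by
  rw [S.term_eq J q, S.term_eq J p, planeDot]
  simp only [Prod.fst_sub, Prod.snd_sub]
  ring

theorem term_add_smul (S : SolitonData k n) (J : Finset (Fin n)) (p v : ℝ × ℝ) (s : ℝ) :
    S.term J (p + s • v) = S.term J p + s * planeDot (S.gradient J) v := by
  rw [S.term_eq J, S.term_eq J p, planeDot]
  simp only [Prod.fst_add, Prod.snd_add, Prod.smul_fst, Prod.smul_snd, smul_eq_mul]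
  ring

theorem continuous_term (S : SolitonData k n) (J : Finset (Fin n)) : Continuous (S.term J) := by
  have : S.term J = fun p => (S.gradient J).1 * p.1 + (S.gradient J).2 * p.2 + S.term J 0 :=
    funext (S.term_eq J)
  rw [this]
  fun_prop

theorem term_le_f {J : Finset (Fin n)} (hJ : J ∈ columnMatroid S.A) (p : ℝ × ℝ) :
    S.term J p ≤ S.f p :=
  le_ciSup (f := fun J : {J // J ∈ columnMatroid S.A} => S.term J.1 p)
    (Set.finite_range _).bddAbove ⟨J, hJ⟩

theorem exists_term_eq_f (hS : S.HasDistinctSlopes) (p : ℝ × ℝ) :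
    ∃ J ∈ columnMatroid S.A, S.term J p = S.f p := by
  have : Nonempty {J // J ∈ columnMatroid S.A} := ⟨⟨_, hS.nonempty.choose_spec⟩⟩
  obtain ⟨J, hJ⟩ := Finite.exists_max fun J : {J // J ∈ columnMatroid S.A} => S.term J.1 p
  exact ⟨J.1, J.2, le_antisymm (term_le_f J.2 p) (ciSup_le hJ)⟩

theorem mem_regions_of_forall_lt (hS : S.HasDistinctSlopes) {J : Finset (Fin n)}
    (hJ : J ∈ columnMatroid S.A) {x : ℝ × ℝ}
    (h : ∀ J' ∈ columnMatroid S.A, J' ≠ J → S.term J' x < S.term J x) : J ∈ S.regions := by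
  classical
  rw [regions, Finset.mem_filter]
  refine ⟨hJ, x, ?_⟩
  have : ∀ᶠ q in 𝓝 x, ∀ J' ∈ columnMatroid S.A, J' ≠ J → S.term J' q < S.term J q := by
    rw [Filter.eventually_all_finset]
    intro J' hJ'
    by_cases hne : J' = J
    · simp [hne]
    · filter_upwards [(S.continuous_term J').continuousAt.eventually_lt
        (S.continuous_term J).continuousAt (h J' hJ' hne)] with q hq _ using hq
  filter_upwards [this] with q hq
  obtain ⟨L, hL, hLf⟩ := exists_term_eq_f hS q
  by_cases hne : L = J
  · rw [← hLf, hne]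
  · exact absurd (hq L hL hne) (not_lt.2 (hLf ▸ term_le_f hJ q))

theorem mem_columnMatroid_of_mem_regions {J : Finset (Fin n)} (hJ : J ∈ S.regions) :
    J ∈ columnMatroid S.A := by
  classical
  exact (Finset.mem_filter.1 hJ).1

theorem mem_regionsAt {J : Finset (Fin n)} {p : ℝ × ℝ} :
    J ∈ S.regionsAt p ↔ J ∈ S.regions ∧ S.term J p = S.f p := by
  classical
  exact Finset.mem_filter

theorem mem_columnMatroid_of_mem_regionsAt {J : Finset (Fin n)} {p : ℝ × ℝ}
    (hJ : J ∈ S.regionsAt p) : J ∈ columnMatroid S.A :=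
  mem_columnMatroid_of_mem_regions (mem_regionsAt.1 hJ).1

/-- A term that attains the maximum at `p` and grows fastest in some direction among these is
dominant in a region. -/
theorem mem_regionsAt_of_forall_lt (hS : S.HasDistinctSlopes) {J : Finset (Fin n)}
    (hJ : J ∈ columnMatroid S.A) {p : ℝ × ℝ} (hp : S.term J p = S.f p) (u : ℝ × ℝ)
    (h : ∀ J' ∈ columnMatroid S.A, S.term J' p = S.f p → J' ≠ J →
      planeDot (S.gradient J') u < planeDot (S.gradient J) u) : J ∈ S.regionsAt p := by
  refine mem_regionsAt.2 ⟨?_, hp⟩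
  have hc : ∀ L : Finset (Fin n), Filter.Tendsto (fun s : ℝ => S.term L (p + s • u)) (𝓝[>] 0)
      (𝓝 (S.term L p)) := by
    intro L
    have : Continuous fun s : ℝ => S.term L (p + s • u) :=
      (S.continuous_term L).comp (by fun_prop)
    have h2 := this.tendsto 0
    simp only [zero_smul, add_zero] at h2
    exact h2.mono_left nhdsWithin_le_nhds
  have : ∀ᶠ s in 𝓝[>] (0 : ℝ), ∀ J' ∈ columnMatroid S.A, J' ≠ J →
      S.term J' (p + s • u) < S.term J (p + s • u) := by
    rw [Filter.eventually_all_finset]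
    intro J' hJ'
    rcases (term_le_f hJ' p).lt_or_eq with hlt | heq
    · rw [← hp] at hlt
      filter_upwards [(hc J').eventually_lt (hc J) hlt] with s hs _ using hs
    · filter_upwards [self_mem_nhdsWithin] with s hs hne
      have hs : (0 : ℝ) < s := hs
      rw [term_add_smul, term_add_smul, heq, hp]
      have := mul_lt_mul_of_pos_left (h J' hJ' heq hne) hs
      linarith
  obtain ⟨s, hs⟩ := this.exists
  exact mem_regions_of_forall_lt hS hJ hs

theorem regionsAt_nonempty (hS : S.HasDistinctSlopes) (p : ℝ × ℝ) : (S.regionsAt p).Nonempty := by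
  classical
  have hne : ((columnMatroid S.A).filter fun J => S.term J p = S.f p).Nonempty := by
    obtain ⟨J, hJ, h⟩ := exists_term_eq_f hS p
    exact ⟨J, Finset.mem_filter.2 ⟨hJ, h⟩⟩
  -- Among the terms that are maximal at `p`, slopes being distinct, the one with the largest
  -- `x`-slope wins alone just to the right of `p`.
  obtain ⟨J, hJ, hmax⟩ := Finset.exists_max_image _ (fun J => (S.gradient J).1) hne
  obtain ⟨hJM, hJp⟩ := Finset.mem_filter.1 hJ
  refine ⟨J, mem_regionsAt_of_forall_lt hS hJM hJp (1, 0) fun J' hJ' hp' hne' => ?_⟩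
  have h1 := hmax J' (Finset.mem_filter.2 ⟨hJ', hp'⟩)
  have h2 : (S.gradient J').1 ≠ (S.gradient J).1 := fun h => hne' (hS.inj _ hJ' _ hJM h)
  simpa [planeDot] using lt_of_le_of_ne h1 h2

/-- If exactly two terms attain the maximum at `p`, then `p` lies on a wall. -/
theorem regionsAt_eq_pair (hS : S.HasDistinctSlopes) {I J : Finset (Fin n)}
    (hI : I ∈ columnMatroid S.A) (hJ : J ∈ columnMatroid S.A) (hIJ : I ≠ J) {p : ℝ × ℝ}
    (h : S.term I p = S.term J p)
    (hlt : ∀ L ∈ columnMatroid S.A, L ≠ I → L ≠ J → S.term L p < S.term I p) :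
    S.regionsAt p = {I, J} := by
  obtain ⟨L, hL, hLf⟩ := exists_term_eq_f hS p
  have hIf : S.term I p = S.f p := by
    by_cases h1 : L = I
    · rw [← h1, hLf]
    by_cases h2 : L = J
    · rw [h, ← h2, hLf]
    have := hlt L hL h1 h2
    have := term_le_f hI p
    linarith
  have hJf : S.term J p = S.f p := h ▸ hIf
  have key : ∀ L ∈ columnMatroid S.A, S.term L p = S.f p → L = I ∨ L = J := by
    intro L hL hLf
    by_contra hn
    push Not at hn
    have := hlt L hL hn.1 hn.2
    linarith
  have hne : (S.gradient I).1 ≠ (S.gradient J).1 := fun h => hIJ (hS.inj _ hI _ hJ h)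
  ext L
  simp only [Finset.mem_insert, Finset.mem_singleton]
  constructor
  · exact fun hL => key L (mem_columnMatroid_of_mem_regionsAt hL) (mem_regionsAt.1 hL).2
  · rintro (rfl | rfl)
    -- A horizontal direction, with the sign that makes the first of the two terms outgrow the
    -- second.
    · refine mem_regionsAt_of_forall_lt hS hI hIf ((S.gradient L).1 - (S.gradient J).1, 0) ?_
      intro J' hJ' hp' hne'
      rcases key J' hJ' hp' with rfl | rfl
      · exact absurd rfl hne'
      · have := mul_self_pos.2 (sub_ne_zero.2 hne)
        simp only [planeDot]
        nlinarith
    · refine mem_regionsAt_of_forall_lt hS hJ hJf ((S.gradient L).1 - (S.gradient I).1, 0) ?_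
      intro J' hJ' hp' hne'
      rcases key J' hJ' hp' with rfl | rfl
      · have := mul_self_pos.2 (sub_ne_zero.2 hne)
        simp only [planeDot]
        nlinarith
      · exact absurd rfl hne'

/-- Finitely many continuous terms are involved, and those strictly below the maximum at `p` remain
so nearby. -/
theorem eventually_regionsAt_subset (hS : S.HasDistinctSlopes) (p : ℝ × ℝ) :
    ∀ᶠ q in 𝓝 p, S.regionsAt q ⊆ S.regionsAt p := by
  obtain ⟨I, hI⟩ := regionsAt_nonempty hS p
  have hIp := (mem_regionsAt.1 hI).2
  have : ∀ᶠ q in 𝓝 p, ∀ J ∈ S.regions, J ∉ S.regionsAt p → S.term J q < S.term I q := by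
    rw [Filter.eventually_all_finset]
    intro J hJ
    by_cases hJp : J ∈ S.regionsAt p
    · simp [hJp]
    · have hlt : S.term J p < S.term I p := by
        rw [hIp]
        exact lt_of_le_of_ne (term_le_f (mem_columnMatroid_of_mem_regions hJ) p)
          fun h => hJp (mem_regionsAt.2 ⟨hJ, h⟩)
      filter_upwards [(S.continuous_term J).continuousAt.eventually_lt
        (S.continuous_term I).continuousAt hlt] with q hq _ using hq
  filter_upwards [this] with q hq J hJ
  by_contra hJp
  have h1 := hq J (mem_regionsAt.1 hJ).1 hJp
  have h2 := (mem_regionsAt.1 hJ).2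
  have h3 := term_le_f (mem_columnMatroid_of_mem_regionsAt hI) q
  linarith

theorem eventually_smul_regionsAt_subset (hS : S.HasDistinctSlopes) (p v : ℝ × ℝ) :
    ∀ᶠ s in 𝓝 (0 : ℝ), S.regionsAt (p + s • v) ⊆ S.regionsAt p := by
  have : Continuous fun s : ℝ => p + s • v := by fun_prop
  have h2 := this.tendsto 0
  simp only [zero_smul, add_zero] at h2
  exact h2.eventually (eventually_regionsAt_subset hS p)

/-! ### Walls -/

/-- A direction of the wall between `I` and `J`, with the region of `I` on the left. -/
noncomputable def wallDir (S : SolitonData k n) (I J : Finset (Fin n)) : ℝ × ℝ :=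
  ((S.gradient I).2 - (S.gradient J).2, -((S.gradient I).1 - (S.gradient J).1))

theorem wallDir_swap (S : SolitonData k n) (I J : Finset (Fin n)) :
    S.wallDir J I = -S.wallDir I J := by
  simp only [wallDir, Prod.neg_mk]
  congr 1 <;> ring

theorem planeDot_wallDir (S : SolitonData k n) (I J : Finset (Fin n)) :
    planeDot (S.gradient I) (S.wallDir I J) = planeDot (S.gradient J) (S.wallDir I J) := by
  simp only [planeDot, wallDir]
  ring

theorem term_wallDir (S : SolitonData k n) (I J : Finset (Fin n)) {p : ℝ × ℝ}
    (h : S.term I p = S.term J p) (s : ℝ) :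
    S.term I (p + s • S.wallDir I J) = S.term J (p + s • S.wallDir I J) := by
  rw [term_add_smul, term_add_smul, h, planeDot_wallDir]

theorem mem_wall {I J : Finset (Fin n)} {p : ℝ × ℝ} : p ∈ S.wall I J ↔ S.regionsAt p = {I, J} :=
  Iff.rfl

theorem mem_regionsAt_left {I J : Finset (Fin n)} {p : ℝ × ℝ} (h : p ∈ S.wall I J) :
    I ∈ S.regionsAt p := by
  rw [mem_wall.1 h]; simp

theorem mem_regionsAt_right {I J : Finset (Fin n)} {p : ℝ × ℝ} (h : p ∈ S.wall I J) :
    J ∈ S.regionsAt p := by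
  rw [mem_wall.1 h]; simp

theorem term_eq_of_mem_regionsAt {I J : Finset (Fin n)} {p : ℝ × ℝ} (hI : I ∈ S.regionsAt p)
    (hJ : J ∈ S.regionsAt p) : S.term I p = S.term J p :=
  (mem_regionsAt.1 hI).2.trans (mem_regionsAt.1 hJ).2.symm

theorem term_lt_of_mem_wall {I J L : Finset (Fin n)} {p : ℝ × ℝ} (h : p ∈ S.wall I J)
    (hL : L ∈ S.regions) (h1 : L ≠ I) (h2 : L ≠ J) : S.term L p < S.term I p := by
  rw [(mem_regionsAt.1 (mem_regionsAt_left h)).2]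
  refine lt_of_le_of_ne (term_le_f (mem_columnMatroid_of_mem_regions hL) p) fun heq => ?_
  have : L ∈ S.regionsAt p := mem_regionsAt.2 ⟨hL, heq⟩
  rw [mem_wall.1 h] at this
  simp [h1, h2] at this

theorem mem_wall_of_forall_lt (hS : S.HasDistinctSlopes) {I J : Finset (Fin n)} {p : ℝ × ℝ}
    (hI : I ∈ S.regions) (hJ : J ∈ S.regions) (h : S.term I p = S.term J p)
    (hlt : ∀ L ∈ S.regions, L ≠ I → L ≠ J → S.term L p < S.term I p) : p ∈ S.wall I J := by
  obtain ⟨L, hL⟩ := regionsAt_nonempty hS p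
  have hLf := mem_regionsAt.1 hL
  have hIf : S.term I p = S.f p := by
    by_cases h1 : L = I
    · rw [← h1, hLf.2]
    by_cases h2 : L = J
    · rw [h, ← h2, hLf.2]
    have := hlt L hLf.1 h1 h2
    have := term_le_f (mem_columnMatroid_of_mem_regions hI) p
    linarith
  rw [mem_wall]
  ext L
  simp only [Finset.mem_insert, Finset.mem_singleton, mem_regionsAt]
  constructor
  · rintro ⟨hL, hLf⟩
    by_contra hn
    push Not at hn
    have := hlt L hL hn.1 hn.2
    linarith
  · rintro (rfl | rfl)
    · exact ⟨hI, hIf⟩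
    · exact ⟨hJ, h ▸ hIf⟩

theorem convex_wall (hS : S.HasDistinctSlopes) (I J : Finset (Fin n)) : Convex ℝ (S.wall I J) := by
  intro x hx y hy a b ha hb hab
  have hI := (mem_regionsAt.1 (mem_regionsAt_left hx)).1
  have hJ := (mem_regionsAt.1 (mem_regionsAt_right hx)).1
  have key : ∀ L, S.term L (a • x + b • y) = a * S.term L x + b * S.term L y := by
    intro L
    rw [S.term_eq L (a • x + b • y), S.term_eq L x, S.term_eq L y]
    simp only [Prod.fst_add, Prod.snd_add, Prod.smul_fst, Prod.smul_snd, smul_eq_mul]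
    have : b = 1 - a := by linarith
    subst this
    ring
  refine mem_wall_of_forall_lt hS hI hJ ?_ fun L hL h1 h2 => ?_
  · rw [key, key, term_eq_of_mem_regionsAt (mem_regionsAt_left hx) (mem_regionsAt_right hx),
      term_eq_of_mem_regionsAt (mem_regionsAt_left hy) (mem_regionsAt_right hy)]
  · rw [key, key]
    have hx' := term_lt_of_mem_wall hx hL h1 h2
    have hy' := term_lt_of_mem_wall hy hL h1 h2
    rcases ha.eq_or_lt with rfl | ha
    · have : b = 1 := by linarith
      subst this
      linarith
    · have := mul_lt_mul_of_pos_left hx' ha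
      have := mul_le_mul_of_nonneg_left hy'.le hb
      linarith

/-- Along a wall one stays in the wall for a while. -/
theorem eventually_mem_wall (hS : S.HasDistinctSlopes) {I J : Finset (Fin n)} {p : ℝ × ℝ}
    (hp : p ∈ S.wall I J) : ∀ᶠ s in 𝓝 (0 : ℝ), p + s • S.wallDir I J ∈ S.wall I J := by
  have hI := mem_regionsAt_left hp
  have hJ := mem_regionsAt_right hp
  filter_upwards [eventually_smul_regionsAt_subset hS p (S.wallDir I J)] with s hs
  rw [mem_wall.1 hp] at hs
  have heq := S.term_wallDir I J (term_eq_of_mem_regionsAt hI hJ) s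
  obtain ⟨L, hL⟩ := regionsAt_nonempty hS (p + s • S.wallDir I J)
  have hIf : S.term I (p + s • S.wallDir I J) = S.f (p + s • S.wallDir I J) := by
    have h2 := (mem_regionsAt.1 hL).2
    rcases Finset.mem_insert.1 (hs hL) with rfl | h
    · exact h2
    · rw [Finset.mem_singleton.1 h] at h2
      rw [heq, h2]
  rw [mem_wall]
  refine subset_antisymm hs fun L hL => ?_
  rcases Finset.mem_insert.1 hL with rfl | h
  · exact mem_regionsAt.2 ⟨(mem_regionsAt.1 hI).1, hIf⟩
  · rw [Finset.mem_singleton.1 h]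
    exact mem_regionsAt.2 ⟨(mem_regionsAt.1 hJ).1, heq ▸ hIf⟩

/-- The wall between `I` and `J` starts at the point `p`. -/
def WallStartsAt (S : SolitonData k n) (I J : Finset (Fin n)) (p : ℝ × ℝ) : Prop :=
  p ∉ S.wall I J ∧ ∃ ε > (0 : ℝ), ∀ s, 0 < s → s < ε → p + s • S.wallDir I J ∈ S.wall I J

/-- Along the wall direction the terms of `I` and `J` stay equal, and near `p` only the regions at
`p` compete with them; they stay dominant exactly when all these competitors grow strictly slower. A
third region at `p` is what keeps `p` itself off the wall. The geometric condition becomes a finite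
check on gradients. -/
theorem wallStartsAt_iff (hS : S.HasDistinctSlopes) {I J : Finset (Fin n)} {p : ℝ × ℝ} :
    S.WallStartsAt I J p ↔ I ∈ S.regionsAt p ∧ J ∈ S.regionsAt p ∧
      (∃ L ∈ S.regionsAt p, L ≠ I ∧ L ≠ J) ∧ ∀ L ∈ S.regionsAt p, L ≠ I → L ≠ J →
        planeDot (S.gradient L) (S.wallDir I J) < planeDot (S.gradient I) (S.wallDir I J) := by
  constructor
  · rintro ⟨hp, ε, hε, hw⟩
    have hev : ∀ᶠ s in 𝓝[>] (0 : ℝ), p + s • S.wallDir I J ∈ S.wall I J := by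
      filter_upwards [Ioo_mem_nhdsGT hε] with s hs using hw s hs.1 hs.2
    have hsub := (eventually_smul_regionsAt_subset hS p (S.wallDir I J)).filter_mono
      (nhdsWithin_le_nhds (s := Set.Ioi 0))
    obtain ⟨s, ⟨hsw, hss⟩, hs0⟩ := ((hev.and hsub).and self_mem_nhdsWithin).exists
    have hs0 : (0 : ℝ) < s := hs0
    have hI := hss (mem_regionsAt_left hsw)
    have hJ := hss (mem_regionsAt_right hsw)
    refine ⟨hI, hJ, ?_, ?_⟩
    · by_contra hn
      push Not at hn
      apply hp
      rw [mem_wall]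
      ext L
      simp only [Finset.mem_insert, Finset.mem_singleton]
      constructor
      · intro hL
        by_cases h1 : L = I
        · exact Or.inl h1
        · exact Or.inr (hn L hL h1)
      · rintro (rfl | rfl) <;> assumption
    · intro L hL h1 h2
      have := term_lt_of_mem_wall hsw (mem_regionsAt.1 hL).1 h1 h2
      rw [term_add_smul, term_add_smul, term_eq_of_mem_regionsAt hL hI] at this
      exact lt_of_mul_lt_mul_left (by linarith) hs0.le
  · rintro ⟨hI, hJ, ⟨L, hL, hLI, hLJ⟩, hlt⟩
    refine ⟨fun hp => ?_, ?_⟩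
    · rw [mem_wall.1 hp] at hL
      simp [hLI, hLJ] at hL
    have hev := eventually_smul_regionsAt_subset hS p (S.wallDir I J)
    obtain ⟨ε, hε, hball⟩ := Metric.eventually_nhds_iff.1 hev
    refine ⟨ε, hε, fun s hs0 hsε => ?_⟩
    have hsub : S.regionsAt (p + s • S.wallDir I J) ⊆ S.regionsAt p := by
      apply hball
      rw [Real.dist_eq, sub_zero, abs_of_pos hs0]
      exact hsε
    have heq := S.term_wallDir I J (term_eq_of_mem_regionsAt hI hJ) s
    refine mem_wall_of_forall_lt hS (mem_regionsAt.1 hI).1 (mem_regionsAt.1 hJ).1 heq ?_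
    have hlt' : ∀ L ∈ S.regionsAt p, L ≠ I → L ≠ J →
        S.term L (p + s • S.wallDir I J) < S.term I (p + s • S.wallDir I J) := by
      intro L hL h1 h2
      rw [term_add_smul, term_add_smul, term_eq_of_mem_regionsAt hL hI]
      have := mul_lt_mul_of_pos_left (hlt L hL h1 h2) hs0
      linarith
    have hIf : S.term I (p + s • S.wallDir I J) = S.f (p + s • S.wallDir I J) := by
      obtain ⟨K, hK⟩ := regionsAt_nonempty hS (p + s • S.wallDir I J)
      have h2 := (mem_regionsAt.1 hK).2
      by_cases h3 : K = I
      · rwa [h3] at h2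
      by_cases h4 : K = J
      · rwa [h4, ← heq] at h2
      have := hlt' K (hsub hK) h3 h4
      have := term_le_f (mem_columnMatroid_of_mem_regionsAt hI) (p + s • S.wallDir I J)
      linarith
    intro L hL h1 h2
    by_cases hLp : L ∈ S.regionsAt p
    · exact hlt' L hLp h1 h2
    · rw [hIf]
      exact lt_of_le_of_ne (term_le_f (mem_columnMatroid_of_mem_regions hL) _)
        fun h => hLp (hsub (mem_regionsAt.2 ⟨hL, h⟩))

/-- A wall which does not come in from infinity starts at some point. -/
theorem exists_wallStartsAt (hS : S.HasDistinctSlopes) {I J : Finset (Fin n)} {p : ℝ × ℝ}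
    (hp : p ∈ S.wall I J) {s : ℝ} (hs : 0 ≤ s) (hps : p - s • S.wallDir I J ∉ S.wall I J) :
    ∃ q, S.WallStartsAt I J q := by
  -- The backward times at which one is off the wall. Walls are relatively open, so the infimum is
  -- still off the wall, and it marks the starting point.
  set T : Set ℝ := {s | 0 ≤ s ∧ p - s • S.wallDir I J ∉ S.wall I J} with hT
  have hTne : T.Nonempty := ⟨s, hs, hps⟩
  have hTb : BddBelow T := ⟨0, fun s hs => hs.1⟩
  have h0 : 0 ≤ sInf T := le_csInf hTne fun s hs => hs.1
  have hnot : p - sInf T • S.wallDir I J ∉ S.wall I J := by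
    intro hw
    obtain ⟨ε, hε, hball⟩ := Metric.eventually_nhds_iff.1 (eventually_mem_wall hS hw)
    obtain ⟨s, hsT, hs⟩ := exists_lt_of_csInf_lt hTne (lt_add_of_pos_right (sInf T) hε)
    have hle := csInf_le hTb hsT
    apply hsT.2
    have h3 := @hball (sInf T - s) (by
      rw [Real.dist_eq, sub_zero, abs_of_nonpos (by linarith)]; linarith)
    convert h3 using 1
    rw [sub_smul]
    abel
  have hpos : 0 < sInf T := by
    rcases h0.eq_or_lt with h | h
    · rw [← h] at hnot
      simp only [zero_smul, sub_zero] at hnot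
      exact absurd hp hnot
    · exact h
  refine ⟨p - sInf T • S.wallDir I J, hnot, sInf T, hpos, fun s h1 h2 => ?_⟩
  by_contra hn
  have : sInf T - s ∈ T := by
    refine ⟨by linarith, ?_⟩
    convert hn using 2
    rw [sub_smul]
    abel
  have := csInf_le hTb this
  linarith

theorem wallDir_snd_ne_zero (hS : S.HasDistinctSlopes) {I J : Finset (Fin n)}
    (hI : I ∈ S.regions) (hJ : J ∈ S.regions) (hIJ : I ≠ J) : (S.wallDir I J).2 ≠ 0 := by
  simp only [wallDir, neg_ne_zero, sub_ne_zero]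
  exact fun h => hIJ (hS.inj _ (mem_columnMatroid_of_mem_regions hI) _
    (mem_columnMatroid_of_mem_regions hJ) h)

/-- Two points at which the terms of `I` and `J` agree differ by a multiple of the direction of
the wall. -/
theorem exists_smul_wallDir (hS : S.HasDistinctSlopes) {I J : Finset (Fin n)}
    (hI : I ∈ S.regions) (hJ : J ∈ S.regions) (hIJ : I ≠ J) {p q : ℝ × ℝ}
    (hp : S.term I p = S.term J p) (hq : S.term I q = S.term J q) :
    ∃ t : ℝ, q = p + t • S.wallDir I J := by
  have h2 := wallDir_snd_ne_zero hS hI hJ hIJ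
  refine ⟨(q.2 - p.2) / (S.wallDir I J).2, ?_⟩
  rw [S.term_eq_add I p q, S.term_eq_add J p q, hp, planeDot, planeDot] at hq
  simp only [Prod.fst_sub, Prod.snd_sub] at hq
  have h2' : (S.gradient J).1 - (S.gradient I).1 ≠ 0 := by
    simpa [wallDir] using h2
  have hw : (S.wallDir I J).2 = (S.gradient J).1 - (S.gradient I).1 := by simp [wallDir]
  ext
  · simp only [Prod.fst_add, Prod.smul_fst, smul_eq_mul]
    rw [hw, div_mul_eq_mul_div, ← sub_eq_iff_eq_add', eq_div_iff h2']
    simp only [wallDir]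
    linarith
  · simp only [Prod.snd_add, Prod.smul_snd, smul_eq_mul]
    rw [div_mul_cancel₀ _ h2]
    ring

/-- If one starting point lay strictly ahead of the other on their common line, convexity of the
wall would place it on the wall, between a point just after the first start and a point just after
the second. -/
theorem WallStartsAt.unique (hS : S.HasDistinctSlopes) {I J : Finset (Fin n)} (hIJ : I ≠ J)
    {p q : ℝ × ℝ} (hp : S.WallStartsAt I J p) (hq : S.WallStartsAt I J q) : p = q := by
  have hp' := (wallStartsAt_iff hS).1 hp
  have hq' := (wallStartsAt_iff hS).1 hq
  obtain ⟨t, ht⟩ := exists_smul_wallDir hS (mem_regionsAt.1 hp'.1).1 (mem_regionsAt.1 hp'.2.1).1 hIJ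
    (term_eq_of_mem_regionsAt hp'.1 hp'.2.1) (term_eq_of_mem_regionsAt hq'.1 hq'.2.1)
  have key : ∀ (p q : ℝ × ℝ) (t : ℝ), S.WallStartsAt I J p → S.WallStartsAt I J q →
      q = p + t • S.wallDir I J → ¬ 0 < t := by
    intro p q t hp hq ht ht0
    obtain ⟨ε, hε, h1⟩ := hp.2
    obtain ⟨δ, hδ, h2⟩ := hq.2
    set s := min (ε / 2) (t / 2) with hs
    have hs0 : 0 < s := lt_min (by linarith) (by linarith)
    have hsε : s < ε := (min_le_left _ _).trans_lt (by linarith)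
    have hst : s < t := (min_le_right _ _).trans_lt (by linarith)
    clear_value s
    obtain ⟨c, rfl⟩ : ∃ c, t = s + c := ⟨t - s, by ring⟩
    have hx := h1 s hs0 hsε
    have hy := h2 (δ / 2) (by linarith) (by linarith)
    have hden : 0 < c + δ / 2 := by linarith
    have hden' : c * 2 + δ ≠ 0 := by linarith
    apply hq.1
    -- `q` lies `c` units beyond the first point and `δ / 2` units before the second, in multiples
    -- of the wall direction.
    have := convex_wall hS I J hx hy (a := (δ / 2) / (c + δ / 2)) (b := c / (c + δ / 2))
      (by positivity) (div_nonneg (by linarith) hden.le)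
      (by rw [← add_div, add_comm (δ / 2), div_self hden.ne'])
    convert this using 1
    rw [ht]
    ext
    · simp only [Prod.fst_add, Prod.smul_fst, smul_eq_mul]
      field_simp
      ring
    · simp only [Prod.snd_add, Prod.smul_snd, smul_eq_mul]
      field_simp
      ring
  have h1 := key p q t hp hq ht
  have h2 := key q p (-t) hq hp (by rw [ht, neg_smul]; abel)
  have : t = 0 := le_antisymm (not_lt.1 h1) (by linarith [not_lt.1 h2])
  rw [ht, this, zero_smul, add_zero]

end SolitonData

/-! ### Combinatorics of triples of sets that pairwise differ in one element -/

theorem exists_insert_of_card_sdiff {α : Type*} [DecidableEq α] {I J : Finset α}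
    (hc : I.card = J.card) (h : (I \ J).card = 1) :
    ∃ B i j, i ∉ B ∧ j ∉ B ∧ i ≠ j ∧ I = insert i B ∧ J = insert j B := by
  have h' : (J \ I).card = 1 := by rw [← h]; exact Finset.card_sdiff_comm hc.symm
  obtain ⟨i, hi⟩ := Finset.card_eq_one.1 h
  obtain ⟨j, hj⟩ := Finset.card_eq_one.1 h'
  have hi' : i ∈ I \ J := hi ▸ Finset.mem_singleton_self i
  have hj' : j ∈ J \ I := hj ▸ Finset.mem_singleton_self j
  rw [Finset.mem_sdiff] at hi' hj'
  refine ⟨I ∩ J, i, j, fun h => hi'.2 (Finset.mem_inter.1 h).2,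
    fun h => hj'.2 (Finset.mem_inter.1 h).1, fun h => hi'.2 (h ▸ hj'.1), ?_, ?_⟩
  · rw [Finset.insert_eq, ← hi, Finset.sdiff_union_inter]
  · rw [Finset.insert_eq, ← hj, Finset.inter_comm, Finset.sdiff_union_inter]

theorem insert_sdiff_insert_eq {α : Type*} [DecidableEq α] {B : Finset α} {i j : α} (hi : i ∉ B)
    (hij : i ≠ j) : insert i B \ insert j B = {i} := by
  ext x
  simp only [Finset.mem_sdiff, Finset.mem_insert, Finset.mem_singleton]
  constructor
  · rintro ⟨rfl | h, h2⟩
    · rfl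
    · exact absurd (Or.inr h) h2
  · rintro rfl
    exact ⟨Or.inl rfl, fun h => h.elim hij hi⟩

/-- Write two of the sets as `B ∪ {x}` and `B ∪ {y}`. If the third contains `B`, all three extend
`B`. Otherwise it misses exactly one `b` of `B`, must contain `x` and `y`, and all three are
obtained from `B ∪ {x, y}` by removing one element. This dichotomy becomes white against black. -/
theorem eq_image_insert_or_erase {α : Type*} [DecidableEq α] {k : ℕ} {s : Finset (Finset α)}
    (hs : s.card = 3) (hk : ∀ I ∈ s, I.card = k)
    (h : ∀ I ∈ s, ∀ J ∈ s, I ≠ J → (I \ J).card = 1) :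
    ∃ B T : Finset α, T.card = 3 ∧
      ((Disjoint T B ∧ s = T.image fun x => insert x B) ∨
        (T ⊆ B ∧ s = T.image fun x => B.erase x)) := by
  obtain ⟨I, J, L, hIJ, hIL, hJL, rfl⟩ := Finset.card_eq_three.1 hs
  have hcI := hk I (by simp)
  have hcJ := hk J (by simp)
  have hcL := hk L (by simp)
  obtain ⟨B, x, y, hx, hy, hxy, rfl, rfl⟩ :=
    exists_insert_of_card_sdiff (hcI.trans hcJ.symm) (h I (by simp) J (by simp) hIJ)
  have h1 := h _ (by simp) L (by simp) hIL
  have h2 := h _ (by simp) L (by simp) hJL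
  rw [Finset.card_insert_of_notMem hx] at hcI
  by_cases hB : B ⊆ L
  · obtain ⟨z, hz⟩ := Finset.card_eq_one.1 (show (L \ B).card = 1 by
      rw [Finset.card_sdiff_of_subset hB]; omega)
    have hL : L = insert z B := by
      rw [Finset.insert_eq, ← hz, Finset.sdiff_union_of_subset hB]
    have hzB : z ∉ B := by
      have : z ∈ L \ B := hz ▸ Finset.mem_singleton_self z
      exact (Finset.mem_sdiff.1 this).2
    subst hL
    have hxz : x ≠ z := fun h => hIL (by rw [h])
    have hyz : y ≠ z := fun h => hJL (by rw [h])
    refine ⟨B, {x, y, z}, Finset.card_eq_three.2 ⟨x, y, z, hxy, hxz, hyz, rfl⟩, Or.inl ⟨?_, ?_⟩⟩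
    · simp [hx, hy, hzB]
    · simp [Finset.image_insert]
  · obtain ⟨b, hb, hbL⟩ := Finset.not_subset.1 hB
    have hbx : b ≠ x := fun h => hx (h ▸ hb)
    have hby : b ≠ y := fun h => hy (h ▸ hb)
    have hone : ∀ z, (insert z B \ L).card = 1 → ∀ c ∈ insert z B, c ∉ L → c = b := by
      intro z hz c hc hcL
      exact Finset.card_le_one.1 hz.le c (Finset.mem_sdiff.2 ⟨hc, hcL⟩) b
        (Finset.mem_sdiff.2 ⟨Finset.mem_insert_of_mem hb, hbL⟩)
    have hxL : x ∈ L := by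
      by_contra hn
      exact hbx (hone x h1 x (Finset.mem_insert_self _ _) hn).symm
    have hyL : y ∈ L := by
      by_contra hn
      exact hby (hone y h2 y (Finset.mem_insert_self _ _) hn).symm
    have hsub : (insert x (insert y B)).erase b ⊆ L := by
      intro c hc
      obtain ⟨hcb, hc⟩ := Finset.mem_erase.1 hc
      rcases Finset.mem_insert.1 hc with rfl | hc
      · exact hxL
      · by_contra hn
        exact hcb (hone y h2 c hc hn)
    have hL : L = (insert x (insert y B)).erase b := by
      refine (Finset.eq_of_subset_of_card_le hsub ?_).symm
      rw [Finset.card_erase_of_mem (by simp [hb]), Finset.card_insert_of_notMem (by simp [hxy, hx]),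
        Finset.card_insert_of_notMem hy]
      omega
    refine ⟨insert x (insert y B), {y, x, b}, Finset.card_eq_three.2 ⟨y, x, b, hxy.symm, hby.symm,
      hbx.symm, rfl⟩, Or.inr ⟨?_, ?_⟩⟩
    · intro c hc
      simp only [Finset.mem_insert, Finset.mem_singleton] at hc ⊢
      rcases hc with rfl | rfl | rfl <;> simp [hb]
    · rw [hL]
      simp only [Finset.image_insert, Finset.image_singleton]
      congr 1
      · rw [Finset.insert_comm, Finset.erase_insert (by simp [hxy.symm, hy])]
      · rw [Finset.erase_insert (by simp [hxy, hx])]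

/-! ### Generic slopes and gradients. -/

namespace SolitonData

variable {k n : ℕ} {S : SolitonData k n}

/-- The consequences of the genericity of the parameters that are used below. -/
structure HasGenericSlopes (S : SolitonData k n) : Prop extends S.HasDistinctSlopes where
  strictMono : StrictMono S.κ
  pair_sums : ∀ i j l m, i ≠ j → l ≠ m → S.κ i + S.κ j = S.κ l + S.κ m →
    (i = l ∧ j = m) ∨ (i = m ∧ j = l)

theorem gradient_insert (S : SolitonData k n) {B : Finset (Fin n)} {x : Fin n} (hx : x ∉ B) :
    S.gradient (insert x B) = (S.κ x + (S.gradient B).1, S.κ x ^ 2 + (S.gradient B).2) := by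
  simp only [gradient, Finset.sum_insert hx]

theorem gradient_erase (S : SolitonData k n) {B : Finset (Fin n)} {x : Fin n} (hx : x ∈ B) :
    S.gradient (B.erase x) = ((S.gradient B).1 - S.κ x, (S.gradient B).2 - S.κ x ^ 2) := by
  simp only [gradient, ← Finset.sum_erase_eq_sub hx]

theorem card_of_mem_regionsAt {J : Finset (Fin n)} {p : ℝ × ℝ} (h : J ∈ S.regionsAt p) :
    J.card = k :=
  card_of_mem_columnMatroid (mem_columnMatroid_of_mem_regionsAt h)

/-- Three terms with affinely independent gradients agree in at most one point. -/
theorem eq_of_term_eq (hS : S.HasDistinctSlopes) {I J L : Finset (Fin n)} {p q : ℝ × ℝ}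
    (hI : I ∈ S.regionsAt p) (hJ : J ∈ S.regionsAt p) (hL : L ∈ S.regionsAt p)
    (hI' : I ∈ S.regionsAt q) (hJ' : J ∈ S.regionsAt q) (hL' : L ∈ S.regionsAt q) (hIJ : I ≠ J)
    (h : planeDot (S.gradient L) (S.wallDir I J) ≠ planeDot (S.gradient I) (S.wallDir I J)) :
    p = q := by
  obtain ⟨t, ht⟩ := exists_smul_wallDir hS (mem_regionsAt.1 hI).1 (mem_regionsAt.1 hJ).1 hIJ
    (term_eq_of_mem_regionsAt hI hJ) (term_eq_of_mem_regionsAt hI' hJ')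
  have h1 := term_eq_of_mem_regionsAt hL hI
  have h2 := term_eq_of_mem_regionsAt hL' hI'
  rw [ht, term_add_smul, term_add_smul, h1] at h2
  have : t * (planeDot (S.gradient L) (S.wallDir I J) - planeDot (S.gradient I) (S.wallDir I J)) = 0 := by
    linarith
  rcases mul_eq_zero.1 this with h0 | h0
  · rw [ht, h0, zero_smul, add_zero]
  · exact absurd (sub_eq_zero.1 h0) h

/-! ### X-crossings -/

/-- The line-solitons of types `[i, j]` and `[l, m]` cross at the points `p` and `q`. -/
structure IsCrossingAt (S : SolitonData k n) (p q : ℝ × ℝ) (B : Finset (Fin n))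
    (i j l m : Fin n) : Prop where
  nodup : [i, j, l, m].Nodup
  hi : i ∉ B
  hj : j ∉ B
  hl : l ∉ B
  hm : m ∉ B
  regions : (p = q ∧ S.regionsAt p =
        {insert i (insert l B), insert j (insert l B), insert j (insert m B),
          insert i (insert m B)}) ∨
      (p ≠ q ∧
        S.regionsAt p = {insert i (insert l B), insert j (insert l B), insert j (insert m B)} ∧
        S.regionsAt q = {insert i (insert l B), insert i (insert m B), insert j (insert m B)})

theorem isXCrossing_iff {p q : ℝ × ℝ} :
    S.IsXCrossing p q ↔ ∃ B i j l m, S.IsCrossingAt p q B i j l m := by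
  constructor
  · rintro ⟨B, i, j, l, m, h1, h2, h3, h4, h5, h6⟩
    exact ⟨B, i, j, l, m, h1, h2, h3, h4, h5, h6⟩
  · rintro ⟨B, i, j, l, m, h1, h2, h3, h4, h5, h6⟩
    exact ⟨B, i, j, l, m, h1, h2, h3, h4, h5, h6⟩

namespace IsCrossingAt

variable {p q : ℝ × ℝ} {B : Finset (Fin n)} {i j l m : Fin n}

theorem ne (h : S.IsCrossingAt p q B i j l m) :
    i ≠ j ∧ i ≠ l ∧ i ≠ m ∧ j ≠ l ∧ j ≠ m ∧ l ≠ m := by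
  have := h.nodup
  simp only [List.nodup_cons, List.mem_cons, not_or, List.not_mem_nil] at this
  tauto

/-- Exchanging the roles of the two solitons reverses the cyclic order of the four regions and swaps
the two ends of the phase shift. -/
theorem symm (h : S.IsCrossingAt p q B i j l m) : S.IsCrossingAt q p B l m i j := by
  obtain ⟨h1, h2, h3, h4, h5, h6⟩ := h.ne
  refine ⟨?_, h.hl, h.hm, h.hi, h.hj, ?_⟩
  · simp [h1, h6, h2.symm, h4.symm, h3.symm, h5.symm]
  · rw [Finset.insert_comm l i, Finset.insert_comm m i, Finset.insert_comm m j,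
      Finset.insert_comm l j]
    rcases h.regions with ⟨e, hr⟩ | ⟨hne, hp, hq⟩
    · refine Or.inl ⟨e.symm, ?_⟩
      rw [← e, hr]
      ext x
      simp only [Finset.mem_insert, Finset.mem_singleton]
      tauto
    · exact Or.inr ⟨hne.symm, hq, hp⟩

theorem gradient_il (h : S.IsCrossingAt p q B i j l m) :
    S.gradient (insert i (insert l B)) =
      (S.κ i + (S.κ l + (S.gradient B).1), S.κ i ^ 2 + (S.κ l ^ 2 + (S.gradient B).2)) := by
  rw [gradient_insert, gradient_insert _ h.hl]
  simp [h.ne.2.1, h.hi]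

theorem gradient_jl (h : S.IsCrossingAt p q B i j l m) :
    S.gradient (insert j (insert l B)) =
      (S.κ j + (S.κ l + (S.gradient B).1), S.κ j ^ 2 + (S.κ l ^ 2 + (S.gradient B).2)) := by
  rw [gradient_insert, gradient_insert _ h.hl]
  simp [h.ne.2.2.2.1, h.hj]

theorem gradient_jm (h : S.IsCrossingAt p q B i j l m) :
    S.gradient (insert j (insert m B)) =
      (S.κ j + (S.κ m + (S.gradient B).1), S.κ j ^ 2 + (S.κ m ^ 2 + (S.gradient B).2)) := by
  rw [gradient_insert, gradient_insert _ h.hm]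
  simp [h.ne.2.2.2.2.1, h.hj]

theorem gradient_im (h : S.IsCrossingAt p q B i j l m) :
    S.gradient (insert i (insert m B)) =
      (S.κ i + (S.κ m + (S.gradient B).1), S.κ i ^ 2 + (S.κ m ^ 2 + (S.gradient B).2)) := by
  rw [gradient_insert, gradient_insert _ h.hm]
  simp [h.ne.2.2.1, h.hi]

theorem sdiff_il_jl (h : S.IsCrossingAt p q B i j l m) :
    insert i (insert l B) \ insert j (insert l B) = {i} :=
  insert_sdiff_insert_eq (by simp [h.ne.2.1, h.hi]) h.ne.1

theorem sdiff_jl_il (h : S.IsCrossingAt p q B i j l m) :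
    insert j (insert l B) \ insert i (insert l B) = {j} :=
  insert_sdiff_insert_eq (by simp [h.ne.2.2.2.1, h.hj]) h.ne.1.symm

theorem sdiff_im_jm (h : S.IsCrossingAt p q B i j l m) :
    insert i (insert m B) \ insert j (insert m B) = {i} :=
  insert_sdiff_insert_eq (by simp [h.ne.2.2.1, h.hi]) h.ne.1

theorem sdiff_jm_im (h : S.IsCrossingAt p q B i j l m) :
    insert j (insert m B) \ insert i (insert m B) = {j} :=
  insert_sdiff_insert_eq (by simp [h.ne.2.2.2.2.1, h.hj]) h.ne.1.symm

theorem sdiff_il_im (h : S.IsCrossingAt p q B i j l m) :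
    insert i (insert l B) \ insert i (insert m B) = {l} := by
  simpa only [Finset.insert_comm l i, Finset.insert_comm m i, Finset.insert_comm m j, Finset.insert_comm l j] using h.symm.sdiff_il_jl

theorem sdiff_im_il (h : S.IsCrossingAt p q B i j l m) :
    insert i (insert m B) \ insert i (insert l B) = {m} := by
  simpa only [Finset.insert_comm l i, Finset.insert_comm m i, Finset.insert_comm m j, Finset.insert_comm l j] using h.symm.sdiff_jl_il

theorem sdiff_jl_jm (h : S.IsCrossingAt p q B i j l m) :
    insert j (insert l B) \ insert j (insert m B) = {l} := by
  simpa only [Finset.insert_comm l i, Finset.insert_comm m i, Finset.insert_comm m j, Finset.insert_comm l j] using h.symm.sdiff_im_jm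

theorem sdiff_jm_jl (h : S.IsCrossingAt p q B i j l m) :
    insert j (insert m B) \ insert j (insert l B) = {m} := by
  simpa only [Finset.insert_comm l i, Finset.insert_comm m i, Finset.insert_comm m j, Finset.insert_comm l j] using h.symm.sdiff_jm_im

theorem card_sdiff_il_jm (h : S.IsCrossingAt p q B i j l m) :
    (insert i (insert l B) \ insert j (insert m B)).card = 2 := by
  obtain ⟨h1, h2, h3, h4, h5, h6⟩ := h.ne
  have h7 := h.hi
  have h8 := h.hl
  have : insert i (insert l B) \ insert j (insert m B) = {i, l} := by
    ext x
    simp only [Finset.mem_sdiff, Finset.mem_insert, Finset.mem_singleton]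
    grind
  rw [this, Finset.card_pair h2]

theorem card_sdiff_jl_im (h : S.IsCrossingAt p q B i j l m) :
    (insert j (insert l B) \ insert i (insert m B)).card = 2 := by
  obtain ⟨h1, h2, h3, h4, h5, h6⟩ := h.ne
  have h7 := h.hj
  have h8 := h.hl
  have : insert j (insert l B) \ insert i (insert m B) = {j, l} := by
    ext x
    simp only [Finset.mem_sdiff, Finset.mem_insert, Finset.mem_singleton]
    grind
  rw [this, Finset.card_pair h4]

theorem card_sdiff_im_jl (h : S.IsCrossingAt p q B i j l m) :
    (insert i (insert m B) \ insert j (insert l B)).card = 2 := by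
  obtain ⟨h1, h2, h3, h4, h5, h6⟩ := h.ne
  have h7 := h.hi
  have h8 := h.hm
  have : insert i (insert m B) \ insert j (insert l B) = {i, m} := by
    ext x
    simp only [Finset.mem_sdiff, Finset.mem_insert, Finset.mem_singleton]
    grind
  rw [this, Finset.card_pair h3]

theorem card_sdiff_jm_il (h : S.IsCrossingAt p q B i j l m) :
    (insert j (insert m B) \ insert i (insert l B)).card = 2 := by
  obtain ⟨h1, h2, h3, h4, h5, h6⟩ := h.ne
  have h7 := h.hj
  have h8 := h.hm
  have : insert j (insert m B) \ insert i (insert l B) = {j, m} := by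
    ext x
    simp only [Finset.mem_sdiff, Finset.mem_insert, Finset.mem_singleton]
    grind
  rw [this, Finset.card_pair h5]

theorem regions_ne (h : S.IsCrossingAt p q B i j l m) :
    insert i (insert l B) ≠ insert j (insert l B) ∧ insert i (insert l B) ≠ insert j (insert m B) ∧
    insert i (insert l B) ≠ insert i (insert m B) ∧ insert j (insert l B) ≠ insert j (insert m B) ∧
    insert j (insert l B) ≠ insert i (insert m B) ∧
    insert j (insert m B) ≠ insert i (insert m B) := by
  refine ⟨fun e => ?_, fun e => ?_, fun e => ?_, fun e => ?_, fun e => ?_, fun e => ?_⟩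
  · have := h.sdiff_il_jl; rw [e] at this; simp at this
  · have := h.card_sdiff_il_jm; rw [e] at this; simp at this
  · have := h.sdiff_il_im; rw [e] at this; simp at this
  · have := h.sdiff_jl_jm; rw [e] at this; simp at this
  · have := h.card_sdiff_jl_im; rw [e] at this; simp at this
  · have := h.sdiff_jm_im; rw [e] at this; simp at this

theorem mem_left (h : S.IsCrossingAt p q B i j l m) :
    insert i (insert l B) ∈ S.regionsAt p ∧ insert j (insert l B) ∈ S.regionsAt p ∧
      insert j (insert m B) ∈ S.regionsAt p := by
  rcases h.regions with ⟨-, h⟩ | ⟨-, h, -⟩ <;> rw [h] <;> simp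

theorem mem_right (h : S.IsCrossingAt p q B i j l m) :
    insert i (insert l B) ∈ S.regionsAt q ∧ insert i (insert m B) ∈ S.regionsAt q ∧
      insert j (insert m B) ∈ S.regionsAt q := by
  rcases h.regions with ⟨e, hr⟩ | ⟨-, -, hr⟩
  · rw [← e, hr]; simp
  · rw [hr]; simp

/-- The product is the signed area of the parallelogram of gradients of the four regions. The chords
of the parabola over `{i, j}` and `{l, m}` have slopes `κ_i + κ_j` and `κ_l + κ_m`, which differ by
genericity. -/
theorem cross_ne_zero (hS : S.HasGenericSlopes) (h : S.IsCrossingAt p q B i j l m) :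
    (S.κ i - S.κ j) * (S.κ l - S.κ m) * (S.κ l + S.κ m - S.κ i - S.κ j) ≠ 0 := by
  obtain ⟨h1, h2, h3, h4, h5, h6⟩ := h.ne
  have hinj := hS.strictMono.injective
  refine mul_ne_zero (mul_ne_zero (sub_ne_zero.2 (hinj.ne h1)) (sub_ne_zero.2 (hinj.ne h6))) ?_
  intro h0
  rcases hS.pair_sums l m i j h6 h1 (by linarith) with ⟨h, -⟩ | ⟨h, -⟩
  · exact h2 h.symm
  · exact h4 h.symm

/-- The number of regions at `p` separates the two kinds of crossing. With a phase shift, the middle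
one of the three regions at `p` is the only one that differs from both others in a single index. The
fourth region then has its `x`-slope determined by the parallelogram, hence is determined, and `q`
is the only point where it meets the two outer regions. -/
theorem unique (hS : S.HasGenericSlopes) (h : S.IsCrossingAt p q B i j l m) {q' : ℝ × ℝ}
    {B' : Finset (Fin n)} {i' j' l' m' : Fin n} (h' : S.IsCrossingAt p q' B' i' j' l' m') :
    q = q' := by
  obtain ⟨n1, n2, n3, n4, n5, n6⟩ := h.regions_ne
  obtain ⟨n1', n2', n3', n4', n5', n6'⟩ := h'.regions_ne
  have four : ∀ {a b c d : Finset (Fin n)}, a ≠ b → a ≠ c → a ≠ d → b ≠ c → b ≠ d → c ≠ d →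
      ({a, b, c, d} : Finset (Finset (Fin n))).card = 4 := by
    intro a b c d h1 h2 h3 h4 h5 h6
    rw [Finset.card_insert_of_notMem (by simp [h1, h2, h3]),
      Finset.card_insert_of_notMem (by simp [h4, h5]), Finset.card_pair h6]
  have three : ∀ {a b c : Finset (Fin n)}, ({a, b, c} : Finset (Finset (Fin n))).card ≤ 3 :=
    fun {a b c} => Finset.card_le_three
  rcases h.regions with ⟨e, hp⟩ | ⟨hne, hp, hq⟩
  · rcases h'.regions with ⟨e', hp'⟩ | ⟨hne', hp', hq'⟩
    · rw [← e, ← e']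
    · have := four n1 n2 n3 n4 n5 n6
      rw [← hp, hp'] at this
      have := three.trans' this.ge
      omega
  · rcases h'.regions with ⟨e', hp'⟩ | ⟨hne', hp', hq'⟩
    · have := four n1' n2' n3' n4' n5' n6'
      rw [← hp', hp] at this
      have := three.trans' this.ge
      omega
    have c1 := h'.card_sdiff_il_jm
    have c2 := h'.card_sdiff_jm_il
    have d1 : (insert i (insert l B) \ insert j (insert l B)).card = 1 := by rw [h.sdiff_il_jl]; rfl
    have d2 : (insert j (insert l B) \ insert i (insert l B)).card = 1 := by rw [h.sdiff_jl_il]; rfl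
    have d3 : (insert j (insert l B) \ insert j (insert m B)).card = 1 := by rw [h.sdiff_jl_jm]; rfl
    have d4 : (insert j (insert m B) \ insert j (insert l B)).card = 1 := by rw [h.sdiff_jm_jl]; rfl
    have g1 : (S.gradient (insert i (insert m B))).1 = (S.gradient (insert i (insert l B))).1 +
        (S.gradient (insert j (insert m B))).1 - (S.gradient (insert j (insert l B))).1 := by
      rw [h.gradient_il, h.gradient_jl, h.gradient_jm, h.gradient_im]; ring
    have g2 : (S.gradient (insert i' (insert m' B'))).1 = (S.gradient (insert i' (insert l' B'))).1 +
        (S.gradient (insert j' (insert m' B'))).1 - (S.gradient (insert j' (insert l' B'))).1 := by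
      rw [h'.gradient_il, h'.gradient_jl, h'.gradient_jm, h'.gradient_im]; ring
    have hM := mem_columnMatroid_of_mem_regionsAt h.mem_right.2.1
    have hM' := mem_columnMatroid_of_mem_regionsAt h'.mem_right.2.1
    have hcr := h.cross_ne_zero hS
    -- The two sides differ by the signed area of the parallelogram.
    have hncol : planeDot (S.gradient (insert i (insert m B)))
        (S.wallDir (insert i (insert l B)) (insert j (insert m B))) ≠
        planeDot (S.gradient (insert i (insert l B)))
        (S.wallDir (insert i (insert l B)) (insert j (insert m B))) := by
      rw [h.gradient_il, h.gradient_im, wallDir, h.gradient_il, h.gradient_jm]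
      simp only [planeDot]
      intro h0
      apply hcr
      linear_combination h0
    have hmr := h.mem_right
    have hmr' := h'.mem_right
    have hinj := hS.inj _ hM _ hM'
    have heq : ∀ x, x ∈ S.regionsAt p ↔ x = insert i (insert l B) ∨ x = insert j (insert l B) ∨
        x = insert j (insert m B) := fun x => by rw [hp]; simp
    have heq' : ∀ x, x ∈ S.regionsAt p ↔ x = insert i' (insert l' B') ∨ x = insert j' (insert l' B') ∨
        x = insert j' (insert m' B') := fun x => by rw [hp']; simp
    generalize insert i (insert l B) = a at *
    generalize insert j (insert l B) = b at *
    generalize insert j (insert m B) = c at *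
    generalize insert i (insert m B) = d at *
    generalize insert i' (insert l' B') = a' at *
    generalize insert j' (insert l' B') = b' at *
    generalize insert j' (insert m' B') = c' at *
    generalize insert i' (insert m' B') = d' at *
    have hbb : b = b' := by
      rcases (heq' b).1 ((heq b).2 (by simp)) with e | e | e
      · rcases (heq c').1 ((heq' c').2 (by simp)) with e' | e' | e'
        · rw [← e, e'] at c1; omega
        · exact absurd (e.symm.trans e'.symm) n2'
        · rw [← e, e'] at c1; omega
      · exact e
      · rcases (heq a').1 ((heq' a').2 (by simp)) with e' | e' | e'
        · rw [← e, e'] at c2; omega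
        · exact absurd (e'.trans e) n2'
        · rw [← e, e'] at c2; omega
    subst hbb
    have hac : (a = a' ∧ c = c') ∨ (a = c' ∧ c = a') := by
      rcases (heq' a).1 ((heq a).2 (by simp)) with e | e | e <;>
      rcases (heq' c).1 ((heq c).2 (by simp)) with e' | e' | e'
      · exact absurd (e.trans e'.symm) n2
      · exact absurd e'.symm n4
      · exact Or.inl ⟨e, e'⟩
      · exact absurd e n1
      · exact absurd e n1
      · exact absurd e n1
      · exact Or.inr ⟨e, e'⟩
      · exact absurd e'.symm n4
      · exact absurd (e.trans e'.symm) n2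
    have hdd : d = d' := by
      apply hinj
      rcases hac with ⟨rfl, rfl⟩ | ⟨rfl, rfl⟩
      · rw [g1, g2]
      · rw [g1, g2]; ring
    subst hdd
    rcases hac with ⟨rfl, rfl⟩ | ⟨rfl, rfl⟩
    · exact eq_of_term_eq hS.toHasDistinctSlopes hmr.1 hmr.2.2 hmr.2.1 hmr'.1 hmr'.2.2 hmr'.2.1 n2 hncol
    · exact eq_of_term_eq hS.toHasDistinctSlopes hmr.1 hmr.2.2 hmr.2.1 hmr'.2.2 hmr'.1 hmr'.2.1 n2 hncol

end IsCrossingAt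

theorem IsXCrossing.symm {p q : ℝ × ℝ} (h : S.IsXCrossing p q) : S.IsXCrossing q p := by
  obtain ⟨B, i, j, l, m, h⟩ := isXCrossing_iff.1 h
  exact isXCrossing_iff.2 ⟨B, l, m, i, j, h.symm⟩

theorem IsXCrossing.unique (hS : S.HasGenericSlopes) {p q q' : ℝ × ℝ} (h : S.IsXCrossing p q)
    (h' : S.IsXCrossing p q') : q = q' := by
  obtain ⟨B, i, j, l, m, h⟩ := isXCrossing_iff.1 h
  obtain ⟨B', i', j', l', m', h'⟩ := isXCrossing_iff.1 h'
  exact h.unique hS h'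

theorem IsTrivalentVertex.not_isXCrossing {p q : ℝ × ℝ} (hp : S.IsTrivalentVertex p) :
    ¬ S.IsXCrossing p q := by
  intro h
  obtain ⟨B, i, j, l, m, h⟩ := isXCrossing_iff.1 h
  have := hp.2 _ h.mem_left.1 _ h.mem_left.2.2 h.regions_ne.2.1
  rw [h.card_sdiff_il_jm] at this
  omega

end SolitonData

namespace SolitonData

variable {k n : ℕ} {S : SolitonData k n}

/-! ### Nodes of the soliton graph -/

/-- The points of the contour plot that are contracted to one node together with `p`. -/
def nodePoints (S : SolitonData k n) (p : ℝ × ℝ) : Set (ℝ × ℝ) := {q | p = q ∨ S.IsXCrossing p q}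

theorem mem_nodePoints_self (p : ℝ × ℝ) : p ∈ S.nodePoints p := Or.inl rfl

/-- Being partners in an X-crossing is symmetric and determines the partner, so the sets of
contracted points form a partition. -/
theorem nodePoints_eq (hS : S.HasGenericSlopes) {p q : ℝ × ℝ} (h : q ∈ S.nodePoints p) :
    S.nodePoints q = S.nodePoints p := by
  rcases h with rfl | h
  · rfl
  ext y
  constructor
  · rintro (rfl | hy)
    · exact Or.inr h
    · exact Or.inl (h.symm.unique hS hy)
  · rintro (rfl | hy)
    · exact Or.inr h.symm
    · exact Or.inl (h.unique hS hy)

theorem sameOrigin_iff {d d' : S.Dart} :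
    d.SameOrigin d' ↔ ∃ p, d.StartsAt p ∧ ∃ q ∈ S.nodePoints p, d'.StartsAt q :=
  ⟨fun ⟨p, q, h1, h2, h3⟩ => ⟨p, h1, q, h3, h2⟩, fun ⟨p, h1, q, h3, h2⟩ => ⟨p, q, h1, h2, h3⟩⟩

theorem startsAt_iff {d : S.Dart} {p : ℝ × ℝ} : d.StartsAt p ↔ S.WallStartsAt d.1.1 d.1.2 p :=
  Iff.rfl

theorem Dart.direction_eq (d : S.Dart) : d.direction = S.wallDir d.1.1 d.1.2 := rfl

theorem IsLineSoliton.ne {I J : Finset (Fin n)} (h : S.IsLineSoliton I J) : I ≠ J := by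
  rintro rfl
  have := h.2.2.1
  simp at this

theorem Dart.StartsAt.unique (hS : S.HasDistinctSlopes) {d : S.Dart} {p q : ℝ × ℝ}
    (hp : d.StartsAt p) (hq : d.StartsAt q) : p = q :=
  WallStartsAt.unique hS d.2.ne hp hq

theorem Dart.StartsAt.not_fromInfinity {d : S.Dart} {p : ℝ × ℝ} (hp : d.StartsAt p) :
    ¬ d.FromInfinity := by
  intro h
  obtain ⟨ε, hε, hw⟩ := hp.2
  apply hp.1
  have := h _ (hw (ε / 2) (by linarith) (by linarith)) (ε / 2) (by linarith)
  rwa [add_sub_cancel_right] at this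

theorem Dart.exists_startsAt (hS : S.HasDistinctSlopes) {d : S.Dart} (hd : ¬ d.FromInfinity) :
    ∃ p, d.StartsAt p := by
  simp only [Dart.FromInfinity, not_forall] at hd
  obtain ⟨p, hp, s, hs, hps⟩ := hd
  exact exists_wallStartsAt hS hp hs hps

theorem sameOrigin_symm (hS : S.HasGenericSlopes) {d d' : S.Dart} (h : d.SameOrigin d') :
    d'.SameOrigin d := by
  obtain ⟨p, h1, q, h2, h3⟩ := sameOrigin_iff.1 h
  exact sameOrigin_iff.2 ⟨q, h3, p, by rw [nodePoints_eq hS h2]; exact mem_nodePoints_self p, h1⟩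

/-- The regions `R 0, R 1, …` are those around the node at `p`, in counterclockwise order; the node
is dual to a strictly convex polygon with vertices the gradients of these regions. -/
structure IsNode {m : ℕ} [NeZero m] (S : SolitonData k n) (p : ℝ × ℝ)
    (R : Fin m → Finset (Fin n)) : Prop where
  inj : Function.Injective R
  soliton : ∀ a, S.IsLineSoliton (R (a + 1)) (R a)
  convex : ∀ a b, b ≠ a → b ≠ a + 1 → planeDot (S.gradient (R b)) (S.wallDir (R (a + 1)) (R a)) <
    planeDot (S.gradient (R a)) (S.wallDir (R (a + 1)) (R a))
  range_eq : ∀ J, (∃ a, R a = J) ↔ ∃ x ∈ S.nodePoints p, J ∈ S.regionsAt x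
  starts : ∀ a, ∃ x ∈ S.nodePoints p, S.WallStartsAt (R (a + 1)) (R a) x
  of_starts : ∀ (d : S.Dart), ∀ x ∈ S.nodePoints p, d.StartsAt x → ∃ a, d.1 = (R (a + 1), R a)

/-- Strict convexity at an edge of the polygon is the growth criterion for its wall to start at the
node. Conversely, a dart starting here joins regions that differ in one index, hence consecutive
ones, and convexity excludes the wrong orientation. -/
theorem isNode_of_forall (hS : S.HasGenericSlopes) {m : ℕ} [NeZero m] {p : ℝ × ℝ}
    {R : Fin m → Finset (Fin n)} (inj : Function.Injective R)
    (hsol : ∀ a, (R (a + 1) \ R a).card = 1)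
    (hadj : ∀ a b, (R a \ R b).card = 1 → a = b + 1 ∨ b = a + 1)
    (convex : ∀ a b, b ≠ a → b ≠ a + 1 →
      planeDot (S.gradient (R b)) (S.wallDir (R (a + 1)) (R a)) <
      planeDot (S.gradient (R a)) (S.wallDir (R (a + 1)) (R a)))
    (range_eq : ∀ J, (∃ a, R a = J) ↔ ∃ x ∈ S.nodePoints p, J ∈ S.regionsAt x)
    (starts : ∀ a, ∃ x ∈ S.nodePoints p, R a ∈ S.regionsAt x ∧ R (a + 1) ∈ S.regionsAt x ∧
      ∃ L ∈ S.regionsAt x, L ≠ R a ∧ L ≠ R (a + 1)) : S.IsNode p R := by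
  have hst : ∀ a, ∃ x ∈ S.nodePoints p, S.WallStartsAt (R (a + 1)) (R a) x := by
    intro a
    obtain ⟨x, hx, h1, h2, L, hL, hL1, hL2⟩ := starts a
    refine ⟨x, hx, (wallStartsAt_iff hS.toHasDistinctSlopes).2 ⟨h2, h1, ⟨L, hL, hL2, hL1⟩, ?_⟩⟩
    intro L hL hL2 hL1
    obtain ⟨b, rfl⟩ := (range_eq L).2 ⟨x, hx, hL⟩
    rw [planeDot_wallDir]
    exact convex a b (fun h => hL1 (by rw [h])) (fun h => hL2 (by rw [h]))
  refine ⟨inj, fun a => ?_, convex, range_eq, hst, fun d x hx hd => ?_⟩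
  · obtain ⟨x, hx, hw⟩ := hst a
    have hw' := (wallStartsAt_iff hS.toHasDistinctSlopes).1 hw
    obtain ⟨ε, hε, hw⟩ := hw.2
    exact ⟨(mem_regionsAt.1 hw'.1).1, (mem_regionsAt.1 hw'.2.1).1, hsol a,
      _, hw (ε / 2) (by linarith) (by linarith)⟩
  · obtain ⟨h1, h2, ⟨L, hL, hL1, hL2⟩, h3⟩ := (wallStartsAt_iff hS.toHasDistinctSlopes).1 hd
    obtain ⟨a, ha⟩ := (range_eq _).2 ⟨x, hx, h1⟩
    obtain ⟨b, hb⟩ := (range_eq _).2 ⟨x, hx, h2⟩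
    have hc := d.2.2.2.1
    rw [← ha, ← hb] at hc
    rcases hadj a b hc with rfl | rfl
    · exact ⟨b, Prod.ext ha.symm hb.symm⟩
    · exfalso
      obtain ⟨c, rfl⟩ := (range_eq L).2 ⟨x, hx, hL⟩
      have h4 := h3 _ hL hL1 hL2
      rw [← ha] at hL1 h4
      rw [← hb] at hL2 h4
      have h5 := convex a c (fun h => hL1 (by rw [h])) (fun h => hL2 (by rw [h]))
      rw [wallDir_swap] at h5
      simp only [planeDot, Prod.fst_neg, Prod.snd_neg] at h4 h5
      linarith

namespace IsNode

variable {m : ℕ} [NeZero m] {p : ℝ × ℝ} {R : Fin m → Finset (Fin n)}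

/-- The darts that leave a node. -/
def dart (h : S.IsNode p R) (a : Fin m) : S.Dart := ⟨(R (a + 1), R a), h.soliton a⟩

theorem sameOrigin_iff (hS : S.HasGenericSlopes) (h : S.IsNode p R) {a : Fin m} {d : S.Dart} :
    (h.dart a).SameOrigin d ↔ ∃ b, d = h.dart b := by
  rw [SolitonData.sameOrigin_iff]
  constructor
  · rintro ⟨x, hx, y, hy, hd⟩
    obtain ⟨x', hx', hw⟩ := h.starts a
    have : x = x' := Dart.StartsAt.unique hS.toHasDistinctSlopes hx hw
    subst this
    rw [nodePoints_eq hS hx'] at hy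
    obtain ⟨b, hb⟩ := h.of_starts d y hy hd
    exact ⟨b, Subtype.ext hb⟩
  · rintro ⟨b, rfl⟩
    obtain ⟨x, hx, hxw⟩ := h.starts a
    obtain ⟨y, hy, hyw⟩ := h.starts b
    exact ⟨x, hxw, y, by rw [nodePoints_eq hS hx]; exact hy, hyw⟩

theorem not_fromInfinity (h : S.IsNode p R) (a : Fin m) : ¬ (h.dart a).FromInfinity := by
  obtain ⟨x, -, hw⟩ := h.starts a
  exact Dart.StartsAt.not_fromInfinity (d := h.dart a) hw

theorem dart_injective (h : S.IsNode p R) : Function.Injective h.dart := by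
  intro a b hab
  exact h.inj (congrArg (fun d : S.Dart => d.1.2) hab)

theorem ccw_iff (hS : S.HasGenericSlopes) (h : S.IsNode p R) (π : Equiv.Perm (Fin n)) {a : Fin m}
    {d : S.Dart} : (S.plabic π).ccw (h.dart a) d ↔ d = h.dart (a + 1) := by
  constructor
  · rintro (⟨hf, -⟩ | ⟨hs, hd⟩)
    · exact absurd hf (h.not_fromInfinity a)
    · obtain ⟨b, rfl⟩ := (h.sameOrigin_iff hS).1 hs
      have : b = a + 1 := h.inj hd
      rw [this]
  · rintro rfl
    exact Or.inr ⟨(h.sameOrigin_iff hS).2 ⟨_, rfl⟩, rfl⟩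

theorem ccw_iff' (hS : S.HasGenericSlopes) (h : S.IsNode p R) (π : Equiv.Perm (Fin n)) {a : Fin m}
    {d : S.Dart} : (S.plabic π).ccw d (h.dart a) ↔ d = h.dart (a - 1) := by
  constructor
  · intro hc
    rcases hc with ⟨hf, e⟩ | ⟨hs, hd⟩
    · rw [← e] at hf
      exact absurd hf (h.not_fromInfinity a)
    · obtain ⟨b, rfl⟩ := (h.sameOrigin_iff hS).1 (sameOrigin_symm hS hs)
      have : a = b + 1 := h.inj hd
      rw [this, add_sub_cancel_right]
  · rintro rfl
    rw [h.ccw_iff hS, sub_add_cancel]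

end IsNode

/-- Three regions around a white vertex. -/
def IsWhiteNode (S : SolitonData k n) (p : ℝ × ℝ) (R : Fin 3 → Finset (Fin n)) : Prop :=
  ∃ h : S.IsNode p R, (∀ a, (h.dart a).kind = NodeKind.white) ∧
    ∃ (B : Finset (Fin n)) (x : Fin 3 → Fin n), Function.Injective x ∧
      ∀ a, x a ∉ B ∧ R a = insert (x a) B

/-- Three regions around a black vertex. -/
def IsBlackNode (S : SolitonData k n) (p : ℝ × ℝ) (R : Fin 3 → Finset (Fin n)) : Prop :=
  ∃ h : S.IsNode p R, (∀ a, (h.dart a).kind = NodeKind.black) ∧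
    ∃ (B : Finset (Fin n)) (x : Fin 3 → Fin n), Function.Injective x ∧
      ∀ a, x a ∈ B ∧ R a = B.erase (x a)

/-- Four regions around an X-crossing. -/
def IsCrossingNode (S : SolitonData k n) (p : ℝ × ℝ) (R : Fin 4 → Finset (Fin n)) : Prop :=
  ∃ h : S.IsNode p R, (∀ a, (h.dart a).kind = NodeKind.crossing) ∧
    ∃ (x y : ℝ × ℝ) (B : Finset (Fin n)) (i j l m : Fin n), S.nodePoints p = {x, y} ∧
      S.IsCrossingAt x y B i j l m ∧
      R = ![insert i (insert l B), insert j (insert l B), insert j (insert m B),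
        insert i (insert m B)]

/-! ### Construction of white, black and crossing nodes. -/

theorem sdiff_card_of_mem (R : Fin 3 → Finset (Fin n)) {p : ℝ × ℝ}
    (hR : Finset.univ.image R = S.regionsAt p) (hp : S.IsTrivalentVertex p)
    (inj : Function.Injective R) (a b : Fin 3) (h : a ≠ b) : (R a \ R b).card = 1 := by
  apply hp.2 _ _ _ _ (inj.ne h) <;> rw [← hR] <;> simp

theorem nodePoints_of_isTrivalentVertex {p : ℝ × ℝ} (hp : S.IsTrivalentVertex p) :
    S.nodePoints p = {p} := by
  ext q
  simp only [nodePoints, Set.mem_ofPred_eq, Set.mem_singleton_iff, hp.not_isXCrossing, or_false]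
  exact eq_comm

/-- A cyclically ordered triple of regions at a trivalent vertex. -/
theorem isNode_of_isTrivalentVertex (hS : S.HasGenericSlopes) {p : ℝ × ℝ}
    (hp : S.IsTrivalentVertex p) {R : Fin 3 → Finset (Fin n)} (inj : Function.Injective R)
    (hR : Finset.univ.image R = S.regionsAt p)
    (convex : ∀ a b, b ≠ a → b ≠ a + 1 →
      planeDot (S.gradient (R b)) (S.wallDir (R (a + 1)) (R a)) <
      planeDot (S.gradient (R a)) (S.wallDir (R (a + 1)) (R a))) : S.IsNode p R := by
  have hmem : ∀ a, R a ∈ S.regionsAt p := fun a => by rw [← hR]; simp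
  have hne : ∀ a : Fin 3, a + 1 ≠ a := by decide
  have hadj : ∀ a b : Fin 3, a ≠ b → a = b + 1 ∨ b = a + 1 := by decide
  have hne2 : ∀ a : Fin 3, a + 2 ≠ a ∧ a + 2 ≠ a + 1 := by decide
  refine isNode_of_forall hS inj (fun a => sdiff_card_of_mem R hR hp inj _ _ (hne a))
    (fun a b h => hadj a b ?_) convex (fun J => ?_) (fun a => ?_)
  · rintro rfl
    simp at h
  · rw [nodePoints_of_isTrivalentVertex hp]
    simp [← hR]
  · exact ⟨p, mem_nodePoints_self p, hmem _, hmem _, R (a + 2), hmem _, inj.ne (hne2 a).1,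
      inj.ne (hne2 a).2⟩

/-- The darts with the same origin are exactly the three darts of the node, so the descending ones
can be counted over `Fin 3`. -/
theorem kind_eq_ite {p : ℝ × ℝ} (hp : S.IsTrivalentVertex p) {R : Fin 3 → Finset (Fin n)}
    (hS : S.HasGenericSlopes) (h : S.IsNode p R) (a : Fin 3) [Decidable (∃! b : Fin 3, (h.dart b).direction.2 < 0)] :
    (h.dart a).kind = if ∃! b, (h.dart b).direction.2 < 0 then NodeKind.black
      else NodeKind.white := by
  classical
  have hx : ¬ ∃ x q, (h.dart a).StartsAt x ∧ S.IsXCrossing x q := by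
    rintro ⟨x, q, hx, hq⟩
    obtain ⟨x', hx', hw⟩ := h.starts a
    have : x = x' := Dart.StartsAt.unique hS.toHasDistinctSlopes hx hw
    subst this
    rw [nodePoints_of_isTrivalentVertex hp, Set.mem_singleton_iff] at hx'
    subst hx'
    exact hp.not_isXCrossing hq
  have hiff : (∃! d' : S.Dart, (h.dart a).SameOrigin d' ∧ d'.direction.2 < 0) ↔
      ∃! b, (h.dart b).direction.2 < 0 := by
    simp only [h.sameOrigin_iff hS]
    constructor
    · rintro ⟨_, ⟨⟨b, rfl⟩, hb⟩, hu⟩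
      exact ⟨b, hb, fun c hc => h.dart_injective (hu _ ⟨⟨c, rfl⟩, hc⟩)⟩
    · rintro ⟨b, hb, hu⟩
      refine ⟨h.dart b, ⟨⟨b, rfl⟩, hb⟩, ?_⟩
      rintro _ ⟨⟨c, rfl⟩, hc⟩
      rw [hu c hc]
  unfold Dart.kind
  rw [if_neg (h.not_fromInfinity a), if_neg hx]
  simp only [hiff]

/-- The gradients are a translate of three points of the parabola, which are met counterclockwise as
`κ` increases. The dart between consecutive regions has vertical component `κ (x a) - κ (x (a +
1))`; it is negative for two of the three darts, so no descending edge is unique. -/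
theorem exists_isWhiteNode (hS : S.HasGenericSlopes) {p : ℝ × ℝ} (hp : S.IsTrivalentVertex p)
    {B T : Finset (Fin n)} (hT : T.card = 3) (hd : Disjoint T B)
    (h : S.regionsAt p = T.image fun x => insert x B) : ∃ R, S.IsWhiteNode p R := by
  classical
  set x := T.orderEmbOfFin hT with hx
  have hxB : ∀ a, x a ∉ B := fun a =>
    Finset.disjoint_left.1 hd (Finset.orderEmbOfFin_mem T hT a)
  have inj : Function.Injective fun a => insert (x a) B := by
    intro a b hab
    have : x a ∈ insert (x b) B := by
      rw [← show insert (x a) B = insert (x b) B from hab]; exact Finset.mem_insert_self _ _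
    rcases Finset.mem_insert.1 this with h | h
    · exact x.injective h
    · exact absurd h (hxB a)
  have hR : Finset.univ.image (fun a => insert (x a) B) = S.regionsAt p := by
    rw [h, ← Finset.image_orderEmbOfFin_univ T hT, Finset.image_image]
    rfl
  have h01 : S.κ (x 0) < S.κ (x 1) := hS.strictMono (x.strictMono (by decide))
  have h12 : S.κ (x 1) < S.κ (x 2) := hS.strictMono (x.strictMono (by decide))
  have hnode : S.IsNode p (fun a => insert (x a) B) := by
    refine isNode_of_isTrivalentVertex hS hp inj hR ?_
    -- Twice the signed area of a triangle inscribed in the parabola is a Vandermonde product, and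
    -- its sign depends only on the cyclic order of `a, b, c`.
    have key : ∀ a b c : Fin 3, 0 < (S.κ (x b) - S.κ (x a)) * (S.κ (x c) - S.κ (x a)) *
        (S.κ (x c) - S.κ (x b)) →
        planeDot (S.gradient (insert (x c) B)) (S.wallDir (insert (x b) B) (insert (x a) B)) <
        planeDot (S.gradient (insert (x a) B)) (S.wallDir (insert (x b) B) (insert (x a) B)) := by
      intro a b c hpos
      rw [wallDir, gradient_insert _ (hxB a), gradient_insert _ (hxB b), gradient_insert _ (hxB c)]
      simp only [planeDot]
      nlinarith
    intro a b hb1 hb2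
    apply key
    have e1 := sub_pos.2 h01
    have e2 := sub_pos.2 h12
    have e3 := sub_pos.2 (h01.trans h12)
    fin_cases a <;> fin_cases b <;> simp at hb1 hb2 ⊢
    · exact mul_pos (mul_pos e1 e3) e2
    · have := mul_pos (mul_pos e2 e1) e3
      nlinarith
    · have := mul_pos (mul_pos e3 e2) e1
      nlinarith
  refine ⟨_, hnode, fun a => ?_, B, x, x.injective, fun a => ⟨hxB a, rfl⟩⟩
  rw [kind_eq_ite hp hS, if_neg]
  rintro ⟨b, -, hu⟩
  have hdir : ∀ a, (hnode.dart a).direction.2 = S.κ (x a) - S.κ (x (a + 1)) := by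
    intro a
    rw [Dart.direction_eq]
    change (S.wallDir (insert (x (a + 1)) B) (insert (x a) B)).2 = _
    rw [wallDir, gradient_insert _ (hxB a), gradient_insert _ (hxB _)]
    ring
  have h0 := hu 0 ((hdir 0).trans_lt (sub_neg.2 h01))
  have h1 := hu 1 ((hdir 1).trans_lt (sub_neg.2 h12))
  exact absurd (h0.trans h1.symm) (by decide)

/-- Removing `x` instead of adding it reflects the triangle in a point. The counterclockwise order
is preserved but every dart is reversed, so exactly one of them descends, namely the one that closes
the cycle. -/
theorem exists_isBlackNode (hS : S.HasGenericSlopes) {p : ℝ × ℝ} (hp : S.IsTrivalentVertex p)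
    {B T : Finset (Fin n)} (hT : T.card = 3) (hd : T ⊆ B)
    (h : S.regionsAt p = T.image fun x => B.erase x) : ∃ R, S.IsBlackNode p R := by
  classical
  set x := T.orderEmbOfFin hT with hx
  have hxB : ∀ a, x a ∈ B := fun a => hd (Finset.orderEmbOfFin_mem T hT a)
  have inj : Function.Injective fun a => B.erase (x a) := by
    intro a b hab
    by_contra hne
    have : x b ∈ B.erase (x b) := by
      rw [← show B.erase (x a) = B.erase (x b) from hab]
      exact Finset.mem_erase.2 ⟨x.injective.ne (Ne.symm hne), hxB b⟩
    simp at this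
  have hR : Finset.univ.image (fun a => B.erase (x a)) = S.regionsAt p := by
    rw [h, ← Finset.image_orderEmbOfFin_univ T hT, Finset.image_image]
    rfl
  have h01 : S.κ (x 0) < S.κ (x 1) := hS.strictMono (x.strictMono (by decide))
  have h12 : S.κ (x 1) < S.κ (x 2) := hS.strictMono (x.strictMono (by decide))
  have hnode : S.IsNode p (fun a => B.erase (x a)) := by
    refine isNode_of_isTrivalentVertex hS hp inj hR ?_
    have key : ∀ a b c : Fin 3, 0 < (S.κ (x b) - S.κ (x a)) * (S.κ (x c) - S.κ (x a)) *
        (S.κ (x c) - S.κ (x b)) →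
        planeDot (S.gradient (B.erase (x c))) (S.wallDir (B.erase (x b)) (B.erase (x a))) <
        planeDot (S.gradient (B.erase (x a))) (S.wallDir (B.erase (x b)) (B.erase (x a))) := by
      intro a b c hpos
      rw [wallDir, gradient_erase _ (hxB a), gradient_erase _ (hxB b), gradient_erase _ (hxB c)]
      simp only [planeDot]
      nlinarith
    intro a b hb1 hb2
    apply key
    have e1 := sub_pos.2 h01
    have e2 := sub_pos.2 h12
    have e3 := sub_pos.2 (h01.trans h12)
    fin_cases a <;> fin_cases b <;> simp at hb1 hb2 ⊢
    · exact mul_pos (mul_pos e1 e3) e2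
    · have := mul_pos (mul_pos e2 e1) e3
      nlinarith
    · have := mul_pos (mul_pos e3 e2) e1
      nlinarith
  refine ⟨_, hnode, fun a => ?_, B, x, x.injective, fun a => ⟨hxB a, rfl⟩⟩
  have hdir : ∀ a, (hnode.dart a).direction.2 = S.κ (x (a + 1)) - S.κ (x a) := by
    intro a
    rw [Dart.direction_eq]
    change (S.wallDir (B.erase (x (a + 1))) (B.erase (x a))).2 = _
    rw [wallDir, gradient_erase _ (hxB a), gradient_erase _ (hxB _)]
    ring
  rw [kind_eq_ite hp hS, if_pos]
  refine ⟨2, ?_, fun b hb => ?_⟩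
  · change (hnode.dart 2).direction.2 < 0
    rw [hdir]
    exact sub_neg.2 (h01.trans h12)
  · have hb : (hnode.dart b).direction.2 < 0 := hb
    rw [hdir] at hb
    fin_cases b
    · exact absurd hb (not_lt.2 (sub_nonneg.2 h01.le))
    · exact absurd hb (not_lt.2 (sub_nonneg.2 h12.le))
    · rfl

theorem nodePoints_of_isXCrossing (hS : S.HasGenericSlopes) {p q : ℝ × ℝ}
    (h : S.IsXCrossing p q) : S.nodePoints p = {p, q} := by
  ext y
  simp only [nodePoints, Set.mem_ofPred_eq, Set.mem_insert_iff, Set.mem_singleton_iff]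
  constructor
  · rintro (rfl | hy)
    · exact Or.inl rfl
    · exact Or.inr (hy.unique hS h)
  · rintro (rfl | rfl)
    · exact Or.inl rfl
    · exact Or.inr h

/-- The sign condition says that the parallelogram with vertices `il`, `jl`, `jm`, `im` is listed
counterclockwise. -/
theorem isCrossingNode_of_pos (hS : S.HasGenericSlopes) {p x y : ℝ × ℝ} {B : Finset (Fin n)}
    {i j l m : Fin n} (hp : S.nodePoints p = {x, y}) (h : S.IsCrossingAt x y B i j l m)
    (hpos : 0 < (S.κ i - S.κ j) * (S.κ l - S.κ m) * (S.κ l + S.κ m - S.κ i - S.κ j)) :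
    S.IsCrossingNode p ![insert i (insert l B), insert j (insert l B), insert j (insert m B),
        insert i (insert m B)] := by
  classical
  obtain ⟨n1, n2, n3, n4, n5, n6⟩ := h.regions_ne
  obtain ⟨m1, m2, m3⟩ := h.mem_left
  obtain ⟨m4, m5, m6⟩ := h.mem_right
  have hx : x ∈ S.nodePoints p := by simp [hp]
  have hy : y ∈ S.nodePoints p := by simp [hp]
  have hnode : S.IsNode p ![insert i (insert l B), insert j (insert l B), insert j (insert m B),
        insert i (insert m B)] := by
    refine isNode_of_forall hS ?_ ?_ ?_ ?_ ?_ ?_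
    · intro a b hab
      fin_cases a <;> fin_cases b <;> first | rfl | (exfalso; revert hab; simp [*, Ne.symm])
    · intro a
      fin_cases a
      · exact Finset.card_eq_one.2 ⟨_, h.sdiff_jl_il⟩
      · exact Finset.card_eq_one.2 ⟨_, h.sdiff_jm_jl⟩
      · exact Finset.card_eq_one.2 ⟨_, h.sdiff_im_jm⟩
      · exact Finset.card_eq_one.2 ⟨_, h.sdiff_il_im⟩
    · intro a b hab
      have d1 := h.card_sdiff_il_jm
      have d2 := h.card_sdiff_jm_il
      have d3 := h.card_sdiff_jl_im
      have d4 := h.card_sdiff_im_jl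
      fin_cases a <;> fin_cases b <;>
        first
        | exact Or.inl rfl
        | exact Or.inr rfl
        | (exfalso; simp [d1, d2, d3, d4] at hab)
    · intro a b h1 h2
      fin_cases a <;> fin_cases b <;>
        first
        | exact absurd rfl h1
        | exact absurd rfl h2
        | (simp [wallDir, planeDot, h.gradient_il, h.gradient_jl, h.gradient_jm, h.gradient_im]
           nlinarith)
    · intro J
      simp only [hp, Set.mem_insert_iff, Set.mem_singleton_iff, exists_eq_or_imp, exists_eq_left]
      constructor
      · rintro ⟨a, rfl⟩
        fin_cases a
        · exact Or.inl m1
        · exact Or.inl m2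
        · exact Or.inl m3
        · exact Or.inr m5
      · intro hJ
        have : J = insert i (insert l B) ∨ J = insert j (insert l B) ∨ J = insert j (insert m B) ∨
            J = insert i (insert m B) := by
          rcases h.regions with ⟨rfl, hr⟩ | ⟨-, hr, hr'⟩
          · rw [hr] at hJ
            simp only [Finset.mem_insert, Finset.mem_singleton, or_self] at hJ
            exact hJ
          · rw [hr, hr'] at hJ
            simp only [Finset.mem_insert, Finset.mem_singleton] at hJ
            tauto
        rcases this with rfl | rfl | rfl | rfl
        · exact ⟨0, rfl⟩
        · exact ⟨1, rfl⟩
        · exact ⟨2, rfl⟩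
        · exact ⟨3, rfl⟩
    -- The two edges that bound `jl` start at `x` and the two that bound `im` start at `y`; at each
    -- end the remaining region of the triple serves as the third one.
    · intro a
      fin_cases a
      · exact ⟨x, hx, m1, m2, _, m3, n2.symm, n4.symm⟩
      · exact ⟨x, hx, m2, m3, _, m1, n1, n2⟩
      · exact ⟨y, hy, m6, m5, _, m4, n2, n3⟩
      · exact ⟨y, hy, m5, m4, _, m6, n6, n2.symm⟩
  refine ⟨hnode, fun a => ?_, x, y, B, i, j, l, m, hp, h, rfl⟩
  have hc : S.IsXCrossing x y := isXCrossing_iff.2 ⟨B, i, j, l, m, h⟩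
  have : ∃ z w, (hnode.dart a).StartsAt z ∧ S.IsXCrossing z w := by
    obtain ⟨z, hz, hw⟩ := hnode.starts a
    rw [hp] at hz
    rcases hz with rfl | hz
    · exact ⟨z, y, hw, hc⟩
    · rw [Set.mem_singleton_iff.1 hz] at hw
      exact ⟨y, x, hw, hc.symm⟩
  unfold Dart.kind
  rw [if_neg (hnode.not_fromInfinity a), if_pos this]

theorem exists_isCrossingNode (hS : S.HasGenericSlopes) {p q : ℝ × ℝ} (h : S.IsXCrossing p q) :
    ∃ R, S.IsCrossingNode p R := by
  have hp := nodePoints_of_isXCrossing hS h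
  obtain ⟨B, i, j, l, m, h⟩ := isXCrossing_iff.1 h
  rcases (h.cross_ne_zero hS).lt_or_gt with h0 | h0
  -- Exchanging the two solitons changes the sign of the area.
  · refine ⟨_, isCrossingNode_of_pos hS (hp.trans (Set.pair_comm _ _)) h.symm ?_⟩
    linarith
  · exact ⟨_, isCrossingNode_of_pos hS hp h h0⟩

/-- Wherever three regions meet there is a white vertex, a black vertex, or an X-crossing. -/
theorem exists_node (hS : S.HasGenericSlopes) (hC : S.IsGeneric) {p : ℝ × ℝ}
    (hp : 3 ≤ (S.regionsAt p).card) :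
    (∃ R, S.IsWhiteNode p R) ∨ (∃ R, S.IsBlackNode p R) ∨ ∃ R, S.IsCrossingNode p R := by
  classical
  rcases hC p hp with h | ⟨q, h⟩
  · obtain ⟨B, T, hT, ⟨hd, hr⟩ | ⟨hd, hr⟩⟩ :=
      eq_image_insert_or_erase h.1 (fun _ => card_of_mem_regionsAt) h.2
    · exact Or.inl (exists_isWhiteNode hS h hT hd hr)
    · exact Or.inr (Or.inl (exists_isBlackNode hS h hT hd hr))
  · exact Or.inr (Or.inr (exists_isCrossingNode hS h))

theorem WallStartsAt.three_le_card (hS : S.HasDistinctSlopes) {I J : Finset (Fin n)} (hIJ : I ≠ J)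
    {p : ℝ × ℝ} (h : S.WallStartsAt I J p) : 3 ≤ (S.regionsAt p).card := by
  obtain ⟨h1, h2, ⟨L, hL, h3, h4⟩, -⟩ := (wallStartsAt_iff hS).1 h
  rw [← Finset.card_eq_three.2 ⟨I, J, L, hIJ, h3.symm, h4.symm, rfl⟩]
  apply Finset.card_le_card
  intro x hx
  simp only [Finset.mem_insert, Finset.mem_singleton] at hx
  rcases hx with rfl | rfl | rfl <;> assumption

/-- A dart that does not come in from infinity leaves a white vertex, a black vertex, or an
X-crossing. -/
theorem Dart.exists_node (hS : S.HasGenericSlopes) (hC : S.IsGeneric) {d : S.Dart} {p : ℝ × ℝ}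
    (hd : d.StartsAt p) :
    (∃ (R : _) (h : S.IsWhiteNode p R) (a : _), d = h.choose.dart a) ∨
    (∃ (R : _) (h : S.IsBlackNode p R) (a : _), d = h.choose.dart a) ∨
    ∃ (R : _) (h : S.IsCrossingNode p R) (a : _), d = h.choose.dart a := by
  have key : ∀ {m : ℕ} [NeZero m] {R : Fin m → Finset (Fin n)} (h : S.IsNode p R),
      ∃ a, d = h.dart a := by
    intro m _ R h
    obtain ⟨a, ha⟩ := h.of_starts d p (mem_nodePoints_self p) hd
    exact ⟨a, Subtype.ext ha⟩
  rcases SolitonData.exists_node hS hC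
    (WallStartsAt.three_le_card hS.toHasDistinctSlopes d.2.ne hd) with ⟨R, h⟩ | ⟨R, h⟩ | ⟨R, h⟩
  · exact Or.inl ⟨R, h, key _⟩
  · exact Or.inr (Or.inl ⟨R, h, key _⟩)
  · exact Or.inr (Or.inr ⟨R, h, key _⟩)

end SolitonData

namespace SolitonData

variable {k n : ℕ} {S : SolitonData k n}

/-! ### The rules of the road at the nodes -/

/-- The dart has the regions labelled by sets that contain `r` on its left, and others on its
right. -/
def Dart.Carries (d : S.Dart) (r : Fin n) : Prop := r ∈ d.1.1 ∧ r ∉ d.1.2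

theorem Dart.rev_rev (d : S.Dart) : d.rev.rev = d := rfl

theorem Dart.kind_eq_boundary_iff {d : S.Dart} : d.kind = NodeKind.boundary ↔ d.FromInfinity := by
  classical
  unfold Dart.kind
  split_ifs with h <;> simp [h]

theorem IsNode.dart_rev_carries {m : ℕ} [NeZero m] {p : ℝ × ℝ} {R : Fin m → Finset (Fin n)}
    (h : S.IsNode p R) (a : Fin m) (r : Fin n) :
    (h.dart a).rev.Carries r ↔ r ∈ R a ∧ r ∉ R (a + 1) := Iff.rfl

theorem IsNode.dart_carries {m : ℕ} [NeZero m] {p : ℝ × ℝ} {R : Fin m → Finset (Fin n)}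
    (h : S.IsNode p R) (a : Fin m) (r : Fin n) :
    (h.dart a).Carries r ↔ r ∈ R (a + 1) ∧ r ∉ R a := Iff.rfl

variable (π : Equiv.Perm (Fin n))

theorem step_iff_of_white (hS : S.HasGenericSlopes) {p : ℝ × ℝ} {R : Fin 3 → Finset (Fin n)}
    (h : S.IsNode p R) {a : Fin 3} (hk : (h.dart a).kind = NodeKind.white) {d' : S.Dart} :
    (S.plabic π).Step (h.dart a).rev d' ↔ d' = h.dart (a - 1) := by
  rw [← h.ccw_iff' hS π]
  have : (S.plabic π).kind ((S.plabic π).rev (h.dart a).rev) = NodeKind.white := hk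
  unfold PlabicDiagram.Step
  rw [this]
  rfl

theorem step_iff_of_black (hS : S.HasGenericSlopes) {p : ℝ × ℝ} {R : Fin 3 → Finset (Fin n)}
    (h : S.IsNode p R) {a : Fin 3} (hk : (h.dart a).kind = NodeKind.black) {d' : S.Dart} :
    (S.plabic π).Step (h.dart a).rev d' ↔ d' = h.dart (a + 1) := by
  rw [← h.ccw_iff hS π]
  have : (S.plabic π).kind ((S.plabic π).rev (h.dart a).rev) = NodeKind.black := hk
  unfold PlabicDiagram.Step
  rw [this]
  rfl

theorem step_iff_of_crossing (hS : S.HasGenericSlopes) {p : ℝ × ℝ} {R : Fin 4 → Finset (Fin n)}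
    (h : S.IsNode p R) {a : Fin 4} (hk : (h.dart a).kind = NodeKind.crossing) {d' : S.Dart} :
    (S.plabic π).Step (h.dart a).rev d' ↔ d' = h.dart (a + 1 + 1) := by
  have : (S.plabic π).kind ((S.plabic π).rev (h.dart a).rev) = NodeKind.crossing := hk
  unfold PlabicDiagram.Step
  rw [this]
  change (∃ e, (S.plabic π).ccw (h.dart a) e ∧ (S.plabic π).ccw e d') ↔ _
  constructor
  · rintro ⟨e, h1, h2⟩
    obtain rfl := (h.ccw_iff hS π).1 h1
    exact (h.ccw_iff hS π).1 h2
  · rintro rfl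
    exact ⟨_, (h.ccw_iff hS π).2 rfl, (h.ccw_iff hS π).2 rfl⟩

/-- At a white vertex the region `R a` contains one index, `x a`, which is missing from both others.
Turning left keeps `R a` on the left. -/
theorem IsWhiteNode.carries_iff {p : ℝ × ℝ} {R : Fin 3 → Finset (Fin n)} (h : S.IsWhiteNode p R)
    (a : Fin 3) (r : Fin n) :
    (h.choose.dart a).rev.Carries r ↔ (h.choose.dart (a - 1)).Carries r := by
  obtain ⟨-, B, x, hx, hR⟩ := h.choose_spec
  rw [IsNode.dart_rev_carries, IsNode.dart_carries, sub_add_cancel]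
  have h1 : a + 1 ≠ a := by revert a; decide
  have h2 : a - 1 ≠ a := by revert a; decide
  have key : ∀ b, b ≠ a → (r ∈ R a ∧ r ∉ R b ↔ r = x a) := by
    intro b hb
    rw [(hR a).2, (hR b).2]
    simp only [Finset.mem_insert, not_or]
    constructor
    · tauto
    · rintro rfl
      exact ⟨Or.inl rfl, hx.ne hb.symm, (hR a).1⟩
  rw [key _ h1, key _ h2]

/-- At a black vertex the region `R (a + 1)` lacks one index, `x (a + 1)`, which both others
contain. Turning right keeps `R (a + 1)` on the right. -/
theorem IsBlackNode.carries_iff {p : ℝ × ℝ} {R : Fin 3 → Finset (Fin n)} (h : S.IsBlackNode p R)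
    (a : Fin 3) (r : Fin n) :
    (h.choose.dart a).rev.Carries r ↔ (h.choose.dart (a + 1)).Carries r := by
  obtain ⟨-, B, x, hx, hR⟩ := h.choose_spec
  rw [IsNode.dart_rev_carries, IsNode.dart_carries]
  have h1 : a ≠ a + 1 := by revert a; decide
  have h2 : a + 1 + 1 ≠ a + 1 := by revert a; decide
  have key : ∀ b, b ≠ a + 1 → (r ∈ R b ∧ r ∉ R (a + 1) ↔ r = x (a + 1)) := by
    intro b hb
    rw [(hR b).2, (hR (a + 1)).2]
    simp only [Finset.mem_erase, not_and]
    constructor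
    · rintro ⟨⟨-, h1⟩, h2⟩
      by_contra h3
      exact h2 h3 h1
    · rintro rfl
      exact ⟨⟨hx.ne hb.symm, (hR _).1⟩, fun h => absurd rfl h⟩
  rw [key _ h1, key _ h2]

/-- Opposite edges of the parallelogram exchange the same two indices. -/
theorem IsCrossingNode.carries_iff {p : ℝ × ℝ} {R : Fin 4 → Finset (Fin n)}
    (h : S.IsCrossingNode p R) (a : Fin 4) (r : Fin n) :
    (h.choose.dart a).rev.Carries r ↔ (h.choose.dart (a + 1 + 1)).Carries r := by
  obtain ⟨-, x, y, B, i, j, l, m, -, hc, hR⟩ := h.choose_spec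
  rw [IsNode.dart_rev_carries, IsNode.dart_carries, ← Finset.mem_sdiff, ← Finset.mem_sdiff]
  suffices R a \ R (a + 1) = R (a + 1 + 1 + 1) \ R (a + 1 + 1) by rw [this]
  rw [hR]
  fin_cases a
  · exact hc.sdiff_il_jl.trans hc.sdiff_im_jm.symm
  · exact hc.sdiff_jl_jm.trans hc.sdiff_il_im.symm
  · exact hc.sdiff_jm_im.trans hc.sdiff_jl_il.symm
  · exact hc.sdiff_im_il.trans hc.sdiff_jm_jl.symm

theorem Dart.exists_step (hS : S.HasGenericSlopes) (hC : S.IsGeneric) {d : S.Dart}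
    (hd : ¬ d.rev.FromInfinity) : ∃ d', (S.plabic π).Step d d' := by
  obtain ⟨p, hp⟩ := Dart.exists_startsAt hS.toHasDistinctSlopes hd
  rcases Dart.exists_node hS hC hp with ⟨R, h, a, ha⟩ | ⟨R, h, a, ha⟩ | ⟨R, h, a, ha⟩ <;>
  rw [← d.rev_rev, ha]
  · exact ⟨_, (step_iff_of_white π hS h.choose (h.choose_spec.1 a)).2 rfl⟩
  · exact ⟨_, (step_iff_of_black π hS h.choose (h.choose_spec.1 a)).2 rfl⟩
  · exact ⟨_, (step_iff_of_crossing π hS h.choose (h.choose_spec.1 a)).2 rfl⟩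

theorem Dart.exists_step_to (hS : S.HasGenericSlopes) (hC : S.IsGeneric) {d' : S.Dart}
    (hd : ¬ d'.FromInfinity) : ∃ d, (S.plabic π).Step d d' := by
  obtain ⟨p, hp⟩ := Dart.exists_startsAt hS.toHasDistinctSlopes hd
  rcases Dart.exists_node hS hC hp with ⟨R, h, a, rfl⟩ | ⟨R, h, a, rfl⟩ | ⟨R, h, a, rfl⟩
  · exact ⟨(h.choose.dart (a + 1)).rev,
      (step_iff_of_white π hS h.choose (h.choose_spec.1 _)).2 (by rw [add_sub_cancel_right])⟩
  · exact ⟨(h.choose.dart (a - 1)).rev,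
      (step_iff_of_black π hS h.choose (h.choose_spec.1 _)).2 (by rw [sub_add_cancel])⟩
  · exact ⟨(h.choose.dart (a - 1 - 1)).rev,
      (step_iff_of_crossing π hS h.choose (h.choose_spec.1 _)).2
        (by rw [sub_add_cancel, sub_add_cancel])⟩

theorem not_fromInfinity_of_step {d d' : S.Dart} (h : (S.plabic π).Step d d') :
    ¬ d.rev.FromInfinity := by
  intro hf
  have : (S.plabic π).kind ((S.plabic π).rev d) = NodeKind.boundary :=
    Dart.kind_eq_boundary_iff.2 hf
  unfold PlabicDiagram.Step at h
  rw [this] at h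
  exact h

/-- Trips respect the node structure and keep the regions whose labels contain a given element on
their left. -/
theorem step_carries_iff (hS : S.HasGenericSlopes) (hC : S.IsGeneric) {d d' : S.Dart}
    (h : (S.plabic π).Step d d') :
    d.rev.SameOrigin d' ∧ ∀ r, d.Carries r ↔ d'.Carries r := by
  obtain ⟨p, hp⟩ := Dart.exists_startsAt hS.toHasDistinctSlopes (not_fromInfinity_of_step π h)
  rcases Dart.exists_node hS hC hp with ⟨R, hn, a, ha⟩ | ⟨R, hn, a, ha⟩ | ⟨R, hn, a, ha⟩ <;>
  obtain rfl : d = (hn.choose.dart a).rev := by rw [← ha]; rfl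
  · obtain rfl := (step_iff_of_white π hS hn.choose (hn.choose_spec.1 a)).1 h
    exact ⟨(hn.choose.sameOrigin_iff hS).2 ⟨_, rfl⟩, hn.carries_iff a⟩
  · obtain rfl := (step_iff_of_black π hS hn.choose (hn.choose_spec.1 a)).1 h
    exact ⟨(hn.choose.sameOrigin_iff hS).2 ⟨_, rfl⟩, hn.carries_iff a⟩
  · obtain rfl := (step_iff_of_crossing π hS hn.choose (hn.choose_spec.1 a)).1 h
    exact ⟨(hn.choose.sameOrigin_iff hS).2 ⟨_, rfl⟩, hn.carries_iff a⟩

/-- A dart that does not come in from infinity leaves some node. -/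
theorem Dart.exists_isNode (hS : S.HasGenericSlopes) (hC : S.IsGeneric) {d : S.Dart} {p : ℝ × ℝ}
    (hp : d.StartsAt p) : ∃ (m : ℕ) (_ : NeZero m) (R : Fin m → Finset (Fin n)) (h : S.IsNode p R)
      (a : Fin m), d = h.dart a ∧ ∀ b, (h.dart b).kind = d.kind := by
  rcases Dart.exists_node hS hC hp with ⟨R, hn, a, ha⟩ | ⟨R, hn, a, ha⟩ | ⟨R, hn, a, ha⟩ <;>
  exact ⟨_, _, R, hn.choose, a, ha, fun b => by rw [ha, hn.choose_spec.1 a, hn.choose_spec.1 b]⟩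

theorem Dart.exists_isNode_of_kind_eq_crossing (hS : S.HasGenericSlopes) (hC : S.IsGeneric)
    {d : S.Dart} (hd : d.kind = NodeKind.crossing) :
    ∃ (p : ℝ × ℝ) (R : Fin 4 → Finset (Fin n)) (h : S.IsNode p R) (a : Fin 4), d = h.dart a := by
  have hf : ¬ d.FromInfinity := by
    rw [← Dart.kind_eq_boundary_iff, hd]
    simp
  obtain ⟨p, hp⟩ := Dart.exists_startsAt hS.toHasDistinctSlopes hf
  rcases Dart.exists_node hS hC hp with ⟨R, hn, a, ha⟩ | ⟨R, hn, a, ha⟩ | ⟨R, hn, a, ha⟩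
  · rw [ha, hn.choose_spec.1 a] at hd; simp at hd
  · rw [ha, hn.choose_spec.1 a] at hd; simp at hd
  · exact ⟨p, R, hn.choose, a, ha⟩

theorem Dart.existsUnique_ccw (hS : S.HasGenericSlopes) (hC : S.IsGeneric) (d : S.Dart) :
    (∃! d', (S.plabic π).ccw d d') ∧ ∃! d', (S.plabic π).ccw d' d := by
  by_cases hf : d.FromInfinity
  · constructor
    · refine ⟨d, Or.inl ⟨hf, rfl⟩, ?_⟩
      rintro d' (⟨-, h⟩ | ⟨h, -⟩)
      · exact h
      · obtain ⟨p, hp, -⟩ := sameOrigin_iff.1 h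
        exact absurd hf hp.not_fromInfinity
    · refine ⟨d, Or.inl ⟨hf, rfl⟩, ?_⟩
      rintro d' (⟨-, h⟩ | ⟨h, -⟩)
      · exact h.symm
      · obtain ⟨p, hp, -⟩ := sameOrigin_iff.1 (sameOrigin_symm hS h)
        exact absurd hf hp.not_fromInfinity
  · obtain ⟨p, hp⟩ := Dart.exists_startsAt hS.toHasDistinctSlopes hf
    obtain ⟨m, _, R, h, a, rfl, -⟩ := Dart.exists_isNode hS hC hp
    exact ⟨⟨_, (h.ccw_iff hS π).2 rfl, fun _ => (h.ccw_iff hS π).1⟩,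
      ⟨_, (h.ccw_iff' hS π).2 rfl, fun _ => (h.ccw_iff' hS π).1⟩⟩

theorem Dart.kind_eq_of_ccw (hS : S.HasGenericSlopes) (hC : S.IsGeneric) {d d' : S.Dart}
    (hd : (S.plabic π).ccw d d') : d'.kind = d.kind := by
  by_cases hf : d.FromInfinity
  · have := (Dart.existsUnique_ccw π hS hC d).1.unique hd (Or.inl ⟨hf, rfl⟩)
    rw [this]
  · obtain ⟨p, hp⟩ := Dart.exists_startsAt hS.toHasDistinctSlopes hf
    obtain ⟨m, _, R, h, a, rfl, hk⟩ := Dart.exists_isNode hS hC hp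
    obtain rfl := (h.ccw_iff hS π).1 hd
    exact hk _

theorem Dart.exists_four_of_crossing (hS : S.HasGenericSlopes) (hC : S.IsGeneric) {d : S.Dart}
    (hd : d.kind = NodeKind.crossing) : ∃ a b c : S.Dart,
      [d, a, b, c].Nodup ∧ (S.plabic π).ccw d a ∧ (S.plabic π).ccw a b ∧ (S.plabic π).ccw b c ∧
        (S.plabic π).ccw c d := by
  obtain ⟨p, R, h, a, rfl⟩ := Dart.exists_isNode_of_kind_eq_crossing hS hC hd
  refine ⟨h.dart (a + 1), h.dart (a + 2), h.dart (a + 3), ?_, ?_⟩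
  · have : [h.dart a, h.dart (a + 1), h.dart (a + 2), h.dart (a + 3)] =
      [a, a + 1, a + 2, a + 3].map h.dart := rfl
    rw [this, List.nodup_map_iff h.dart_injective]
    clear this hd
    revert a
    decide
  · have e : a + 2 = a + 1 + 1 ∧ a + 3 = a + 2 + 1 ∧ a = a + 3 + 1 := by
      clear hd
      revert a
      decide
    refine ⟨(h.ccw_iff hS π).2 rfl, (h.ccw_iff hS π).2 (congrArg h.dart e.1),
      (h.ccw_iff hS π).2 (congrArg h.dart e.2.1), (h.ccw_iff hS π).2 (congrArg h.dart e.2.2)⟩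

end SolitonData

/-! ### Disjoint open convex sets in the plane are partially ordered by translation -/

/-- Some point of `V` is moved into `U` by a positive multiple of `v`. -/
def IsAbove (v : ℝ × ℝ) (U V : Set (ℝ × ℝ)) : Prop :=
  U ≠ V ∧ ∃ z ∈ V, ∃ t : ℝ, 0 < t ∧ z + t • v ∈ U

/-- A linear functional with kernel spanned by `v`. -/
def coordAcross (v z : ℝ × ℝ) : ℝ := z.1 * v.2 - z.2 * v.1

theorem coordAcross_add_smul (v z : ℝ × ℝ) (t : ℝ) : coordAcross v (z + t • v) = coordAcross v z := by
  simp only [coordAcross, Prod.fst_add, Prod.snd_add, Prod.smul_fst, Prod.smul_snd, smul_eq_mul]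
  ring

theorem exists_eq_add_smul {v : ℝ × ℝ} (hv : v ≠ 0) {z w : ℝ × ℝ}
    (h : coordAcross v z = coordAcross v w) : ∃ t : ℝ, z = w + t • v := by
  simp only [coordAcross] at h
  have hpos : v.1 * v.1 + v.2 * v.2 ≠ 0 := by
    intro h0
    apply hv
    have h1 : v.1 = 0 := by nlinarith [mul_self_nonneg v.1, mul_self_nonneg v.2]
    have h2 : v.2 = 0 := by nlinarith [mul_self_nonneg v.1, mul_self_nonneg v.2]
    exact Prod.ext h1 h2
  refine ⟨((z.1 - w.1) * v.1 + (z.2 - w.2) * v.2) / (v.1 * v.1 + v.2 * v.2), ?_⟩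
  ext
  · simp only [Prod.fst_add, Prod.smul_fst, smul_eq_mul]
    rw [div_mul_eq_mul_div, ← sub_eq_iff_eq_add', eq_div_iff hpos]
    linear_combination v.2 * h
  · simp only [Prod.snd_add, Prod.smul_snd, smul_eq_mul]
    rw [div_mul_eq_mul_div, ← sub_eq_iff_eq_add', eq_div_iff hpos]
    linear_combination (-v.1) * h

theorem exists_mem_coordAcross_eq {v : ℝ × ℝ} {U : Set (ℝ × ℝ)} (hU : Convex ℝ U) {z w : ℝ × ℝ}
    (hz : z ∈ U) (hw : w ∈ U) {c : ℝ} (h1 : coordAcross v z ≤ c) (h2 : c < coordAcross v w) :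
    ∃ y ∈ U, coordAcross v y = c := by
  have hden : 0 < coordAcross v w - coordAcross v z := by linarith
  refine ⟨((coordAcross v w - c) / (coordAcross v w - coordAcross v z)) • z +
    ((c - coordAcross v z) / (coordAcross v w - coordAcross v z)) • w,
    hU hz hw (div_nonneg (by linarith) hden.le) (div_nonneg (by linarith) hden.le) ?_, ?_⟩
  · rw [← add_div, div_eq_one_iff_eq hden.ne']; ring
  · have : ∀ a b : ℝ, coordAcross v (a • z + b • w) = a * coordAcross v z + b * coordAcross v w := by
      intro a b
      simp only [coordAcross, Prod.fst_add, Prod.snd_add, Prod.smul_fst, Prod.smul_snd, smul_eq_mul]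
      ring
    rw [this, div_mul_eq_mul_div, div_mul_eq_mul_div, ← add_div, div_eq_iff hden.ne']
    ring

/-- If displacements of both signs (or a zero one) led from `V` to `U`, a convex combination would
have displacement zero and give a common point. So the direction of passage between two disjoint
convex sets is well defined. -/
theorem pos_of_add_smul_mem {v : ℝ × ℝ} {U V : Set (ℝ × ℝ)} (hU : Convex ℝ U) (hV : Convex ℝ V)
    (hd : Disjoint U V) {z z' : ℝ × ℝ} {t t' : ℝ} (hz : z ∈ V) (ht : 0 < t) (hzt : z + t • v ∈ U)
    (hz' : z' ∈ V) (hzt' : z' + t' • v ∈ U) : 0 < t' := by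
  by_contra hn
  have hden : 0 < t - t' := by linarith
  have h1 : 0 ≤ -t' / (t - t') := div_nonneg (by linarith) hden.le
  have h2 : 0 ≤ t / (t - t') := div_nonneg ht.le hden.le
  have h3 : -t' / (t - t') + t / (t - t') = 1 := by
    rw [← add_div, div_eq_one_iff_eq hden.ne']; ring
  have hmV := hV hz hz' h1 h2 h3
  have hmU := hU hzt hzt' h1 h2 h3
  refine Set.disjoint_left.1 hd hmU ?_
  convert hmV using 1
  have : (-t' / (t - t')) * t + (t / (t - t')) * t' = 0 := by
    rw [div_mul_eq_mul_div, div_mul_eq_mul_div, ← add_div]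
    simp only [neg_mul]
    rw [mul_comm t' t, neg_add_cancel, zero_div]
  calc (-t' / (t - t')) • (z + t • v) + (t / (t - t')) • (z' + t' • v)
      = (-t' / (t - t')) • z + (t / (t - t')) • z' +
        ((-t' / (t - t')) * t + (t / (t - t')) * t') • v := by
        module
    _ = _ := by rw [this, zero_smul, add_zero]

theorem exists_coordAcross_lt {v : ℝ × ℝ} (hv : v ≠ 0) {U : Set (ℝ × ℝ)} (hU : IsOpen U)
    {z : ℝ × ℝ} (hz : z ∈ U) : ∃ w ∈ U, coordAcross v z < coordAcross v w := by
  have hc : Continuous fun s : ℝ => z + s • ((v.2, -v.1) : ℝ × ℝ) := by fun_prop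
  have h2 := hc.tendsto 0
  simp only [zero_smul, add_zero] at h2
  have h3 := (h2.mono_left (nhdsWithin_le_nhds (s := Set.Ioi (0 : ℝ)))).eventually (hU.mem_nhds hz)
  obtain ⟨s, hs, hs0⟩ := (h3.and (self_mem_nhdsWithin (s := Set.Ioi (0 : ℝ)))).exists
  have hs0 : (0 : ℝ) < s := hs0
  refine ⟨_, hs, ?_⟩
  have hpos : 0 < v.1 * v.1 + v.2 * v.2 := by
    rcases (mul_self_nonneg v.1).lt_or_eq with h | h
    · nlinarith [mul_self_nonneg v.2]
    · rcases (mul_self_nonneg v.2).lt_or_eq with h' | h'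
      · nlinarith
      · exact absurd (Prod.ext (mul_self_eq_zero.1 h.symm) (mul_self_eq_zero.1 h'.symm)) hv
  simp only [coordAcross, Prod.fst_add, Prod.snd_add, Prod.smul_fst, Prod.smul_snd, smul_eq_mul]
  nlinarith [mul_pos hs0 hpos]

/-- The translation order may be shortcut at a set which ends first in the transversal direction. -/
theorem IsAbove.shortcut {v : ℝ × ℝ} (hv : v ≠ 0) {U V W : Set (ℝ × ℝ)} (hU : Convex ℝ U)
    (hV : Convex ℝ V) (hW : Convex ℝ W) (hUV : Disjoint U V) (hVW : Disjoint V W)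
    (hU' : ∀ z ∈ V, ∃ u ∈ U, coordAcross v z < coordAcross v u)
    (hW' : ∀ z ∈ V, ∃ u ∈ W, coordAcross v z < coordAcross v u)
    (h1 : IsAbove v U V) (h2 : IsAbove v V W) : IsAbove v U W := by
  obtain ⟨-, z₁, hz₁, t₁, ht₁, hzt₁⟩ := h1
  obtain ⟨-, z₂, hz₂, t₂, ht₂, hzt₂⟩ := h2
  refine ⟨?_, ?_⟩
  · rintro rfl
    have := pos_of_add_smul_mem (t' := -t₁) (v := v) hV hU hVW hz₂ ht₂ hzt₂ hzt₁ (by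
      convert hz₁ using 1
      rw [neg_smul, add_neg_cancel_right])
    linarith
  -- Both `U` and `W` reach at least as far across as `V`. So whichever of them has its witness
  -- point less far across also meets the line of the other witness, and the two translations can be
  -- composed on this line.
  · rcases le_total (coordAcross v z₂) (coordAcross v z₁) with hle | hle
    · obtain ⟨u, hu, hlt⟩ := hW' z₁ hz₁
      obtain ⟨w, hw, hwc⟩ := exists_mem_coordAcross_eq hW hz₂ hu hle hlt
      obtain ⟨t, ht⟩ := exists_eq_add_smul hv hwc.symm
      have := pos_of_add_smul_mem (t' := t) hV hW hVW hz₂ ht₂ hzt₂ hw (ht ▸ hz₁)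
      refine ⟨w, hw, t + t₁, by linarith, ?_⟩
      rw [add_smul, ← add_assoc, ← ht]
      exact hzt₁
    · have hc := coordAcross_add_smul v z₂ t₂
      obtain ⟨u, hu, hlt⟩ := hU' _ hzt₂
      have hle' : coordAcross v (z₁ + t₁ • v) ≤ coordAcross v (z₂ + t₂ • v) := by
        rw [coordAcross_add_smul, coordAcross_add_smul]; exact hle
      obtain ⟨w, hw, hwc⟩ := exists_mem_coordAcross_eq hU hzt₁ hu hle' hlt
      obtain ⟨t, ht⟩ := exists_eq_add_smul hv hwc
      have := pos_of_add_smul_mem (t' := t) hU hV hUV hz₁ ht₁ hzt₁ hzt₂ (ht ▸ hw)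
      refine ⟨z₂, hz₂, t₂ + t, by linarith, ?_⟩
      rw [add_smul, ← add_assoc, ← ht]
      exact hw

/-- Induction on the number of sets. Let `A` be a set that ends first in the transversal direction.
Any passage through `A` can be shortcut, so a cycle would survive the removal of `A`. -/
theorem not_transGen_isAbove {v : ℝ × ℝ} (hv : v ≠ 0) (𝒯 : Finset (Set (ℝ × ℝ)))
    (ho : ∀ U ∈ 𝒯, IsOpen U) (hc : ∀ U ∈ 𝒯, Convex ℝ U) (hb : ∀ U ∈ 𝒯, Bornology.IsBounded U)
    (hd : ∀ U ∈ 𝒯, ∀ V ∈ 𝒯, U ≠ V → Disjoint U V) (U : Set (ℝ × ℝ)) :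
    ¬ Relation.TransGen (fun U V => U ∈ 𝒯 ∧ V ∈ 𝒯 ∧ IsAbove v U V) U U := by
  classical
  induction hN : 𝒯.card generalizing 𝒯 U with
  | zero =>
    intro h
    obtain ⟨V, hV, -⟩ := Relation.TransGen.head'_iff.1 h
    rw [Finset.card_eq_zero.1 hN] at hV
    simp at hV
  | succ N ih =>
    have hne : 𝒯.Nonempty := Finset.card_pos.1 (by omega)
    obtain ⟨A, hA, hmin⟩ := Finset.exists_min_image 𝒯 (fun U => sSup (coordAcross v '' U)) hne
    have hbdd : ∀ U ∈ 𝒯, BddAbove (coordAcross v '' U) := by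
      intro U hU
      have hcl := (hb U hU).closure
      have hcomp : IsCompact (closure U) := Metric.isCompact_of_isClosed_isBounded isClosed_closure hcl
      have hcont : Continuous (coordAcross v) := by
        unfold coordAcross; fun_prop
      exact (hcomp.image hcont).bddAbove.mono (Set.image_mono subset_closure)
    have hfar : ∀ U ∈ 𝒯, U.Nonempty → ∀ z ∈ A, ∃ u ∈ U, coordAcross v z < coordAcross v u := by
      intro U hU hUne z hz
      obtain ⟨w, hw, hzw⟩ := exists_coordAcross_lt hv (ho A hA) hz
      have h1 : coordAcross v w ≤ sSup (coordAcross v '' A) := le_csSup (hbdd A hA) ⟨w, hw, rfl⟩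
      have h2 := hmin U hU
      obtain ⟨_, ⟨u, hu, rfl⟩, hlt⟩ := exists_lt_of_lt_csSup (hUne.image (coordAcross v))
        (hzw.trans_le (h1.trans h2))
      exact ⟨u, hu, hlt⟩
    have hshort : ∀ U V, U ∈ 𝒯 → V ∈ 𝒯 → IsAbove v U A → IsAbove v A V → IsAbove v U V := by
      intro U V hU hV h1 h2
      refine h1.shortcut hv (hc U hU) (hc A hA) (hc V hV) (hd U hU A hA h1.1)
        (hd A hA V hV h2.1) (hfar U hU ?_) (hfar V hV ?_) h2
      · obtain ⟨-, z, -, t, -, h⟩ := h1; exact ⟨_, h⟩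
      · obtain ⟨-, z, h, -⟩ := h2; exact ⟨_, h⟩
    have herase : ∀ U V, U ≠ A → V ≠ A → (U ∈ 𝒯 ∧ V ∈ 𝒯 ∧ IsAbove v U V) →
        (U ∈ 𝒯.erase A ∧ V ∈ 𝒯.erase A ∧ IsAbove v U V) := fun U V h1 h2 h =>
      ⟨Finset.mem_erase.2 ⟨h1, h.1⟩, Finset.mem_erase.2 ⟨h2, h.2.1⟩, h.2.2⟩
    have hIH : ∀ V, ¬ Relation.TransGen
        (fun U V => U ∈ 𝒯.erase A ∧ V ∈ 𝒯.erase A ∧ IsAbove v U V) V V := fun V =>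
      ih (𝒯.erase A) (fun U hU => ho U (Finset.mem_of_mem_erase hU))
        (fun U hU => hc U (Finset.mem_of_mem_erase hU))
        (fun U hU => hb U (Finset.mem_of_mem_erase hU))
        (fun U hU V hV => hd U (Finset.mem_of_mem_erase hU) V (Finset.mem_of_mem_erase hV)) V
        (by rw [Finset.card_erase_of_mem hA]; omega)
    -- A path from `U` is rebuilt without `A`; if it currently sits at `A`, the predecessor `W` of
    -- `A` is remembered so that the next step can be shortcut.
    have key : ∀ U, U ≠ A → ∀ V, Relation.TransGen (fun U V => U ∈ 𝒯 ∧ V ∈ 𝒯 ∧ IsAbove v U V) U V →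
        (V ≠ A → Relation.TransGen
          (fun U V => U ∈ 𝒯.erase A ∧ V ∈ 𝒯.erase A ∧ IsAbove v U V) U V) ∧
        (V = A → ∃ W, W ≠ A ∧ (W ∈ 𝒯 ∧ A ∈ 𝒯 ∧ IsAbove v W A) ∧ Relation.ReflTransGen
          (fun U V => U ∈ 𝒯.erase A ∧ V ∈ 𝒯.erase A ∧ IsAbove v U V) U W) := by
      intro U hUA V h
      induction h with
      | single h =>
        refine ⟨fun hV => .single (herase _ _ hUA hV h), ?_⟩
        rintro rfl
        exact ⟨U, hUA, h, .refl⟩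
      | tail _ h ih =>
        rename_i V V' _
        by_cases hV : V = A
        · obtain ⟨W, hWA, hW, hUW⟩ := ih.2 hV
          subst hV
          have hV'A : V' ≠ V := fun e => h.2.2.1 e.symm
          refine ⟨fun _ => ?_, fun e => absurd e hV'A⟩
          exact Relation.TransGen.tail' hUW (herase _ _ hWA hV'A
            ⟨hW.1, h.2.1, hshort _ _ hW.1 h.2.1 hW.2.2 h.2.2⟩)
        · refine ⟨fun hV' => (ih.1 hV).tail (herase _ _ hV hV' h), ?_⟩
          rintro rfl
          exact ⟨V, hV, h, (ih.1 hV).to_reflTransGen⟩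
    intro h
    by_cases hU : U = A
    · subst hU
      obtain ⟨V, hV, hVU⟩ := Relation.TransGen.head'_iff.1 h
      have hne : V ≠ U := fun e => hV.2.2.1 e.symm
      exact hIH V ((key V hne V (Relation.TransGen.tail' hVU hV)).1 hne)
    · exact hIH U ((key U hU U h).1 hU)

/-! ### Convex sets near the midpoint of an edge -/

/-- Near the midpoint of a side of a triangle, one enters the interior by moving towards the side of
the third vertex. In the coordinates `z = m + α (a - b) + β (c - m)` the interior is `0 < β`, `|2α|
< 1 - β`, and along `u` the coordinate `β` grows linearly from `0`. -/
theorem exists_forall_mem_interior {H : Set (ℝ × ℝ)} (hH : Convex ℝ H) {a b c u v : ℝ × ℝ}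
    (ha : a ∈ H) (hb : b ∈ H) (hc : c ∈ H) (hab : a ≠ b) (h1 : planeDot a v = planeDot b v)
    (h2 : planeDot c v < planeDot a v) (h3 : planeDot u v < 0) :
    ∃ ε > 0, ∀ s : ℝ, 0 < s → s < ε → (1 / 2 : ℝ) • (a + b) + s • u ∈ interior H := by
  set D := planeDot a v - planeDot c v with hD
  have hDpos : 0 < D := by linarith
  set E := (a.1 - b.1) * (a.1 - b.1) + (a.2 - b.2) * (a.2 - b.2) with hE
  have hEpos : 0 < E := by
    rcases (mul_self_nonneg (a.1 - b.1)).lt_or_eq with h | h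
    · nlinarith [mul_self_nonneg (a.2 - b.2)]
    · rcases (mul_self_nonneg (a.2 - b.2)).lt_or_eq with h' | h'
      · nlinarith
      · exact absurd (Prod.ext (sub_eq_zero.1 (mul_self_eq_zero.1 h.symm))
          (sub_eq_zero.1 (mul_self_eq_zero.1 h'.symm))) hab
  set β : ℝ × ℝ → ℝ := fun z => (planeDot a v - planeDot z v) / D with hβ
  set m : ℝ × ℝ := (1 / 2 : ℝ) • (a + b) with hm
  set α : ℝ × ℝ → ℝ := fun z => ((z.1 - m.1 - β z * (c.1 - m.1)) * (a.1 - b.1) +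
    (z.2 - m.2 - β z * (c.2 - m.2)) * (a.2 - b.2)) / E with hα
  have hβc : Continuous β := by
    simp only [hβ, planeDot]; fun_prop
  have hαc : Continuous α := by
    simp only [hα]; fun_prop
  have hopen : IsOpen {z | 0 < β z ∧ β z < 1 ∧ 2 * α z < 1 - β z ∧ -(1 - β z) < 2 * α z} := by
    refine (isOpen_lt continuous_const hβc).inter ((isOpen_lt hβc continuous_const).inter
      ((isOpen_lt (hαc.const_mul 2) (continuous_const.sub hβc)).inter
      (isOpen_lt (continuous_const.sub hβc).neg (hαc.const_mul 2))))
  have hrep : ∀ z, z = m + α z • (a - b) + β z • (c - m) := by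
    intro z
    have hvne : v.1 * v.1 + v.2 * v.2 ≠ 0 := by
      intro h0
      have e1 : v.1 = 0 := by nlinarith [mul_self_nonneg v.1, mul_self_nonneg v.2]
      have e2 : v.2 = 0 := by nlinarith [mul_self_nonneg v.1, mul_self_nonneg v.2]
      simp [planeDot, e1, e2] at h3
    have hβD : β z * D = planeDot a v - planeDot z v := div_mul_cancel₀ _ hDpos.ne'
    have hmv : planeDot m v = planeDot a v := by
      simp only [planeDot, hm, Prod.smul_fst, Prod.smul_snd, Prod.fst_add, Prod.snd_add,
        smul_eq_mul] at h1 ⊢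
      linarith
    set w : ℝ × ℝ := z - m - β z • (c - m) with hw
    have hwv : w.1 * v.1 + w.2 * v.2 = 0 := by
      have : w.1 * v.1 + w.2 * v.2 = planeDot z v - planeDot m v - β z * (planeDot c v - planeDot m v) := by
        simp only [planeDot, hw, Prod.fst_sub, Prod.snd_sub, Prod.smul_fst, Prod.smul_snd, smul_eq_mul]
        ring
      rw [this, hmv]
      rw [hD] at hβD
      linarith
    have hαE : α z * E = w.1 * (a.1 - b.1) + w.2 * (a.2 - b.2) := by
      rw [hα]
      simp only [hw, Prod.fst_sub, Prod.snd_sub, Prod.smul_fst, Prod.smul_snd, smul_eq_mul]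
      exact div_mul_cancel₀ _ hEpos.ne'
    have habv : (a.1 - b.1) * v.1 + (a.2 - b.2) * v.2 = 0 := by
      simp only [planeDot] at h1
      linarith
    have hcross : w.1 * (a.2 - b.2) = w.2 * (a.1 - b.1) := by
      have : (w.1 * (a.2 - b.2) - w.2 * (a.1 - b.1)) * (v.1 * v.1 + v.2 * v.2) = 0 := by
        linear_combination ((a.2 - b.2) * v.1 - (a.1 - b.1) * v.2) * hwv +
          (w.1 * v.2 - w.2 * v.1) * habv
      linarith [(mul_eq_zero.1 this).resolve_right hvne]
    have hweq : w = α z • (a - b) := by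
      ext
      · simp only [Prod.smul_fst, Prod.fst_sub, smul_eq_mul]
        apply mul_right_cancel₀ hEpos.ne'
        rw [mul_right_comm, hαE, hE]
        linear_combination (a.2 - b.2) * hcross
      · simp only [Prod.smul_snd, Prod.snd_sub, smul_eq_mul]
        apply mul_right_cancel₀ hEpos.ne'
        rw [mul_right_comm, hαE, hE]
        linear_combination (-(a.1 - b.1)) * hcross
    rw [← hweq, hw]
    abel
  have hsub : {z | 0 < β z ∧ β z < 1 ∧ 2 * α z < 1 - β z ∧ -(1 - β z) < 2 * α z} ⊆ H := by
    rintro z ⟨e1, e2, e3, e4⟩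
    rw [hrep z]
    have : m + α z • (a - b) + β z • (c - m) =
        ((1 - β z) / 2 + α z) • a + ((1 - β z) / 2 - α z) • b + β z • c := by
      rw [hm]; module
    rw [this]
    have hab : Convex ℝ H := hH
    have hs : ((1 - β z) / 2 + α z) + ((1 - β z) / 2 - α z) + β z = 1 := by ring
    have hpos : 0 < ((1 - β z) / 2 + α z) + ((1 - β z) / 2 - α z) := by linarith
    have hmem := hH (hH ha hb (a := ((1 - β z) / 2 + α z) / (1 - β z))
      (b := ((1 - β z) / 2 - α z) / (1 - β z)) (div_nonneg (by linarith) (by linarith))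
      (div_nonneg (by linarith) (by linarith))
      (by rw [← add_div, div_eq_one_iff_eq (by linarith)]; ring)) hc
      (a := 1 - β z) (b := β z) (by linarith) e1.le (by ring)
    convert hmem using 2
    rw [smul_add, smul_smul, smul_smul, mul_div_cancel₀ _ (by linarith),
      mul_div_cancel₀ _ (by linarith)]
  have hmain : ∀ s : ℝ, β (m + s • u) = s * (-planeDot u v / D) := by
    intro s
    simp only [hβ, planeDot, hm, Prod.smul_fst, Prod.smul_snd, Prod.fst_add, Prod.snd_add,
        smul_eq_mul] at h1 ⊢
    rw [mul_div_assoc']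
    congr 1
    linarith
  have hcont : Continuous fun s : ℝ => m + s • u := by fun_prop
  have h0 : β m = 0 := by simpa using hmain 0
  have hα0 : α m = 0 := by simp [hα, h0]
  have hev : ∀ᶠ s in 𝓝 (0 : ℝ), β (m + s • u) < 1 ∧ 2 * α (m + s • u) < 1 - β (m + s • u) ∧
      -(1 - β (m + s • u)) < 2 * α (m + s • u) := by
    have t1 : Continuous fun s : ℝ => β (m + s • u) := hβc.comp hcont
    have t2 : Continuous fun s : ℝ => α (m + s • u) := hαc.comp hcont
    refine (t1.continuousAt.eventually_lt continuousAt_const ?_).and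
      (((t2.const_mul 2).continuousAt.eventually_lt (continuous_const.sub t1).continuousAt ?_).and
      ((continuous_const.sub t1).neg.continuousAt.eventually_lt (t2.const_mul 2).continuousAt ?_))
    · simp [h0]
    · simp [h0, hα0]
    · simp [h0, hα0]
  obtain ⟨ε, hε, hball⟩ := Metric.eventually_nhds_iff.1 hev
  refine ⟨ε, hε, fun s hs0 hsε => ?_⟩
  refine interior_maximal hsub hopen ⟨?_, hball ?_⟩
  · rw [hmain]
    exact mul_pos hs0 (div_pos (by linarith) hDpos)
  · rw [Real.dist_eq, sub_zero, abs_of_pos hs0]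
    exact hsε

namespace SolitonData

variable {k n : ℕ} {S : SolitonData k n}

/-! ### The subdivision dual to the contour plot -/

/-- The subdifferential of the piecewise linear function `S.f`. -/
def subdiff (S : SolitonData k n) (x : ℝ × ℝ) : Set (ℝ × ℝ) :=
  {z | ∀ q, S.f x + planeDot z (q - x) ≤ S.f q}

theorem convex_subdiff (x : ℝ × ℝ) : Convex ℝ (S.subdiff x) := by
  intro z hz w hw a b ha hb hab q
  have h1 := mul_le_mul_of_nonneg_left (hz q) ha
  have h2 := mul_le_mul_of_nonneg_left (hw q) hb
  have h3 : planeDot (a • z + b • w) (q - x) = a * planeDot z (q - x) + b * planeDot w (q - x) := by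
    simp only [planeDot, Prod.fst_add, Prod.snd_add, Prod.smul_fst, Prod.smul_snd, smul_eq_mul]
    ring
  have h4 : b = 1 - a := by linarith
  rw [h3]
  subst h4
  linarith

theorem isClosed_subdiff (x : ℝ × ℝ) : IsClosed (S.subdiff x) := by
  have : S.subdiff x = ⋂ q, {z | S.f x + planeDot z (q - x) ≤ S.f q} := by
    ext z; simp [subdiff]
  rw [this]
  refine isClosed_iInter fun q => isClosed_le ?_ continuous_const
  unfold planeDot
  fun_prop

theorem gradient_mem_subdiff {J : Finset (Fin n)} {x : ℝ × ℝ} (hJ : J ∈ S.regionsAt x) :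
    S.gradient J ∈ S.subdiff x := by
  intro q
  rw [← (mem_regionsAt.1 hJ).2, ← term_eq_add]
  exact term_le_f (mem_columnMatroid_of_mem_regionsAt hJ) q

/-- A common subgradient at `x` and `y` has product `f y - f x` with `y - x`, so it is confined to a
line. Pushing it by a small multiple of `y - x` leaves the subdifferential at `x`. -/
theorem interior_subdiff_inter {x y : ℝ × ℝ} (hxy : x ≠ y) :
    interior (S.subdiff x ∩ S.subdiff y) = ∅ := by
  rw [Set.eq_empty_iff_forall_notMem]
  intro z hz
  have hc : Continuous fun s : ℝ => z + s • (y - x) := by fun_prop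
  have h2 := hc.tendsto 0
  simp only [zero_smul, add_zero] at h2
  have h3 := (h2.mono_left (nhdsWithin_le_nhds (s := Set.Ioi (0 : ℝ)))).eventually
    (isOpen_interior.mem_nhds hz)
  obtain ⟨s, hs, hs0⟩ := (h3.and (self_mem_nhdsWithin (s := Set.Ioi (0 : ℝ)))).exists
  have hs0 : (0 : ℝ) < s := hs0
  have e1 := (interior_subset hs).1 y
  have e2 := (interior_subset hz).2 x
  simp only [planeDot, Prod.fst_add, Prod.snd_add, Prod.smul_fst, Prod.smul_snd, smul_eq_mul,
    Prod.fst_sub, Prod.snd_sub] at e1 e2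
  have e3 : s * ((y.1 - x.1) * (y.1 - x.1) + (y.2 - x.2) * (y.2 - x.2)) ≤ 0 := by linarith
  have e4 := nonpos_of_mul_nonpos_right e3 hs0
  exact hxy (Prod.ext (by nlinarith [mul_self_nonneg (y.1 - x.1), mul_self_nonneg (y.2 - x.2)])
    (by nlinarith [mul_self_nonneg (y.1 - x.1), mul_self_nonneg (y.2 - x.2)]))

/-- The diagonal `ac` cuts the parallelogram into one triangle in each subdifferential. In a convex
combination, the smaller of the weights of `b` and `d` is moved to `a` and `c` by means of `b + d =
a + c`. -/
theorem subset_subdiff_union_of_parallelogram {x y a b c d : ℝ × ℝ} (h : a + c = b + d)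
    (ha : a ∈ S.subdiff x ∩ S.subdiff y) (hc : c ∈ S.subdiff x ∩ S.subdiff y)
    (hb : b ∈ S.subdiff x) (hd : d ∈ S.subdiff y) :
    convexHull ℝ {a, b, c, d} ⊆ S.subdiff x ∪ S.subdiff y := by
  have hmem : ∀ {U : Set (ℝ × ℝ)}, Convex ℝ U → ∀ {u v w : ℝ × ℝ}, u ∈ U → v ∈ U → w ∈ U →
      ∀ {α β γ : ℝ}, 0 ≤ α → 0 ≤ β → 0 ≤ γ → α + β + γ = 1 → α • u + β • v + γ • w ∈ U := by
    intro U hU u v w hu hv hw α β γ h1 h2 h3 h4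
    have := hU.sum_mem (t := Finset.univ) (w := ![α, β, γ]) (z := ![u, v, w])
      (by intro i _; fin_cases i <;> assumption)
      (by simpa [Fin.sum_univ_three] using h4)
      (by intro i _; fin_cases i <;> assumption)
    simpa [Fin.sum_univ_three] using this
  have hsub : convexHull ℝ {a, b, c, d} ⊆ {z | ∃ α β γ δ : ℝ, 0 ≤ α ∧ 0 ≤ β ∧ 0 ≤ γ ∧ 0 ≤ δ ∧
      α + β + γ + δ = 1 ∧ z = α • a + β • b + γ • c + δ • d} := by
    refine convexHull_min ?_ ?_
    · rintro z (rfl | rfl | rfl | rfl)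
      · exact ⟨1, 0, 0, 0, by simp⟩
      · exact ⟨0, 1, 0, 0, by simp⟩
      · exact ⟨0, 0, 1, 0, by simp⟩
      · exact ⟨0, 0, 0, 1, by simp⟩
    · rintro z ⟨α, β, γ, δ, h1, h2, h3, h4, h5, rfl⟩ w ⟨α', β', γ', δ', h1', h2', h3', h4', h5', rfl⟩
        s t hs ht hst
      refine ⟨s * α + t * α', s * β + t * β', s * γ + t * γ', s * δ + t * δ', by positivity,
        by positivity, by positivity, by positivity, ?_, by module⟩
      linear_combination s * h5 + t * h5' + hst
  rintro z hz
  obtain ⟨α, β, γ, δ, h1, h2, h3, h4, h5, rfl⟩ := hsub hz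
  rcases le_total δ β with hle | hle
  · left
    have := hmem (convex_subdiff x) ha.1 hb hc.1 (α := α + δ) (β := β - δ) (γ := γ + δ)
      (by linarith) (by linarith) (by linarith) (by linarith)
    convert this using 1
    calc α • a + β • b + γ • c + δ • d = α • a + (β - δ) • b + γ • c + δ • (b + d) := by module
      _ = _ := by rw [← h]; module
  · right
    have := hmem (convex_subdiff y) ha.2 hd hc.2 (α := α + β) (β := δ - β) (γ := γ + β)
      (by linarith) (by linarith) (by linarith) (by linarith)
    convert this using 1
    calc α • a + β • b + γ • c + δ • d = α • a + (δ - β) • d + γ • c + β • (b + d) := by module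
      _ = _ := by rw [← h]; module

/-- The polygon dual to a trivalent vertex or to an X-crossing. -/
def hull (S : SolitonData k n) (p : ℝ × ℝ) : Set (ℝ × ℝ) :=
  convexHull ℝ (S.gradient '' {J | ∃ x ∈ S.nodePoints p, J ∈ S.regionsAt x})

theorem hull_eq {p q : ℝ × ℝ} (h : S.nodePoints p = S.nodePoints q) : S.hull p = S.hull q := by
  rw [hull, hull, h]

theorem gradient_mem_hull {p : ℝ × ℝ} {J : Finset (Fin n)} (hJ : J ∈ S.regionsAt p) :
    S.gradient J ∈ S.hull p :=
  subset_convexHull _ _ ⟨J, ⟨p, mem_nodePoints_self p, hJ⟩, rfl⟩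

/-- At a single point the subdifferential is convex and contains the gradients. For a crossing with
a phase shift, the gradients of the two regions on either side of the shift belong to both
subdifferentials and span the diagonal that cuts the parallelogram. -/
theorem hull_subset (hS : S.HasGenericSlopes) (p : ℝ × ℝ) :
    S.hull p ⊆ ⋃ x ∈ S.nodePoints p, S.subdiff x := by
  by_cases hp : ∃ q, q ≠ p ∧ S.IsXCrossing p q
  · obtain ⟨q, hqp, hq⟩ := hp
    rw [nodePoints_of_isXCrossing hS hq]
    rw [hull, nodePoints_of_isXCrossing hS hq]
    obtain ⟨B, i, j, l, m, h⟩ := isXCrossing_iff.1 hq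
    have hm1 := h.mem_left
    have hm2 := h.mem_right
    rcases h.regions with ⟨h1, -⟩ | ⟨-, h1, h2⟩
    · exact absurd h1.symm hqp
    have := subset_subdiff_union_of_parallelogram (S := S) (x := p) (y := q)
      (a := S.gradient (insert i (insert l B))) (b := S.gradient (insert j (insert l B)))
      (c := S.gradient (insert j (insert m B))) (d := S.gradient (insert i (insert m B)))
      (by rw [h.gradient_il, h.gradient_jl, h.gradient_im, h.gradient_jm]
          ext <;> simp <;> ring)
      ⟨gradient_mem_subdiff hm1.1, gradient_mem_subdiff hm2.1⟩
      ⟨gradient_mem_subdiff hm1.2.2, gradient_mem_subdiff hm2.2.2⟩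
      (gradient_mem_subdiff hm1.2.1) (gradient_mem_subdiff hm2.2.1)
    rw [Set.biUnion_pair]
    refine (convexHull_mono ?_).trans this
    rintro _ ⟨J, ⟨x, rfl | rfl, hJ⟩, rfl⟩
    · rw [h1] at hJ
      simp only [Finset.mem_insert, Finset.mem_singleton] at hJ
      rcases hJ with rfl | rfl | rfl <;> simp
    · rw [h2] at hJ
      simp only [Finset.mem_insert, Finset.mem_singleton] at hJ
      rcases hJ with rfl | rfl | rfl <;> simp
  · refine Set.Subset.trans (convexHull_min ?_ (convex_subdiff p))
      (Set.subset_biUnion_of_mem (mem_nodePoints_self p))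
    rintro _ ⟨J, ⟨x, hx, hJ⟩, rfl⟩
    have : x = p := by
      by_contra hne
      rcases hx with h | h
      · exact hne h.symm
      · exact hp ⟨x, hne, h⟩
    subst this
    exact gradient_mem_subdiff hJ

theorem exists_nodePoints_subset (hS : S.HasGenericSlopes) (p : ℝ × ℝ) :
    ∃ q, S.nodePoints p ⊆ {p, q} := by
  by_cases hp : ∃ q, S.IsXCrossing p q
  · obtain ⟨q, hq⟩ := hp
    exact ⟨q, (nodePoints_of_isXCrossing hS hq).subset⟩
  · refine ⟨p, ?_⟩
    rintro x (h | h)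
    · exact Or.inl h.symm
    · exact absurd ⟨x, h⟩ hp

/-- The interior of the polygon dual to a trivalent vertex or to an X-crossing. -/
def tile (S : SolitonData k n) (p : ℝ × ℝ) : Set (ℝ × ℝ) := interior (S.hull p)

/-- Distinct nodes have no point in common, so the two polygons meet only in intersections of
subdifferentials at distinct points, which are closed without interior. -/
theorem disjoint_tile (hS : S.HasGenericSlopes) {p p' : ℝ × ℝ}
    (h : S.nodePoints p ≠ S.nodePoints p') : Disjoint (S.tile p) (S.tile p') := by
  have hne : ∀ x ∈ S.nodePoints p, ∀ y ∈ S.nodePoints p', x ≠ y := by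
    rintro x hx _ hy rfl
    exact h ((nodePoints_eq hS hx).symm.trans (nodePoints_eq hS hy))
  rw [Set.disjoint_iff_inter_eq_empty, tile, tile, ← interior_inter]
  obtain ⟨q, hq⟩ := exists_nodePoints_subset hS p
  obtain ⟨q', hq'⟩ := exists_nodePoints_subset hS p'
  -- The clause `x ≠ y` empties the set when the points coincide, so all four pairs of bounding
  -- points can be treated alike.
  have hcl : ∀ x y : ℝ × ℝ, IsClosed ({z | z ∈ S.subdiff x ∩ S.subdiff y ∧ x ≠ y}) := by
    intro x y
    by_cases hxy : x = y
    · simp [hxy]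
    · simp only [ne_eq, hxy, not_false_eq_true, and_true, Set.ofPred_mem_eq]
      exact (isClosed_subdiff x).inter (isClosed_subdiff y)
  have hem : ∀ x y : ℝ × ℝ, interior ({z | z ∈ S.subdiff x ∩ S.subdiff y ∧ x ≠ y}) = ∅ := by
    intro x y
    by_cases hxy : x = y
    · simp [hxy]
    · simp only [ne_eq, hxy, not_false_eq_true, and_true, Set.ofPred_mem_eq]
      exact interior_subdiff_inter hxy
  have hsub : S.hull p ∩ S.hull p' ⊆
      {z | z ∈ S.subdiff p ∩ S.subdiff p' ∧ p ≠ p'} ∪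
      ({z | z ∈ S.subdiff p ∩ S.subdiff q' ∧ p ≠ q'} ∪
      ({z | z ∈ S.subdiff q ∩ S.subdiff p' ∧ q ≠ p'} ∪
      {z | z ∈ S.subdiff q ∩ S.subdiff q' ∧ q ≠ q'})) := by
    rintro z ⟨h1, h2⟩
    obtain ⟨x, hx, hzx⟩ := Set.mem_iUnion₂.1 (hull_subset hS p h1)
    obtain ⟨y, hy, hzy⟩ := Set.mem_iUnion₂.1 (hull_subset hS p' h2)
    have hxy := hne x hx y hy
    rcases hq hx with rfl | rfl <;> rcases hq' hy with rfl | rfl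
    · exact Or.inl ⟨⟨hzx, hzy⟩, hxy⟩
    · exact Or.inr (Or.inl ⟨⟨hzx, hzy⟩, hxy⟩)
    · exact Or.inr (Or.inr (Or.inl ⟨⟨hzx, hzy⟩, hxy⟩))
    · exact Or.inr (Or.inr (Or.inr ⟨⟨hzx, hzy⟩, hxy⟩))
  refine Set.subset_empty_iff.1 ((interior_mono hsub).trans ?_)
  rw [Set.union_comm, interior_union_isClosed_of_interior_empty
    ((hcl _ _).union ((hcl _ _).union (hcl _ _))) (hem _ _),
    Set.union_comm, interior_union_isClosed_of_interior_empty
    ((hcl _ _).union (hcl _ _)) (hem _ _),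
    interior_union_isClosed_of_interior_empty (hcl _ _) (hem _ _), hem]

theorem isBounded_hull (p : ℝ × ℝ) : Bornology.IsBounded (S.hull p) := by
  rw [hull, isBounded_convexHull]
  exact ((Set.toFinite _).image _).isBounded

/-! ### Darts which carry an index descend through the tiles -/

theorem Dart.exists_insert (d : S.Dart) : ∃ B i j, i ∉ B ∧ j ∉ B ∧ i ≠ j ∧
    d.1.1 = insert i B ∧ d.1.2 = insert j B :=
  exists_insert_of_card_sdiff
    ((card_of_mem_columnMatroid (mem_columnMatroid_of_mem_regions d.2.1)).trans
      (card_of_mem_columnMatroid (mem_columnMatroid_of_mem_regions d.2.2.1)).symm) d.2.2.2.1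

theorem Dart.Carries.exists_insert {d : S.Dart} {r : Fin n} (h : d.Carries r) :
    ∃ B i, r ∉ B ∧ i ∉ B ∧ r ≠ i ∧ d.1.1 = insert r B ∧ d.1.2 = insert i B := by
  obtain ⟨B, i, j, hi, hj, hij, h1, h2⟩ := d.exists_insert
  have : r = i := by
    have h3 := h.1
    have h4 := h.2
    rw [h1] at h3
    rw [h2] at h4
    rcases Finset.mem_insert.1 h3 with h | h
    · exact h
    · exact absurd (Finset.mem_insert_of_mem h) h4
  subst this
  exact ⟨B, j, hi, hj, hij, h1, h2⟩

/-- The value is `-(κ_r - κ_i)²`. The vector depends on `r` only, so one fixed direction serves all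
darts of a trip. -/
theorem Dart.Carries.planeDot_neg (hS : S.HasGenericSlopes) {d : S.Dart} {r : Fin n}
    (h : d.Carries r) : planeDot (1, 2 * S.κ r) d.direction < 0 := by
  obtain ⟨B, i, hr, hi, hri, h1, h2⟩ := h.exists_insert
  have hne : S.κ r - S.κ i ≠ 0 := sub_ne_zero.2 fun e => hri (hS.strictMono.injective e)
  rw [d.direction_eq, wallDir, h1, h2, gradient_insert S hr, gradient_insert S hi]
  simp only [planeDot]
  have : 0 < (S.κ r - S.κ i) * (S.κ r - S.κ i) := mul_self_pos.2 hne
  nlinarith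

theorem Dart.StartsAt.exists_mem_tile (hS : S.HasGenericSlopes) {d : S.Dart} {p u : ℝ × ℝ}
    (h : d.StartsAt p) (hu : planeDot u d.direction < 0) : ∃ ε > 0, ∀ s : ℝ, 0 < s → s < ε →
      (1 / 2 : ℝ) • (S.gradient d.1.1 + S.gradient d.1.2) + s • u ∈ S.tile p := by
  obtain ⟨h1, h2, ⟨L, hL, hL1, hL2⟩, h3⟩ :=
    (wallStartsAt_iff hS.toHasDistinctSlopes).1 (startsAt_iff.1 h)
  refine exists_forall_mem_interior (convex_convexHull ℝ _) (gradient_mem_hull h1)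
    (gradient_mem_hull h2) (gradient_mem_hull hL) ?_ (planeDot_wallDir S d.1.1 d.1.2)
    (h3 L hL hL1 hL2) hu
  intro e
  exact d.2.ne (hS.inj _ (mem_columnMatroid_of_mem_regionsAt h1) _
    (mem_columnMatroid_of_mem_regionsAt h2) (congrArg Prod.fst e))

/-- The polygon at the start lies entirely on one side of the edge dual to the dart; this shows
below that the tiles at the two ends of a dart are distinct. -/
theorem Dart.StartsAt.planeDot_le (hS : S.HasGenericSlopes) (hC : S.IsGeneric) {d : S.Dart}
    {p z : ℝ × ℝ} (h : d.StartsAt p) (hz : z ∈ S.hull p) :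
    planeDot z d.direction ≤ planeDot (S.gradient d.1.1) d.direction := by
  obtain ⟨m, _, R, hR, a, rfl, -⟩ := Dart.exists_isNode hS hC h
  set c := planeDot (S.gradient (hR.dart a).1.1) (hR.dart a).direction with hc
  have hconv : Convex ℝ {z : ℝ × ℝ | planeDot z (hR.dart a).direction ≤ c} := by
    intro z hz w hw s t hs ht hst
    have h1 := mul_le_mul_of_nonneg_left hz hs
    have h2 := mul_le_mul_of_nonneg_left hw ht
    have h4 : t = 1 - s := by linarith
    have h3 : planeDot (s • z + t • w) (hR.dart a).direction =
        s * planeDot z (hR.dart a).direction + t * planeDot w (hR.dart a).direction := by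
      simp only [planeDot, Prod.fst_add, Prod.snd_add, Prod.smul_fst, Prod.smul_snd, smul_eq_mul]
      ring
    show planeDot (s • z + t • w) (hR.dart a).direction ≤ c
    rw [h3]
    subst h4
    linarith
  refine convexHull_min ?_ hconv hz
  rintro _ ⟨J, hJ, rfl⟩
  obtain ⟨b, rfl⟩ := (hR.range_eq J).2 hJ
  show _ ≤ c
  have e : c = planeDot (S.gradient (R a)) (hR.dart a).direction := by
    rw [hc, Dart.direction_eq]
    exact planeDot_wallDir S _ _
  by_cases h1 : b = a
  · rw [h1, e]
  by_cases h2 : b = a + 1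
  · rw [h2]; rfl
  · rw [e]
    exact (hR.convex a b h1 h2).le

/-- The polygons at the two ends share the edge dual to the dart. From its midpoint, a small
positive multiple of the tangent vector enters the tile at the start and the opposite multiple
enters the tile at the end. -/
theorem Dart.Carries.isAbove (hS : S.HasGenericSlopes) (hC : S.IsGeneric) {d : S.Dart} {r : Fin n}
    (h : d.Carries r) {p p' : ℝ × ℝ} (hp : d.StartsAt p) (hp' : d.rev.StartsAt p') :
    IsAbove (1, 2 * S.κ r) (S.tile p) (S.tile p') := by
  have hn := h.planeDot_neg hS
  have hdir : d.rev.direction = -d.direction := by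
    rw [Dart.direction_eq, Dart.direction_eq]
    exact wallDir_swap S _ _
  obtain ⟨ε, hε, h1⟩ := hp.exists_mem_tile hS hn
  obtain ⟨ε', hε', h2⟩ := hp'.exists_mem_tile hS (u := -(1, 2 * S.κ r)) (by
    rw [hdir]
    simp only [planeDot, Prod.fst_neg, Prod.snd_neg] at hn ⊢
    linarith)
  have hs0 : 0 < min ε ε' / 2 := half_pos (lt_min hε hε')
  have hs1 : min ε ε' / 2 < min ε ε' := half_lt_self (lt_min hε hε')
  set s := min ε ε' / 2 with hs
  have m1 := h1 s hs0 (hs1.trans_le (min_le_left _ _))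
  have m2 := h2 s hs0 (hs1.trans_le (min_le_right _ _))
  have hrev1 : d.rev.1.1 = d.1.2 := rfl
  have hrev2 : d.rev.1.2 = d.1.1 := rfl
  rw [hrev1, hrev2, add_comm (S.gradient d.1.2)] at m2
  refine ⟨?_, _, m2, 2 * s, by linarith, ?_⟩
  · intro e
    rw [← e] at m2
    have h3 := hp.planeDot_le hS hC (interior_subset m2)
    have h4 := planeDot_wallDir S d.1.1 d.1.2
    rw [← Dart.direction_eq] at h4
    simp only [planeDot, Prod.fst_add, Prod.snd_add, Prod.smul_fst, Prod.smul_snd, smul_eq_mul,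
      Prod.fst_neg, Prod.snd_neg] at h3 h4 hn
    nlinarith
  · convert m1 using 1
    module

instance : Finite S.Dart := Subtype.finite

/-- A path that follows the rules of the road never closes up. -/
theorem not_transGen_step (π : Equiv.Perm (Fin n)) (hS : S.HasGenericSlopes) (hC : S.IsGeneric)
    (r : Fin n) (d : S.Dart) :
    ¬ Relation.TransGen (fun d d' : S.Dart => d.Carries r ∧ (S.plabic π).Step d d') d d := by
  classical
  have : Fintype S.Dart := Fintype.ofFinite _
  have hv : ((1, 2 * S.κ r) : ℝ × ℝ) ≠ 0 := fun e => one_ne_zero (congrArg Prod.fst e)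
  -- The tile of the node that the dart leaves, and the empty set for a dart from infinity. The end
  -- of a dart and the start of its successor belong to one node, so a step moves strictly down
  -- among these tiles.
  let Ψ : S.Dart → Set (ℝ × ℝ) := fun d => if h : ∃ p, d.StartsAt p then S.tile h.choose else ∅
  have hΨ : ∀ {d : S.Dart} {p : ℝ × ℝ}, d.StartsAt p → Ψ d = S.tile p := by
    intro d p hp
    have h : ∃ p, d.StartsAt p := ⟨p, hp⟩
    have : h.choose = p := Dart.StartsAt.unique hS.toHasDistinctSlopes h.choose_spec hp
    simp only [Ψ, dif_pos h, this]
  have hΨ' : ∀ d : S.Dart, Ψ d = ∅ ∨ ∃ p, Ψ d = S.tile p := by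
    intro d
    by_cases h : ∃ p, d.StartsAt p
    · obtain ⟨p, hp⟩ := h
      exact Or.inr ⟨p, hΨ hp⟩
    · exact Or.inl (dif_neg h)
  have hac := not_transGen_isAbove hv (Finset.univ.image Ψ)
    (by
      simp only [Finset.mem_image, Finset.mem_univ, true_and, forall_exists_index,
        forall_apply_eq_imp_iff]
      intro d
      rcases hΨ' d with h | ⟨p, h⟩ <;> rw [h]
      · exact isOpen_empty
      · exact isOpen_interior)
    (by
      simp only [Finset.mem_image, Finset.mem_univ, true_and, forall_exists_index,
        forall_apply_eq_imp_iff]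
      intro d
      rcases hΨ' d with h | ⟨p, h⟩ <;> rw [h]
      · exact convex_empty
      · exact (convex_convexHull ℝ _).interior)
    (by
      simp only [Finset.mem_image, Finset.mem_univ, true_and, forall_exists_index,
        forall_apply_eq_imp_iff]
      intro d
      rcases hΨ' d with h | ⟨p, h⟩ <;> rw [h]
      · exact Bornology.isBounded_empty
      · exact (isBounded_hull p).subset interior_subset)
    (by
      simp only [Finset.mem_image, Finset.mem_univ, true_and, forall_exists_index,
        forall_apply_eq_imp_iff]
      intro d d'
      rcases hΨ' d with h | ⟨p, h⟩ <;> rcases hΨ' d' with h' | ⟨p', h'⟩ <;> rw [h, h']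
      · simp
      · simp
      · simp
      · intro hne
        exact disjoint_tile hS fun e => hne (by rw [tile, tile, hull_eq e]))
    (Ψ d)
  have hstart : ∀ {d d' : S.Dart}, (S.plabic π).Step d d' → ∃ p, d'.StartsAt p := by
    intro d d' h
    obtain ⟨p, q, -, hq, -⟩ := (step_carries_iff π hS hC h).1
    exact ⟨q, hq⟩
  have hlift : ∀ {d d' : S.Dart},
      Relation.TransGen (fun d d' : S.Dart => d.Carries r ∧ (S.plabic π).Step d d') d d' →
      (∃ p, d.StartsAt p) → Relation.TransGen (fun U V => U ∈ Finset.univ.image Ψ ∧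
        V ∈ Finset.univ.image Ψ ∧ IsAbove (1, 2 * S.κ r) U V) (Ψ d) (Ψ d') := by
    have hone : ∀ {d d' : S.Dart}, d.Carries r → (S.plabic π).Step d d' → (∃ p, d.StartsAt p) →
        IsAbove (1, 2 * S.κ r) (Ψ d) (Ψ d') := by
      rintro d d' hc hs ⟨p, hp⟩
      obtain ⟨p', hp', q, hq, hd'⟩ := sameOrigin_iff.1 (step_carries_iff π hS hC hs).1
      have e : S.tile q = S.tile p' := by rw [tile, tile, hull_eq (nodePoints_eq hS hq)]
      rw [hΨ hp, hΨ hd', e]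
      exact hc.isAbove hS hC hp hp'
    intro d d' h
    induction h using Relation.TransGen.head_induction_on with
    | single h =>
      intro hp
      exact .single ⟨Finset.mem_image_of_mem _ (Finset.mem_univ _),
        Finset.mem_image_of_mem _ (Finset.mem_univ _), hone h.1 h.2 hp⟩
    | head h _ ih =>
      intro hp
      exact .head ⟨Finset.mem_image_of_mem _ (Finset.mem_univ _),
        Finset.mem_image_of_mem _ (Finset.mem_univ _), hone h.1 h.2 hp⟩ (ih (hstart h.2))
  intro h
  -- Every dart of a cycle has a predecessor and thus starts at a node.
  obtain ⟨e, -, he⟩ := Relation.TransGen.tail'_iff.1 h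
  exact hac (hlift h (hstart he.2))

end SolitonData

namespace SolitonData

variable {k n : ℕ} {S : SolitonData k n}

/-! ### Unbounded line-solitons -/

/-- The rate of growth of the exponent of `E_e` in the direction `ω`. -/
def rate (S : SolitonData k n) (ω : ℝ × ℝ) (e : Fin n) : ℝ := S.κ e * ω.1 + S.κ e ^ 2 * ω.2

theorem sum_rate (S : SolitonData k n) (ω : ℝ × ℝ) (J : Finset (Fin n)) :
    ∑ e ∈ J, S.rate ω e = planeDot (S.gradient J) ω := by
  simp only [rate, Finset.sum_add_distrib, planeDot, gradient, Finset.sum_mul]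

theorem isLocallyMaximal_of_forall_le {ω : ℝ × ℝ} {J : Finset (Fin n)} (hJ : J ∈ columnMatroid S.A)
    (h : ∀ L ∈ columnMatroid S.A, planeDot (S.gradient L) ω ≤ planeDot (S.gradient J) ω) :
    IsLocallyMaximal S.A (S.rate ω) J := by
  refine ⟨hJ, fun f hf e he hL => ?_⟩
  have := h _ hL
  rw [← sum_rate, ← sum_rate, Finset.sum_insert (fun h => he (Finset.mem_of_mem_erase h)),
    Finset.sum_erase_eq_sub hf] at this
  linarith

/-- A term of larger growth rate would overtake that of `I` far out on the ray. -/
theorem planeDot_le_of_ray {ω p : ℝ × ℝ} {I J : Finset (Fin n)}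
    (h : ∀ s : ℝ, 0 ≤ s → p + s • ω ∈ S.wall I J) {L : Finset (Fin n)}
    (hL : L ∈ columnMatroid S.A) : planeDot (S.gradient L) ω ≤ planeDot (S.gradient I) ω := by
  by_contra! hlt
  have key : ∀ s : ℝ, 0 ≤ s → S.term L p + s * planeDot (S.gradient L) ω ≤
      S.term I p + s * planeDot (S.gradient I) ω := by
    intro s hs
    rw [← term_add_smul, ← term_add_smul, (mem_regionsAt.1 (mem_regionsAt_left (h s hs))).2]
    exact term_le_f hL _
  have hδ := sub_pos.2 hlt
  have h0 := key 0 le_rfl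
  have h1 := key ((S.term I p - S.term L p + 1) /
    (planeDot (S.gradient L) ω - planeDot (S.gradient I) ω)) (by apply div_nonneg <;> linarith)
  have h2 := div_mul_cancel₀ (S.term I p - S.term L p + 1) hδ.ne'
  nlinarith

/-- Up to sign, the direction towards infinity of the unbounded line-solitons of type `{i, r}`. -/
def farDir (S : SolitonData k n) (r i : Fin n) : ℝ × ℝ :=
  ((S.κ r - S.κ i) * -(S.κ r + S.κ i), S.κ r - S.κ i)

theorem rate_farDir (r i e : Fin n) : S.rate (S.farDir r i) e - S.rate (S.farDir r i) r =
    (S.κ r - S.κ i) * ((S.κ e - S.κ r) * (S.κ e - S.κ i)) := by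
  simp only [rate, farDir]; ring

theorem rate_farDir_right (r i : Fin n) :
    S.rate (S.farDir r i) i = S.rate (S.farDir r i) r := by
  have := rate_farDir (S := S) r i i
  rw [sub_self (S.κ i), mul_zero, mul_zero] at this
  linarith

/-- The difference of rates is quadratic in `κ_e` with roots `κ_r` and `κ_i` and leading coefficient
`κ_r - κ_i`. It is positive between the roots if `r < i` and outside them if `i < r`; both cases
give the cyclic arc from `r` to `i`. -/
theorem rate_farDir_lt_iff (hS : S.HasGenericSlopes) {r i : Fin n} (hri : r ≠ i) (e : Fin n) :
    S.rate (S.farDir r i) r < S.rate (S.farDir r i) e ↔ e ∈ cyclicArc r i := by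
  have hm : ∀ {a b}, S.κ a < S.κ b ↔ a < b := fun {a b} => hS.strictMono.lt_iff_lt
  rw [mem_cyclicArc hri, ← sub_pos, rate_farDir]
  rcases lt_or_gt_of_ne hri with h | h
  · simp only [h, true_and, not_lt.2 h.le, false_and, or_false]
    have hneg := sub_neg.2 (hm.2 h)
    rw [show ∀ x : ℝ, 0 < (S.κ r - S.κ i) * x ↔ x < 0 from fun x =>
      ⟨fun h => (neg_iff_neg_of_mul_pos h).1 hneg, mul_pos_of_neg_of_neg hneg⟩]
    constructor
    · intro h1
      rcases mul_neg_iff.1 h1 with ⟨h2, h3⟩ | ⟨h2, h3⟩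
      · exact ⟨hm.1 (sub_pos.1 h2), hm.1 (sub_neg.1 h3)⟩
      · exact absurd ((hm.1 (sub_pos.1 h3)).trans (hm.1 (sub_neg.1 h2))) (not_lt.2 h.le)
    · rintro ⟨h1, h2⟩
      exact mul_neg_of_pos_of_neg (sub_pos.2 (hm.2 h1)) (sub_neg.2 (hm.2 h2))
  · simp only [h, true_and, not_lt.2 h.le, false_and, false_or]
    rw [mul_pos_iff_of_pos_left (sub_pos.2 (hm.2 h))]
    constructor
    · intro h1
      rcases mul_pos_iff.1 h1 with ⟨h2, -⟩ | ⟨-, h3⟩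
      · exact Or.inl (hm.1 (sub_pos.1 h2))
      · exact Or.inr (hm.1 (sub_neg.1 h3))
    · rintro (h1 | h1)
      · exact mul_pos (sub_pos.2 (hm.2 h1)) (sub_pos.2 (hm.2 (h.trans h1)))
      · exact mul_pos_of_neg_of_neg (sub_neg.2 (hm.2 (h1.trans h))) (sub_neg.2 (hm.2 h1))

/-- The rate is quadratic in `κ_e`, so a tie fixes the sum of the two parameters. Pair sums are
distinct, hence at most one pair is tied. -/
theorem eq_or_eq_of_rate_eq (hS : S.HasGenericSlopes) {ω : ℝ × ℝ} (hω : ω.2 ≠ 0)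
    {a b e f : Fin n} (hab : a ≠ b) (h : S.rate ω a = S.rate ω b) (hef : e ≠ f)
    (h' : S.rate ω e = S.rate ω f) : (a = e ∧ b = f) ∨ (a = f ∧ b = e) := by
  have key : ∀ {a b}, a ≠ b → S.rate ω a = S.rate ω b → ω.1 + (S.κ a + S.κ b) * ω.2 = 0 := by
    intro a b hab h
    have hne : S.κ a - S.κ b ≠ 0 := sub_ne_zero.2 fun e => hab (hS.strictMono.injective e)
    apply mul_left_cancel₀ hne
    simp only [rate] at h
    linear_combination h
  have h1 := key hab h
  have h2 := key hef h'
  have h3 : S.κ a + S.κ b = S.κ e + S.κ f := by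
    apply mul_right_cancel₀ hω
    linear_combination h1 - h2
  exact hS.pair_sums a b e f hab hef h3

/-- `I` spans the column of `i` by elements at least as fast, that is by `r` and the arc; `J`
contains `i`, so the arc alone does not span it. These two conditions characterize `π i = r`. -/
theorem apply_eq_of_isLocallyMaximal (hS : S.HasGenericSlopes) (h0 : ∀ j, S.A.col j ≠ 0)
    {π : Equiv.Perm (Fin n)} (hπ : IsCellDerangement S.A π) {r i : Fin n} (hri : r ≠ i)
    {I J : Finset (Fin n)} (hI : IsLocallyMaximal S.A (S.rate (S.farDir r i)) I)
    (hJ : IsLocallyMaximal S.A (S.rate (S.farDir r i)) J) (hiI : i ∉ I) (hiJ : i ∈ J) :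
    π i = r := by
  have hlt := rate_farDir_lt_iff hS hri
  rw [hπ.apply_eq_iff h0 hri.symm]
  constructor
  · refine Submodule.span_mono (Set.image_mono ?_) (hI.col_mem_span i)
    rintro f ⟨hf, hle⟩
    rw [rate_farDir_right] at hle
    rcases hle.lt_or_eq with h | h
    · exact Or.inr ((hlt f).1 h)
    · left
      by_contra hfr
      rcases eq_or_eq_of_rate_eq hS (ω := S.farDir r i)
        (sub_ne_zero.2 fun e => hri (hS.strictMono.injective e)) hri
        (rate_farDir_right r i).symm (Ne.symm hfr) h with ⟨-, h⟩ | ⟨h, -⟩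
      · exact hiI (h ▸ hf)
      · exact hfr h.symm
  · refine hJ.col_notMem_span hiJ fun f hf => ?_
    rw [rate_farDir_right]
    exact (hlt f).2 hf

/-- Exactly two bases have maximal growth along this ray. The span conditions for `π i = r` show
that a locally maximal basis contains exactly one of `r` and `i`, either can be exchanged for the
other, and membership of the untied indices is forced. -/
theorem exists_forall_lt_farDir (hS : S.HasGenericSlopes) (h0 : ∀ j, S.A.col j ≠ 0)
    {π : Equiv.Perm (Fin n)} (hπ : IsCellDerangement S.A π) (i : Fin n) :
    ∃ B : Finset (Fin n), π i ∉ B ∧ i ∉ B ∧ insert (π i) B ∈ columnMatroid S.A ∧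
      insert i B ∈ columnMatroid S.A ∧
      ∀ L ∈ columnMatroid S.A, L ≠ insert (π i) B → L ≠ insert i B →
        planeDot (S.gradient L) (S.farDir (π i) i) <
        planeDot (S.gradient (insert (π i) B)) (S.farDir (π i) i) := by
  have hri : π i ≠ i := hπ.apply_ne i
  obtain ⟨hspan, hnot⟩ := (hπ.apply_eq_iff h0 hri.symm).1 rfl
  set r := π i with hr
  set ω := S.farDir r i with hω
  have hω2 : ω.2 ≠ 0 := sub_ne_zero.2 fun e => hri (hS.strictMono.injective e)
  have hlt := rate_farDir_lt_iff hS hri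
  have hirate : S.rate ω i = S.rate ω r := rate_farDir_right r i
  have hiarc : i ∉ cyclicArc r i := fun h => ((hlt i).2 h).ne hirate.symm
  have hrarc : r ∉ cyclicArc r i := fun h => ((hlt r).2 h).ne rfl
  have hties : ∀ e, e ≠ i → e ≠ r → ∀ f, S.rate ω f = S.rate ω e → f = e := by
    intro e hei her f hfe
    by_contra hne
    rcases eq_or_eq_of_rate_eq hS hω2 hri hirate.symm hne hfe with ⟨-, h⟩ | ⟨h, -⟩
    · exact hei h.symm
    · exact her h.symm
  have harc : ∀ {L : Finset (Fin n)}, IsLocallyMaximal S.A (S.rate ω) L → ∀ {s : Set (Fin n)},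
      (∀ f ∈ L, f ∈ cyclicArc r i → f ∈ s) →
      Submodule.span ℝ (S.A.col '' cyclicArc r i) ≤ Submodule.span ℝ (S.A.col '' s) := by
    intro L hL s hs
    rw [Submodule.span_le]
    rintro _ ⟨e, he, rfl⟩
    refine Submodule.span_mono (Set.image_mono ?_) (hL.col_mem_span e)
    rintro f ⟨hf, hle⟩
    exact hs f hf ((hlt f).1 (((hlt e).2 he).trans_le hle))
  -- The arc is spanned by the members of `L` in it, so `r` and these members would span the column
  -- of `i`, contradicting independence.
  have hboth : ∀ {L : Finset (Fin n)}, IsLocallyMaximal S.A (S.rate ω) L → r ∈ L → i ∉ L := by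
    intro L hL hrL hiL
    refine col_notMem_span_sdiff hL.1 hiL ?_
    have : Submodule.span ℝ (S.A.col '' insert r (cyclicArc r i)) ≤
        Submodule.span ℝ (S.A.col '' ((L : Set (Fin n)) \ {i})) := by
      rw [Set.image_insert_eq, Submodule.span_insert, sup_le_iff]
      refine ⟨?_, harc hL fun f hf hfa => ⟨hf, fun e => hiarc (e ▸ hfa)⟩⟩
      rw [Submodule.span_singleton_le_iff_mem]
      exact Submodule.subset_span ⟨r, ⟨hrL, hri⟩, rfl⟩
    exact this hspan
  -- If both were missing, the column of `i` would be spanned by strictly faster elements, that is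
  -- by the arc.
  have hneither : ∀ {L : Finset (Fin n)}, IsLocallyMaximal S.A (S.rate ω) L → r ∉ L → i ∈ L := by
    intro L hL hrL
    by_contra hiL
    refine hnot (Submodule.span_mono (Set.image_mono ?_) (hL.col_mem_span i))
    rintro f ⟨hf, hle⟩
    rw [hirate] at hle
    refine (hlt f).1 (lt_of_le_of_ne hle fun e => ?_)
    exact hrL ((hties f (fun e => hiL (e ▸ hf)) (fun e => hrL (e ▸ hf)) r e) ▸ hf)
  obtain ⟨I₀, hI₀, hmax⟩ := Finset.exists_max_image (columnMatroid S.A)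
    (fun L => planeDot (S.gradient L) ω) hS.nonempty
  have hloc := isLocallyMaximal_of_forall_le hI₀ hmax
  have hpair : ∃ B : Finset (Fin n), r ∉ B ∧ i ∉ B ∧ insert r B ∈ columnMatroid S.A ∧
      insert i B ∈ columnMatroid S.A ∧ (I₀ = insert r B ∨ I₀ = insert i B) := by
    by_cases hr0 : r ∈ I₀
    · have hi0 := hboth hloc hr0
      refine ⟨I₀.erase r, Finset.notMem_erase _ _, fun h => hi0 (Finset.mem_of_mem_erase h), ?_,
        ?_, Or.inl (Finset.insert_erase hr0).symm⟩
      · rwa [Finset.insert_erase hr0]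
      · refine insert_erase_mem_columnMatroid hI₀ hr0 hi0 fun hmem => ?_
        refine col_notMem_span_sdiff hI₀ hr0 ?_
        rw [Set.image_insert_eq] at hspan
        -- Modulo the span of the arc, the columns of `i` and `r` are nonzero multiples of each
        -- other.
        have h1 := mem_span_insert_exchange hspan hnot
        rw [← Set.image_insert_eq] at h1
        have : Submodule.span ℝ (S.A.col '' insert i (cyclicArc r i)) ≤
            Submodule.span ℝ (S.A.col '' ((I₀ : Set (Fin n)) \ {r})) := by
          rw [Set.image_insert_eq, Submodule.span_insert, sup_le_iff]
          refine ⟨?_, harc hloc fun f hf hfa => ⟨hf, fun e => hrarc (e ▸ hfa)⟩⟩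
          rwa [Submodule.span_singleton_le_iff_mem]
        exact this h1
    · have hi0 := hneither hloc hr0
      refine ⟨I₀.erase i, fun h => hr0 (Finset.mem_of_mem_erase h), Finset.notMem_erase _ _, ?_,
        ?_, Or.inr (Finset.insert_erase hi0).symm⟩
      · refine insert_erase_mem_columnMatroid hI₀ hi0 hr0 fun hmem => ?_
        refine col_notMem_span_sdiff hI₀ hi0 ?_
        have : Submodule.span ℝ (S.A.col '' insert r (cyclicArc r i)) ≤
            Submodule.span ℝ (S.A.col '' ((I₀ : Set (Fin n)) \ {i})) := by
          rw [Set.image_insert_eq, Submodule.span_insert, sup_le_iff]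
          refine ⟨?_, harc hloc fun f hf hfa => ⟨hf, fun e => hiarc (e ▸ hfa)⟩⟩
          rwa [Submodule.span_singleton_le_iff_mem]
        exact this hspan
      · rwa [Finset.insert_erase hi0]
  obtain ⟨B, hrB, hiB, hIM, hJM, hB⟩ := hpair
  have hIJ : planeDot (S.gradient (insert r B)) ω = planeDot (S.gradient (insert i B)) ω := by
    rw [← sum_rate, ← sum_rate, Finset.sum_insert hrB, Finset.sum_insert hiB, hirate]
  have hval : planeDot (S.gradient I₀) ω = planeDot (S.gradient (insert r B)) ω := by
    rcases hB with h | h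
    · rw [h]
    · rw [h, hIJ]
  have hIloc : IsLocallyMaximal S.A (S.rate ω) (insert r B) :=
    isLocallyMaximal_of_forall_le hIM fun L hL => (hmax L hL).trans hval.le
  refine ⟨B, hrB, hiB, hIM, hJM, fun L hL h1 h2 => lt_of_le_of_ne ((hmax L hL).trans hval.le) ?_⟩
  intro heq
  have hLloc : IsLocallyMaximal S.A (S.rate ω) L :=
    isLocallyMaximal_of_forall_le hL fun L' hL' => (hmax L' hL').trans (hval.trans heq.symm).le
  have hag : ∀ e, e ≠ i → e ≠ r → (e ∈ L ↔ e ∈ B) := by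
    intro e hei her
    rw [hLloc.mem_iff (hties e hei her), ← hIloc.mem_iff (hties e hei her), Finset.mem_insert,
      or_iff_right her]
  by_cases hrL : r ∈ L
  · refine h1 (Finset.ext fun e => ?_)
    rw [Finset.mem_insert]
    rcases eq_or_ne e r with rfl | her
    · simp [hrL]
    rcases eq_or_ne e i with rfl | hei
    · simp [hboth hLloc hrL, her, hiB]
    · simp [her, hag e hei her]
  · refine h2 (Finset.ext fun e => ?_)
    rw [Finset.mem_insert]
    rcases eq_or_ne e i with rfl | hei
    · simp [hneither hLloc hrL]
    rcases eq_or_ne e r with rfl | her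
    · simp only [hrL, hei, hrB, or_self]
    · simp [hei, hag e hei her]

/-- Both sets are locally maximal for the rate along the ray, so they differ only in tied indices,
and there is at most one tied pair. Consequently phase shifts are bounded. -/
theorem card_sdiff_eq_one_of_ray (hS : S.HasGenericSlopes) {ω p : ℝ × ℝ} (hω : ω.2 ≠ 0)
    {I J : Finset (Fin n)} (hIJ : I ≠ J) (h : ∀ s : ℝ, 0 ≤ s → p + s • ω ∈ S.wall I J) :
    (I \ J).card = 1 := by
  have hw := h 0 le_rfl
  have hI := mem_columnMatroid_of_mem_regionsAt (mem_regionsAt_left hw)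
  have hJ := mem_columnMatroid_of_mem_regionsAt (mem_regionsAt_right hw)
  have hIloc := isLocallyMaximal_of_forall_le hI fun L hL => planeDot_le_of_ray h hL
  have hJloc := isLocallyMaximal_of_forall_le hJ fun L hL => planeDot_le_of_ray (I := J) (J := I)
    (fun s hs => by rw [mem_wall, Finset.pair_comm]; exact h s hs) hL
  have hties : ∀ e, (e ∈ I ∧ e ∉ J) ∨ (e ∉ I ∧ e ∈ J) → ∃ f, f ≠ e ∧ S.rate ω f = S.rate ω e := by
    intro e he
    by_contra! hno
    have hno' : ∀ f, S.rate ω f = S.rate ω e → f = e := fun f hf =>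
      by_contra fun hne => hno f hne hf
    have := (hIloc.mem_iff hno').trans (hJloc.mem_iff hno').symm
    tauto
  have hcard : I.card = J.card :=
    (card_of_mem_columnMatroid hI).trans (card_of_mem_columnMatroid hJ).symm
  have hne : (I \ J).Nonempty := by
    rw [Finset.sdiff_nonempty]
    exact fun hsub => hIJ (Finset.eq_of_subset_of_card_le hsub hcard.ge)
  have hne' : (J \ I).Nonempty := by
    rw [Finset.sdiff_nonempty]
    exact fun hsub => hIJ (Finset.eq_of_subset_of_card_le hsub hcard.le).symm
  obtain ⟨e, he⟩ := hne
  obtain ⟨f, hf⟩ := hne'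
  rw [Finset.mem_sdiff] at he hf
  refine Finset.card_eq_one.2 ⟨e, ?_⟩
  rw [Finset.eq_singleton_iff_unique_mem]
  refine ⟨Finset.mem_sdiff.2 he, fun g hg => ?_⟩
  rw [Finset.mem_sdiff] at hg
  obtain ⟨e', h1, h2⟩ := hties e (Or.inl he)
  obtain ⟨f', h3, h4⟩ := hties f (Or.inr hf.symm)
  obtain ⟨g', h5, h6⟩ := hties g (Or.inl hg)
  have hef : e ≠ f := fun h => he.2 (h ▸ hf.1)
  have hgf : g ≠ f := fun h => hg.2 (h ▸ hf.1)
  have a1 := eq_or_eq_of_rate_eq hS hω h1 h2 h3 h4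
  have a2 := eq_or_eq_of_rate_eq hS hω h5 h6 h3 h4
  rcases a1 with ⟨-, h⟩ | ⟨-, h⟩
  · exact absurd h hef
  rcases a2 with ⟨-, h'⟩ | ⟨-, h'⟩
  · exact absurd h' hgf
  · rw [h, h']

/-- The direction of a dart that carries `r`. -/
theorem Dart.direction_eq_farDir {d : S.Dart} {B : Finset (Fin n)} {r i : Fin n} (hr : r ∉ B)
    (hi : i ∉ B) (h1 : d.1.1 = insert r B) (h2 : d.1.2 = insert i B) :
    d.direction = -S.farDir r i := by
  rw [d.direction_eq, wallDir, h1, h2, gradient_insert S hr, gradient_insert S hi, farDir]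
  ext <;> simp only [Prod.fst_neg, Prod.snd_neg] <;> ring

theorem Dart.FromInfinity.planeDot_le {d : S.Dart} (hd : d.FromInfinity) {L : Finset (Fin n)}
    (hL : L ∈ columnMatroid S.A) :
    planeDot (S.gradient L) (-d.direction) ≤ planeDot (S.gradient d.1.1) (-d.direction) := by
  obtain ⟨p, hp⟩ := d.2.2.2.2
  refine planeDot_le_of_ray (p := p) (J := d.1.2) (fun s hs => ?_) hL
  rw [smul_neg, ← sub_eq_add_neg]
  exact hd p hp s hs

theorem Dart.FromInfinity.isLocallyMaximal {d : S.Dart} (hd : d.FromInfinity) :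
    IsLocallyMaximal S.A (S.rate (-d.direction)) d.1.1 ∧
      IsLocallyMaximal S.A (S.rate (-d.direction)) d.1.2 := by
  refine ⟨isLocallyMaximal_of_forall_le (mem_columnMatroid_of_mem_regions d.2.1)
    fun L hL => hd.planeDot_le hL, isLocallyMaximal_of_forall_le
    (mem_columnMatroid_of_mem_regions d.2.2.1) fun L hL => (hd.planeDot_le hL).trans ?_⟩
  have := planeDot_wallDir S d.1.1 d.1.2
  rw [← d.direction_eq] at this
  simp only [planeDot, Prod.fst_neg, Prod.snd_neg] at this ⊢
  linarith

theorem Dart.FromInfinity.exists_insert (hS : S.HasGenericSlopes) (h0 : ∀ j, S.A.col j ≠ 0)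
    {π : Equiv.Perm (Fin n)} (hπ : IsCellDerangement S.A π) {d : S.Dart} (hd : d.FromInfinity)
    {r : Fin n} (hr : d.Carries r) : ∃ B i, r ∉ B ∧ i ∉ B ∧ r ≠ i ∧ d.1.1 = insert r B ∧
      d.1.2 = insert i B ∧ π i = r := by
  obtain ⟨B, i, hrB, hiB, hri, h1, h2⟩ := hr.exists_insert
  refine ⟨B, i, hrB, hiB, hri, h1, h2, ?_⟩
  have hloc := hd.isLocallyMaximal
  rw [Dart.direction_eq_farDir hrB hiB h1 h2, neg_neg, h1, h2] at hloc
  refine apply_eq_of_isLocallyMaximal hS h0 hπ hri hloc.1 hloc.2 ?_ (Finset.mem_insert_self _ _)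
  rw [Finset.mem_insert]
  rintro (h | h)
  · exact hri h.symm
  · exact hiB h

/-- The edge of type `{i, r}` has two orientations, and an incoming dart carrying `r` descends
exactly when `i < r`. So the prescription at `y ≫ 0` and `y ≪ 0` amounts to saying that the incoming
dart carries its label. -/
theorem Dart.label_iff (hS : S.HasGenericSlopes) (h0 : ∀ j, S.A.col j ≠ 0)
    {π : Equiv.Perm (Fin n)} (hπ : IsCellDerangement S.A π) {d : S.Dart} {r : Fin n} :
    (S.plabic π).label d r ↔ d.FromInfinity ∧ d.Carries r := by
  have hsymm : ∀ {B : Finset (Fin n)} {a b : Fin n}, a ∉ B → b ∉ B → a ≠ b →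
      symmDiff (insert a B) (insert b B) = {a, b} := by
    intro B a b ha hb hab
    rw [symmDiff_def, Finset.sup_eq_union, insert_sdiff_insert_eq ha hab,
      insert_sdiff_insert_eq hb hab.symm]
    rfl
  have hm : ∀ {a b}, S.κ a < S.κ b ↔ a < b := fun {a b} => hS.strictMono.lt_iff_lt
  constructor
  · rintro ⟨hd, i, htype, hπi, hdir⟩
    refine ⟨hd, ?_⟩
    obtain ⟨B, a, b, ha, hb, hab, h1, h2⟩ := d.exists_insert
    have hca : d.Carries a := ⟨h1 ▸ Finset.mem_insert_self _ _, by
      rw [h2, Finset.mem_insert, not_or]; exact ⟨hab, ha⟩⟩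
    rw [Dart.solitonType, h1, h2, hsymm ha hb hab] at htype
    rw [Dart.direction_eq_farDir ha hb h1 h2] at hdir
    simp only [farDir, Prod.snd_neg] at hdir
    have har : a ∈ ({i, r} : Finset (Fin n)) := htype ▸ (by simp)
    have hbr : b ∈ ({i, r} : Finset (Fin n)) := htype ▸ (by simp)
    simp only [Finset.mem_insert, Finset.mem_singleton] at har hbr
    rcases har with rfl | rfl
    · rcases hbr with rfl | rfl
      · exact absurd rfl hab
      · exfalso
        rcases hdir with ⟨h3, h4⟩ | ⟨h3, h4⟩
        · have := hm.2 h4; linarith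
        · have := hm.2 h4; linarith
    · exact hca
  · rintro ⟨hd, hr⟩
    obtain ⟨B, i, hrB, hiB, hri, h1, h2, hπi⟩ := hd.exists_insert hS h0 hπ hr
    refine ⟨hd, i, ?_, hπi, ?_⟩
    · rw [Dart.solitonType, h1, h2, hsymm hrB hiB hri, Finset.pair_comm]
    · rw [Dart.direction_eq_farDir hrB hiB h1 h2]
      simp only [farDir, Prod.snd_neg]
      rcases lt_or_gt_of_ne hri with h | h
      · right
        have := hm.2 h
        exact ⟨by linarith, h⟩
      · left
        have := hm.2 h
        exact ⟨by linarith, h⟩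

/-- `r` fixes `i = π⁻¹ r` and hence the direction of the ray. The regions on both sides have maximal
growth there, and only two sets do. -/
theorem Dart.FromInfinity.carries_unique (hS : S.HasGenericSlopes) (h0 : ∀ j, S.A.col j ≠ 0)
    {π : Equiv.Perm (Fin n)} (hπ : IsCellDerangement S.A π) {d d' : S.Dart} (hd : d.FromInfinity)
    (hd' : d'.FromInfinity) {r : Fin n} (hr : d.Carries r) (hr' : d'.Carries r) : d = d' := by
  have key : ∀ {d : S.Dart}, d.FromInfinity → d.Carries r → ∀ {B₀ : Finset (Fin n)} {i₀ : Fin n},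
      π i₀ = r → r ∉ B₀ → i₀ ∉ B₀ → (∀ L ∈ columnMatroid S.A, L ≠ insert r B₀ →
      L ≠ insert i₀ B₀ → planeDot (S.gradient L) (S.farDir r i₀) <
        planeDot (S.gradient (insert r B₀)) (S.farDir r i₀)) → insert r B₀ ∈ columnMatroid S.A →
      d.1 = (insert r B₀, insert i₀ B₀) := by
    intro d hd hr B₀ i₀ hπ0 hr0 hi0 hmax hM
    obtain ⟨B, i, hrB, hiB, hri, h1, h2, hπi⟩ := hd.exists_insert hS h0 hπ hr
    obtain rfl : i = i₀ := π.injective (hπi.trans hπ0.symm)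
    have hle : planeDot (S.gradient (insert r B₀)) (S.farDir r i) ≤
        planeDot (S.gradient d.1.1) (S.farDir r i) := by
      have := hd.planeDot_le hM
      rwa [Dart.direction_eq_farDir hrB hiB h1 h2, neg_neg] at this
    have hle' : planeDot (S.gradient (insert r B₀)) (S.farDir r i) ≤
        planeDot (S.gradient d.1.2) (S.farDir r i) := by
      refine hle.trans ?_
      rw [h1, h2, ← sum_rate, ← sum_rate, Finset.sum_insert hrB, Finset.sum_insert hiB,
        rate_farDir_right]
    refine Prod.ext ?_ ?_
    · by_contra h3
      by_cases h4 : d.1.1 = insert i B₀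
      · have := hr.1
        rw [h4, Finset.mem_insert] at this
        exact this.elim hri hr0
      · exact absurd (hmax _ (mem_columnMatroid_of_mem_regions d.2.1) h3 h4) (not_lt.2 hle)
    · by_contra h3
      by_cases h4 : d.1.2 = insert r B₀
      · exact hr.2 (h4 ▸ Finset.mem_insert_self _ _)
      · exact absurd (hmax _ (mem_columnMatroid_of_mem_regions d.2.2.1) h4 h3) (not_lt.2 hle')
  obtain ⟨B, h1, h2, h3, -, h5⟩ := exists_forall_lt_farDir hS h0 hπ (π.symm r)
  rw [π.apply_symm_apply] at h1 h3 h5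
  exact Subtype.ext ((key hd hr (π.apply_symm_apply r) h1 h2 h5 h3).trans
    (key hd' hr' (π.apply_symm_apply r) h1 h2 h5 h3).symm)

/-- On the line where the two fastest terms agree, all others eventually fall behind. Once on the
wall, one stays on it by comparing growth rates. -/
theorem exists_fromInfinity (hS : S.HasGenericSlopes) (h0 : ∀ j, S.A.col j ≠ 0)
    {π : Equiv.Perm (Fin n)} (hπ : IsCellDerangement S.A π) (r : Fin n) :
    ∃ d : S.Dart, d.FromInfinity ∧ d.Carries r := by
  obtain ⟨B, hrB, hiB, hI, hJ, hmax⟩ := exists_forall_lt_farDir hS h0 hπ (π.symm r)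
  have hri := hπ.apply_ne (π.symm r)
  rw [π.apply_symm_apply] at hrB hI hmax hri
  set i := π.symm r with hi
  set ω := S.farDir r i with hω
  have hIJ : planeDot (S.gradient (insert r B)) ω = planeDot (S.gradient (insert i B)) ω := by
    rw [← sum_rate, ← sum_rate, Finset.sum_insert hrB, Finset.sum_insert hiB, rate_farDir_right]
  have hcard : insert r B \ insert i B = {r} := insert_sdiff_insert_eq hrB hri
  have hne : insert r B ≠ insert i B := by
    intro h
    rw [h, sdiff_self] at hcard
    exact absurd hcard.symm (Finset.singleton_ne_empty r)
  have hslope : (S.gradient (insert r B)).1 - (S.gradient (insert i B)).1 ≠ 0 :=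
    sub_ne_zero.2 fun h => hne (hS.inj _ hI _ hJ h)
  obtain ⟨p, hp⟩ : ∃ p, S.term (insert r B) p = S.term (insert i B) p := by
    -- The point of this line on the `x`-axis, which exists because the `x`-slopes differ.
    refine ⟨((S.term (insert i B) 0 - S.term (insert r B) 0) /
      ((S.gradient (insert r B)).1 - (S.gradient (insert i B)).1), 0), ?_⟩
    rw [S.term_eq (insert r B) (_, 0), S.term_eq (insert i B) (_, 0)]
    have h2 := div_mul_cancel₀ (S.term (insert i B) 0 - S.term (insert r B) 0) hslope
    linarith
  have hev : ∀ᶠ s : ℝ in Filter.atTop, ∀ L ∈ columnMatroid S.A, L ≠ insert r B → L ≠ insert i B →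
      S.term L (p + s • ω) < S.term (insert r B) (p + s • ω) := by
    rw [Filter.eventually_all_finset]
    intro L hL
    by_cases h1 : L = insert r B
    · exact Filter.Eventually.of_forall fun _ h => absurd h1 h
    by_cases h2 : L = insert i B
    · exact Filter.Eventually.of_forall fun _ _ h => absurd h2 h
    have hlt := sub_pos.2 (hmax L hL h1 h2)
    filter_upwards [Filter.eventually_gt_atTop ((S.term L p - S.term (insert r B) p) /
      (planeDot (S.gradient (insert r B)) ω - planeDot (S.gradient L) ω))] with s hs _ _
    rw [term_add_smul, term_add_smul]
    rw [div_lt_iff₀ hlt] at hs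
    linarith
  obtain ⟨s, hs⟩ := hev.exists
  have hw : p + s • ω ∈ S.wall (insert r B) (insert i B) := by
    refine regionsAt_eq_pair hS.toHasDistinctSlopes hI hJ hne ?_ hs
    rw [term_add_smul, term_add_smul, hp, hIJ]
  have hsol : S.IsLineSoliton (insert r B) (insert i B) :=
    ⟨(mem_regionsAt.1 (mem_regionsAt_left hw)).1, (mem_regionsAt.1 (mem_regionsAt_right hw)).1,
      by rw [hcard, Finset.card_singleton], _, hw⟩
  let d : S.Dart := ⟨(insert r B, insert i B), hsol⟩
  have hdir : d.direction = -ω := Dart.direction_eq_farDir hrB hiB rfl rfl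
  refine ⟨d, ?_, Finset.mem_insert_self _ _, ?_⟩
  · intro q hq t ht
    change q ∈ S.wall (insert r B) (insert i B) at hq
    show q - t • d.direction ∈ S.wall (insert r B) (insert i B)
    rw [hdir, smul_neg, sub_neg_eq_add]
    rcases ht.eq_or_lt with rfl | ht
    · rwa [zero_smul, add_zero]
    have hq' := term_eq_of_mem_regionsAt (mem_regionsAt_left hq) (mem_regionsAt_right hq)
    refine regionsAt_eq_pair hS.toHasDistinctSlopes hI hJ hne ?_ fun L hL h1 h2 => ?_
    · rw [term_add_smul, term_add_smul, hq', hIJ]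
    · rw [term_add_smul, term_add_smul]
      have h3 := term_le_f hL q
      rw [← (mem_regionsAt.1 (mem_regionsAt_left hq)).2] at h3
      have h4 := mul_lt_mul_of_pos_left (hmax L hL h1 h2) ht
      linarith
  · show r ∉ insert i B
    rw [Finset.mem_insert, not_or]
    exact ⟨hri, hrB⟩

end SolitonData

namespace SolitonData

variable {k n : ℕ} {S : SolitonData k n}

/-! ### The regions are connected through line-solitons -/

theorem IsNode.reflTransGen {m : ℕ} [NeZero m] {p : ℝ × ℝ} {R : Fin m → Finset (Fin n)}
    (h : S.IsNode p R) {I J : Finset (Fin n)} (hI : I ∈ S.regionsAt p) (hJ : J ∈ S.regionsAt p) :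
    Relation.ReflTransGen S.IsLineSoliton I J := by
  have key : ∀ (j : ℕ) (hj : j < m), Relation.ReflTransGen S.IsLineSoliton (R 0) (R ⟨j, hj⟩) ∧
      Relation.ReflTransGen S.IsLineSoliton (R ⟨j, hj⟩) (R 0) := by
    intro j
    induction j with
    | zero => exact fun _ => ⟨.refl, .refl⟩
    | succ j ih =>
      intro hj
      have hsucc : (⟨j + 1, hj⟩ : Fin m) = ⟨j, by omega⟩ + 1 := by
        apply Fin.ext
        rw [Fin.val_add]
        simp [Nat.mod_eq_of_lt hj]
      have hs := h.soliton ⟨j, by omega⟩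
      rw [hsucc]
      exact ⟨(ih _).1.tail hs.symm, (ih _).2.head hs⟩
  obtain ⟨a, rfl⟩ := (h.range_eq I).2 ⟨p, mem_nodePoints_self p, hI⟩
  obtain ⟨b, rfl⟩ := (h.range_eq J).2 ⟨p, mem_nodePoints_self p, hJ⟩
  exact (key a a.2).2.trans (key b b.2).1

/-- At a node one walks around it. Otherwise `p` lies on a wall; if this is a phase shift, it is
bounded, and both regions meet a node at its end. -/
theorem reflTransGen_of_mem_regionsAt (hS : S.HasGenericSlopes) (hC : S.IsGeneric) {p : ℝ × ℝ}
    {I J : Finset (Fin n)} (hI : I ∈ S.regionsAt p) (hJ : J ∈ S.regionsAt p) :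
    Relation.ReflTransGen S.IsLineSoliton I J := by
  have h3 : ∀ {p : ℝ × ℝ}, 3 ≤ (S.regionsAt p).card → I ∈ S.regionsAt p → J ∈ S.regionsAt p →
      Relation.ReflTransGen S.IsLineSoliton I J := by
    intro p hp hI hJ
    rcases exists_node hS hC hp with ⟨R, h, -⟩ | ⟨R, h, -⟩ | ⟨R, h, -⟩ <;>
      exact h.reflTransGen hI hJ
  rcases eq_or_ne I J with rfl | hIJ
  · exact .refl
  rcases le_or_gt 3 (S.regionsAt p).card with hp | hp
  · exact h3 hp hI hJ
  have hw : p ∈ S.wall I J := by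
    rw [mem_wall]
    refine (Finset.eq_of_subset_of_card_le ?_ ?_).symm
    · intro L hL
      rcases Finset.mem_insert.1 hL with rfl | hL
      · exact hI
      · exact (Finset.mem_singleton.1 hL) ▸ hJ
    · rw [Finset.card_pair hIJ]; omega
  have hIr := (mem_regionsAt.1 hI).1
  have hJr := (mem_regionsAt.1 hJ).1
  by_cases hc : (I \ J).card = 1
  · exact .single ⟨hIr, hJr, hc, p, hw⟩
  · have hdir : (-S.wallDir I J).2 ≠ 0 :=
      neg_ne_zero.2 (wallDir_snd_ne_zero hS.toHasDistinctSlopes hIr hJr hIJ)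
    obtain ⟨s, hs, hps⟩ : ∃ s : ℝ, 0 ≤ s ∧ p - s • S.wallDir I J ∉ S.wall I J := by
      by_contra! hno
      refine hc (card_sdiff_eq_one_of_ray (p := p) hS hdir hIJ fun s hs => ?_)
      rw [smul_neg, ← sub_eq_add_neg]
      exact hno s hs
    obtain ⟨q, hq⟩ := exists_wallStartsAt hS.toHasDistinctSlopes hw hs hps
    have hq' := (wallStartsAt_iff hS.toHasDistinctSlopes).1 hq
    exact h3 (hq.three_le_card hS.toHasDistinctSlopes hIJ) hq'.1 hq'.2.1

theorem exists_mem_regionsAt {J : Finset (Fin n)} (hJ : J ∈ S.regions) :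
    ∃ p, J ∈ S.regionsAt p := by
  have h := hJ
  simp only [regions, Finset.mem_filter] at h
  obtain ⟨p, hp⟩ := h.2
  have hp' : ∀ᶠ q in 𝓝 p, S.f q = S.term J q := hp
  exact ⟨p, mem_regionsAt.2 ⟨hJ, hp'.self_of_nhds.symm⟩⟩

/-- The points all of whose regions can be reached from `I` form a nonempty set that is open and
closed in the plane, by semicontinuity of the regions at a point. -/
theorem reflTransGen_isLineSoliton (hS : S.HasGenericSlopes) (hC : S.IsGeneric)
    {I J : Finset (Fin n)} (hI : I ∈ S.regions) (hJ : J ∈ S.regions) :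
    Relation.ReflTransGen S.IsLineSoliton I J := by
  obtain ⟨p, hp⟩ := exists_mem_regionsAt hI
  obtain ⟨q, hq⟩ := exists_mem_regionsAt hJ
  set U : Set (ℝ × ℝ) :=
    {x | ∀ L ∈ S.regionsAt x, Relation.ReflTransGen S.IsLineSoliton I L} with hU
  have hopen : IsOpen U := by
    refine isOpen_iff_mem_nhds.2 fun x hx => ?_
    filter_upwards [eventually_regionsAt_subset hS.toHasDistinctSlopes x] with y hy L hL
    exact hx L (hy hL)
  have hclosed : IsClosed U := by
    refine ⟨isOpen_iff_mem_nhds.2 fun x hx => ?_⟩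
    filter_upwards [eventually_regionsAt_subset hS.toHasDistinctSlopes x] with y hy hyU
    obtain ⟨L, hL⟩ := regionsAt_nonempty hS.toHasDistinctSlopes y
    exact hx fun L' hL' => (hyU L hL).trans (reflTransGen_of_mem_regionsAt hS hC (hy hL) hL')
  have huniv := IsClopen.eq_univ ⟨hclosed, hopen⟩
    ⟨p, fun L hL => reflTransGen_of_mem_regionsAt hS hC hp hL⟩
  exact (huniv ▸ Set.mem_univ q : q ∈ U) J hq

/-! ### Trips follow the indices that the darts carry -/

theorem Dart.exists_carries (d : S.Dart) : ∃ r, d.Carries r := by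
  obtain ⟨B, i, j, hi, hj, hij, h1, h2⟩ := d.exists_insert
  refine ⟨i, h1 ▸ Finset.mem_insert_self _ _, ?_⟩
  rw [h2, Finset.mem_insert, not_or]
  exact ⟨hij, hi⟩

theorem Dart.Carries.unique {d : S.Dart} {r s : Fin n} (hr : d.Carries r) (hs : d.Carries s) :
    r = s := by
  have h := d.2.2.2.1
  exact Finset.card_le_one.1 h.le r (Finset.mem_sdiff.2 hr) s (Finset.mem_sdiff.2 hs)

theorem Dart.mem_solitonType {d : S.Dart} {r : Fin n} :
    r ∈ d.solitonType ↔ d.Carries r ∨ d.rev.Carries r :=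
  Finset.mem_symmDiff

variable (π : Equiv.Perm (Fin n))

/-- There are finitely many darts and no cycles, so paths can be followed backwards by induction;
the reversed relation serves for following them forwards. -/
theorem wellFounded_step (hS : S.HasGenericSlopes) (hC : S.IsGeneric) (r : Fin n) :
    WellFounded (Relation.TransGen fun d d' : S.Dart => d.Carries r ∧ (S.plabic π).Step d d') := by
  have : Std.Irrefl
      (Relation.TransGen fun d d' : S.Dart => d.Carries r ∧ (S.plabic π).Step d d') :=
    ⟨not_transGen_step π hS hC r⟩
  exact Finite.wellFounded_of_trans_of_irrefl _

theorem wellFounded_step_swap (hS : S.HasGenericSlopes) (hC : S.IsGeneric) (r : Fin n) :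
    WellFounded (Function.swap
      (Relation.TransGen fun d d' : S.Dart => d.Carries r ∧ (S.plabic π).Step d d')) := by
  have : Std.Irrefl (Function.swap
      (Relation.TransGen fun d d' : S.Dart => d.Carries r ∧ (S.plabic π).Step d d')) :=
    ⟨not_transGen_step π hS hC r⟩
  have : IsTrans _ (Function.swap
      (Relation.TransGen fun d d' : S.Dart => d.Carries r ∧ (S.plabic π).Step d d')) :=
    ⟨fun _ _ _ h1 h2 => h2.trans h1⟩
  exact Finite.wellFounded_of_trans_of_irrefl _

variable {π}

/-- Steps preserve the carried index. Conversely, a dart carrying `r` has predecessors carrying `r`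
until one comes from infinity, and that one starts at the boundary vertex labelled `r`. -/
theorem onTrip_iff (hS : S.HasGenericSlopes) (hC : S.IsGeneric) (h0 : ∀ j, S.A.col j ≠ 0)
    (hπ : IsCellDerangement S.A π) {r : Fin n} {d : S.Dart} :
    (S.plabic π).OnTrip r d ↔ d.Carries r := by
  constructor
  · rintro ⟨d₀, -, hlabel, hpath⟩
    have hc := ((Dart.label_iff hS h0 hπ).1 hlabel).2
    induction hpath with
    | refl => exact hc
    | tail _ hs ih => exact ((step_carries_iff π hS hC hs).2 r).1 ih
  · intro hd
    induction d using (wellFounded_step π hS hC r).induction with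
    | h d ih =>
      by_cases hinf : d.FromInfinity
      · exact ⟨d, Dart.kind_eq_boundary_iff.2 hinf, (Dart.label_iff hS h0 hπ).2 ⟨hinf, hd⟩, .refl⟩
      · obtain ⟨d₁, hs⟩ := Dart.exists_step_to π hS hC hinf
        have hd₁ := ((step_carries_iff π hS hC hs).2 r).2 hd
        obtain ⟨d₀, hk, hl, hp⟩ := ih d₁ (.single ⟨hd₁, hs⟩) hd₁
        exact ⟨d₀, hk, hl, hp.tail hs⟩

theorem Dart.Carries.exists_rev_fromInfinity (π : Equiv.Perm (Fin n)) (hS : S.HasGenericSlopes)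
    (hC : S.IsGeneric) {r : Fin n} {d : S.Dart} (hd : d.Carries r) :
    ∃ d' : S.Dart, d'.Carries r ∧ d'.rev.FromInfinity := by
  induction d using (wellFounded_step_swap π hS hC r).induction with
  | h d ih =>
    by_cases hinf : d.rev.FromInfinity
    · exact ⟨d, hd, hinf⟩
    · obtain ⟨d₁, hs⟩ := Dart.exists_step π hS hC hinf
      exact ih d₁ (.single ⟨hd, hs⟩) (((step_carries_iff π hS hC hs).2 r).1 hd)

theorem isTripPermutation (hS : S.HasGenericSlopes) (hC : S.IsGeneric)
    (h0 : ∀ j, S.A.col j ≠ 0) (hπ : IsCellDerangement S.A π) :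
    (S.plabic π).IsTripPermutation π := by
  -- The reversal of a last dart comes in from infinity and carries `j`, so its type is `{π⁻¹ j,
  -- j}`; the index carried outwards is the other one.
  have key : ∀ {d : S.Dart} {i j : Fin n}, d.Carries i → d.rev.FromInfinity → d.rev.Carries j →
      π i = j := by
    intro d i j hi hinf hj
    obtain ⟨B, i', hjB, hiB, hij, h1, h2, hπi⟩ := hinf.exists_insert hS h0 hπ hj
    have h1' : d.1.2 = insert j B := h1
    have h2' : d.1.1 = insert i' B := h2
    have h3 := hi.1
    have h4 := hi.2
    rw [h2', Finset.mem_insert] at h3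
    rw [h1', Finset.mem_insert, not_or] at h4
    rw [h3.resolve_right h4.2]
    exact hπi
  intro i j
  constructor
  · rintro ⟨d, hd, -, hl⟩
    obtain ⟨hinf, hj⟩ := (Dart.label_iff hS h0 hπ).1 hl
    exact key ((onTrip_iff hS hC h0 hπ).1 hd) hinf hj
  · rintro rfl
    obtain ⟨d₀, -, hd₀⟩ := exists_fromInfinity hS h0 hπ i
    obtain ⟨d, hd, hinf⟩ := hd₀.exists_rev_fromInfinity π hS hC
    obtain ⟨j, hj⟩ := d.rev.exists_carries
    have := key hd hinf hj
    rw [this]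
    exact ⟨d, (onTrip_iff hS hC h0 hπ).2 hd, Dart.kind_eq_boundary_iff.2 hinf,
      (Dart.label_iff hS h0 hπ).2 ⟨hinf, hj⟩⟩

/-! ### Labels of edges and regions. -/

theorem edgeLabels_eq (hS : S.HasGenericSlopes) (hC : S.IsGeneric)
    (h0 : ∀ j, S.A.col j ≠ 0) (hπ : IsCellDerangement S.A π) (d : S.Dart) :
    (S.plabic π).edgeLabels d = (d.solitonType : Set (Fin n)) := by
  ext r
  rw [Finset.mem_coe, Dart.mem_solitonType, ← onTrip_iff hS hC h0 hπ, ← onTrip_iff hS hC h0 hπ]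
  rfl

theorem adjOffTrip_iff (hS : S.HasGenericSlopes) (hC : S.IsGeneric)
    (h0 : ∀ j, S.A.col j ≠ 0) (hπ : IsCellDerangement S.A π) {r : Fin n} {R R' : S.Region} :
    (S.plabic π).AdjOffTrip r R R' ↔ S.IsLineSoliton R.1 R'.1 ∧ (r ∈ R.1 ↔ r ∈ R'.1) := by
  constructor
  · rintro ⟨d, rfl, rfl, hr⟩
    have hr' : r ∉ symmDiff d.1.1 d.1.2 := fun h =>
      hr ((edgeLabels_eq hS hC h0 hπ d).symm.subset h)
    rw [Finset.mem_symmDiff] at hr'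
    refine ⟨d.2, ?_⟩
    change r ∈ d.1.1 ↔ r ∈ d.1.2
    tauto
  · rintro ⟨hsol, hr⟩
    refine ⟨⟨(R.1, R'.1), hsol⟩, rfl, rfl, fun h => ?_⟩
    have hr' : r ∈ symmDiff R.1 R'.1 := (edgeLabels_eq hS hC h0 hπ ⟨(R.1, R'.1), hsol⟩).subset h
    rw [Finset.mem_symmDiff] at hr'
    tauto

theorem mem_iff_of_adjOffTrip (hS : S.HasGenericSlopes) (hC : S.IsGeneric)
    (h0 : ∀ j, S.A.col j ≠ 0) (hπ : IsCellDerangement S.A π) {r : Fin n} {R R' : S.Region}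
    (h : Relation.ReflTransGen ((S.plabic π).AdjOffTrip r) R R') : r ∈ R.1 ↔ r ∈ R'.1 := by
  induction h with
  | refl => rfl
  | tail _ h ih => exact ih.trans ((adjOffTrip_iff hS hC h0 hπ).1 h).2

/-- Go through line-solitons from `R` to some region without `r`. Up to the first edge across which
`r` is lost no edge belongs to the trip, and that edge is a dart of the trip with the reached region
on its left. -/
theorem isLeftOfTrip_iff (hS : S.HasGenericSlopes) (hC : S.IsGeneric)
    (h0 : ∀ j, S.A.col j ≠ 0) (hπ : IsCellDerangement S.A π) {r : Fin n} {R : S.Region} :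
    (S.plabic π).IsLeftOfTrip r R ↔ r ∈ R.1 := by
  constructor
  · rintro ⟨d, hd, hp⟩
    exact (mem_iff_of_adjOffTrip hS hC h0 hπ hp).1 ((onTrip_iff hS hC h0 hπ).1 hd).1
  · obtain ⟨d₀, -, hd₀⟩ := exists_fromInfinity hS h0 hπ r
    obtain ⟨J, hJ⟩ := R
    have hpath := reflTransGen_isLineSoliton hS hC hJ d₀.2.2.1
    induction hpath using Relation.ReflTransGen.head_induction_on with
    | refl => exact fun h => absurd h hd₀.2
    | head h _ ih =>
      rename_i J J' _
      intro hr
      by_cases hr' : r ∈ J'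
      · obtain ⟨d, hd, hp⟩ := ih h.2.1 hr'
        exact ⟨d, hd, hp.tail ((adjOffTrip_iff hS hC h0 hπ).2 ⟨h.symm, iff_of_true hr' hr⟩)⟩
      · exact ⟨⟨(J, J'), h⟩, (onTrip_iff hS hC h0 hπ).2 ⟨hr, hr'⟩, .refl⟩

theorem isRightOfTrip_iff (hS : S.HasGenericSlopes) (hC : S.IsGeneric)
    (h0 : ∀ j, S.A.col j ≠ 0) (hπ : IsCellDerangement S.A π) {r : Fin n} {R : S.Region} :
    (S.plabic π).IsRightOfTrip r R ↔ r ∉ R.1 := by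
  constructor
  · rintro ⟨d, hd, hp⟩
    exact fun hr => ((onTrip_iff hS hC h0 hπ).1 hd).2 ((mem_iff_of_adjOffTrip hS hC h0 hπ hp).2 hr)
  · obtain ⟨d₀, -, hd₀⟩ := exists_fromInfinity hS h0 hπ r
    obtain ⟨J, hJ⟩ := R
    -- The same walk, but towards a region that contains `r`.
    have hpath := reflTransGen_isLineSoliton hS hC hJ d₀.2.1
    induction hpath using Relation.ReflTransGen.head_induction_on with
    | refl => exact fun h => absurd hd₀.1 h
    | head h _ ih =>
      rename_i J J' _
      intro hr
      by_cases hr' : r ∈ J'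
      · exact ⟨⟨(J', J), h.symm⟩, (onTrip_iff hS hC h0 hπ).2 ⟨hr', hr⟩, .refl⟩
      · obtain ⟨d, hd, hp⟩ := ih h.2.1 hr'
        exact ⟨d, hd, hp.tail ((adjOffTrip_iff hS hC h0 hπ).2 ⟨h.symm, iff_of_false hr' hr⟩)⟩

/-! ### Assembly of the graph structure and of the genericity conditions. -/

theorem isGeneralizedPlabicGraph (hS : S.HasGenericSlopes) (hC : S.IsGeneric)
    (h0 : ∀ j, S.A.col j ≠ 0) (hπ : IsCellDerangement S.A π) :
    (S.plabic π).IsGeneralizedPlabicGraph where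
  finite_dart := inferInstanceAs (Finite S.Dart)
  rev_rev := Dart.rev_rev
  rev_ne d h := d.2.ne (congrArg (fun d : S.Dart => d.1.2) h)
  exists_next d := (Dart.existsUnique_ccw π hS hC d).1
  exists_prev d := (Dart.existsUnique_ccw π hS hC d).2
  kind_eq _ _ h := Dart.kind_eq_of_ccw π hS hC h
  corner d d' hk h := by
    rcases h with ⟨hinf, -⟩ | ⟨-, h⟩
    · exact absurd (Dart.kind_eq_boundary_iff.2 hinf) hk
    · exact Subtype.ext h
  boundary_degree d h := Or.inl ⟨Dart.kind_eq_boundary_iff.1 h, rfl⟩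
  crossing_degree _ h := Dart.exists_four_of_crossing π hS hC h
  boundary_label d h := by
    obtain ⟨r, hr⟩ := Dart.exists_carries d
    exact ⟨r, (Dart.label_iff hS h0 hπ).2 ⟨Dart.kind_eq_boundary_iff.1 h, hr⟩,
      fun s hs => ((Dart.label_iff hS h0 hπ).1 hs).2.unique hr⟩
  exists_boundary r := by
    obtain ⟨d, hd, hr⟩ := exists_fromInfinity hS h0 hπ r
    refine ⟨d, ⟨Dart.kind_eq_boundary_iff.2 hd, (Dart.label_iff hS h0 hπ).2 ⟨hd, hr⟩⟩, ?_⟩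
    rintro d' ⟨-, hl⟩
    obtain ⟨hd', hr'⟩ := (Dart.label_iff hS h0 hπ).1 hl
    exact Dart.FromInfinity.carries_unique hS h0 hπ hd' hd hr' hr

/-- The genericity assumption concerns sums of `p` parameters with `1 < p < n`; the cases `p = 0`,
`p = 1` and `p = n` are settled directly. -/
theorem GenericParameters.hasGenericSlopes (hκ : S.GenericParameters) (hA : S.A.rank = k)
    (hπ : IsCellDerangement S.A π) : S.HasGenericSlopes where
  nonempty := by
    -- Without columns the rank forces `k = 0` and the empty set is a basis; otherwise the necklace
    -- supplies one.
    rcases n.eq_zero_or_pos with rfl | hn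
    · obtain rfl : k = 0 := by
        have := S.A.rank_le_width
        omega
      exact ⟨∅, mem_columnMatroid.2 ⟨rfl, by simp⟩⟩
    · obtain ⟨N, hN, -⟩ := hπ
      exact ⟨_, (hN ⟨0, hn⟩).1⟩
  inj := by
    intro I hI J hJ h
    have hIk := card_of_mem_columnMatroid hI
    have hJk := card_of_mem_columnMatroid hJ
    by_cases h1 : I.card = 0
    · rw [Finset.card_eq_zero.1 h1, Finset.card_eq_zero.1 (hJk.trans (hIk.symm.trans h1))]
    by_cases h2 : I.card = 1
    · obtain ⟨a, rfl⟩ := Finset.card_eq_one.1 h2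
      obtain ⟨b, rfl⟩ := Finset.card_eq_one.1 (hJk.trans (hIk.symm.trans h2))
      simp only [gradient, Finset.sum_singleton] at h
      rw [hκ.1.injective h]
    by_cases h3 : I.card < n
    · exact hκ.2 I J (hIk.trans hJk.symm) (by omega) h3 h
    · have hun : ∀ L : Finset (Fin n), ¬ L.card < n → L = Finset.univ := fun L hL =>
        (Finset.card_eq_iff_eq_univ L).1 (le_antisymm (Finset.card_le_univ L) (by simpa using hL))
      rw [hun I h3, hun J (by omega)]
  strictMono := hκ.1
  pair_sums := by
    intro i j l m hij hlm h
    have hset : ({i, j} : Finset (Fin n)) = {l, m} := by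
      by_cases hn : 2 < n
      · refine hκ.2 _ _ (by rw [Finset.card_pair hij, Finset.card_pair hlm])
          (by rw [Finset.card_pair hij]; norm_num) (by rwa [Finset.card_pair hij]) ?_
        rwa [Finset.sum_pair hij, Finset.sum_pair hlm]
      -- For `n ≤ 2` there is at most one pair, the whole index set.
      · have hun : ∀ a b : Fin n, a ≠ b → ({a, b} : Finset (Fin n)) = Finset.univ := by
          intro a b hab
          refine (Finset.card_eq_iff_eq_univ _).1 (le_antisymm (Finset.card_le_univ _) ?_)
          rw [Finset.card_pair hab, Fintype.card_fin]
          omega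
        rw [hun i j hij, hun l m hlm]
    have hi : i ∈ ({l, m} : Finset (Fin n)) := hset ▸ (by simp)
    have hj : j ∈ ({l, m} : Finset (Fin n)) := hset ▸ (by simp)
    simp only [Finset.mem_insert, Finset.mem_singleton] at hi hj
    rcases hi with rfl | rfl <;> rcases hj with rfl | rfl
    · exact absurd rfl hij
    · exact Or.inl ⟨rfl, rfl⟩
    · exact Or.inr ⟨rfl, rfl⟩
    · exact absurd rfl hij

end SolitonData

theorem mainTheorem10 {k n : ℕ} (S : SolitonData k n) (π : Equiv.Perm (Fin n))
    (hκ : S.GenericParameters) (hA : IsTotallyNonneg S.A) (hirr : IsIrreduciblePoint S.A)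
    (hπ : IsCellDerangement S.A π) (hC : S.IsGeneric) :
    (S.plabic π).IsGeneralizedPlabicGraph ∧
    (S.plabic π).IsTripPermutation π ∧
    (∀ d : S.Dart, (S.plabic π).edgeLabels d = (d.solitonType : Set (Fin n))) ∧
    (∀ (r : Fin n) (R : S.Region),
      (S.plabic π).IsLeftOfTrip r R ↔ ¬ (S.plabic π).IsRightOfTrip r R) ∧
    (∀ R : S.Region, (S.plabic π).regionLabels R = (R.1 : Set (Fin n))) := by
  have hS := hκ.hasGenericSlopes hA.1 hπ
  have h0 := col_ne_zero_of_isIrreduciblePoint hirr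
  refine ⟨SolitonData.isGeneralizedPlabicGraph hS hC h0 hπ,
    SolitonData.isTripPermutation hS hC h0 hπ, SolitonData.edgeLabels_eq hS hC h0 hπ,
    fun r R => ?_, fun R => Set.ext fun r => SolitonData.isLeftOfTrip_iff hS hC h0 hπ⟩
  rw [SolitonData.isLeftOfTrip_iff hS hC h0 hπ, SolitonData.isRightOfTrip_iff hS hC h0 hπ, not_not]
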